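/- **Setting.** Let $K\ge 1$. A decision maker (DM) faces an unknown state vector $\theta=(\theta_1,\dots,\theta_K)'\sim\mathcal N(\mu^0,V^0)$ with $V^0$ positive definite. An observation of source $k\in\{1,\dots,K\}$ is $X_k=\langle c_k,\theta\rangle+\epsilon_k$ with $\epsilon_k\sim\mathcal N(0,\sigma_k^2)$, $\sigma_k^2>0$, where all noise terms are independent of each other and of $\theta$. The matrix $C$ with rows $c_1',\dots,c_K'$ is invertible and the first row of $C^{-1}$ has no zero entry. In each period $t=1,2,\dots$ the DM chooses, as a measurable function of the history of observations, a finite multiset of sources, whose size $N_t\in\mathbb Z_+$ (the intensity) is chosen freely, then sees the signal realizations, and then chooses an action $a_t\in A_t$ as a measurable function of the history. The payoff is $$U(a_1,a_2,\dots;\theta_1)-\sum_{t\ge1}\delta^{t-1}\kappa(N_t),$$ where $A_1,A_2,\dots$ are arbitrary measurable spaces, $U$ is an arbitrary measurable real function, $\delta\in(0,1]$, and $\kappa:\mathbb Z_+\to[0,\infty]$ with $\kappa(0)=0$ is a cost function (typically increasing, but this is not needed). Only strategies for which the positive part of the payoff has finite expectation are compared; their expected payoffs lie in $[-\infty,\infty)$.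 Let $f(q_1,\dots,q_K)=\big[\big((V^0)^{-1}+C'\,\mathrm{diag}(q_1/\sigma_1^2,\dots,q_K/\sigma_K^2)\,C\big)^{-1}\big]_{11}$ be the posterior variance of $\theta_1$ after $q_k\in\mathbb Z_+$ observations of each source $k$. The environment $(V^0,C,\{\sigma_k^2\})$ is *separable* if there are convex functions $g_1,\dots,g_K:[0,\infty)\to(-\infty,+\infty]$ and a function $F$, strictly increasing on the set of values taken by the sum, such that $f(q_1,\dots,q_K)=F(g_1(q_1)+\dots+g_K(q_K))$ for all $q\in\mathbb Z_+^K$. A strategy *chooses signals myopically* if at every history, given the number $N_t$ of signals that it acquires in that period, the multiset it acquires minimizes the resulting posterior variance of $\theta_1$ among all multisets of $N_t$ sources. **Statement.** (a) There is $B_0$, depending only on $(V^0,C,\{\sigma_k^2\})$, such that the following holds for every $B\ge B_0$, every $\mu^0$ and all $A_t$, $U$, $\delta$, $\kappa$ with $\kappa(B)\le\kappa(N)$ for $1\le N\le B$ (acquiring between $1$ and $B$ signals is never cheaper than acquiring $B$; for example $\kappa=0$ on $\{0,\dots,B\}$, or $\kappa=\infty$ on $\{1,\dots,B-1\}$): every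 strategy is weakly dominated, in expected payoff, by a strategy that chooses signals myopically; in particular, if the DM has an optimal strategy, then he has one that chooses signals myopically. (b) If the environment is separable, the same conclusion holds for every $\mu^0$ and all $A_t$, $U$, $\delta$, $\kappa$. -/

import Mathlib

open MeasureTheory ProbabilityTheory
open scoped NNReal ENNReal Matrix

universe u

namespace SignalAcquisition

/-! ### The informational environment -/

/-- The data `(V⁰, C, {σ_k²})` of a Gaussian informational environment with `K` states and `K`
sources. An observation of source `k` is `⟨c_k, θ⟩ + ε_k`, where `c_k` is the `k`-th row of `C`
and `ε_k ∼ 𝒩(0, σ_k²)`. -/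
structure InfoEnv (K : ℕ) where
  /-- prior covariance matrix of the state vector -/
  V₀ : Matrix (Fin K) (Fin K) ℝ
  /-- coefficient matrix of the sources -/
  C : Matrix (Fin K) (Fin K) ℝ
  /-- noise variances of the sources -/
  sigmaSq : Fin K → ℝ≥0

namespace InfoEnv

variable {K : ℕ}

/-- Non-redundancy: `C` is invertible and the first row of `C⁻¹` has only non-zero entries (so that
`e₁` is not spanned by any proper subset of the rows of `C`). The payoff-relevant state `θ₁` has
index `0`. -/
def NonRedundant [NeZero K] (E : InfoEnv K) : Prop :=
  IsUnit E.C ∧ ∀ k, E.C⁻¹ 0 k ≠ 0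

/-- The posterior variance `f(q₁, …, q_K)` of `θ₁` after `q_k` observations of each source `k`: the
`(1,1)` entry of the Gaussian posterior covariance matrix `((V⁰)⁻¹ + Cᵀ D C)⁻¹`, where
`D = diag(q_k / σ_k²)`. It does not depend on the realizations. -/
noncomputable def posteriorVar [NeZero K] (E : InfoEnv K) (q : Fin K → ℕ) : ℝ :=
  (E.V₀⁻¹ + E.Cᵀ * Matrix.diagonal (fun k => (q k : ℝ) / (E.sigmaSq k : ℝ)) * E.C)⁻¹ 0 0

/-- A convex function `[0, ∞) → (-∞, +∞]`. -/
def IsConvex (g : ℝ≥0 → EReal) : Prop :=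
  (∀ x, g x ≠ ⊥) ∧
    ∀ x y a b : ℝ≥0, 0 < a → 0 < b → a + b = 1 →
      g (a * x + b * y) ≤ ((a : ℝ) : EReal) * g x + ((b : ℝ) : EReal) * g y

/-- Separability: `f(q₁, …, q_K) = F(g₁(q₁) + ⋯ + g_K(q_K))` for all signal counts, with convex
`g_k` and with `F` strictly increasing on the values that the sum takes. The value `+∞` is allowed
for the `g_k`, as in `g(q) = σ² / q` at `q = 0`. -/
def Separable [NeZero K] (E : InfoEnv K) : Prop :=
  ∃ (g : Fin K → ℝ≥0 → EReal) (F : EReal → ℝ),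
    (∀ k, IsConvex (g k)) ∧
    StrictMonoOn F (Set.range fun q : Fin K → ℕ => ∑ k, g k (q k)) ∧
    ∀ q : Fin K → ℕ, E.posteriorVar q = F (∑ k, g k (q k))

end InfoEnv

/-! ### Histories and strategies -/

/-- What is observed in one period: how many times each source is sampled, and the resulting signal
realizations. -/
abbrev Observation (K : ℕ) : Type :=
  Σ n : Fin K → ℕ, ((k : Fin K) → Fin (n k) → ℝ)

/-- What has been observed in the first `t` periods. -/
abbrev History (K t : ℕ) : Type := Fin t → Observation K

/-- The number of past observations of each source. -/
def History.counts {K t : ℕ} (h : History K t) : Fin K → ℕ :=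
  fun k => ∑ i, (h i).1 k

/-- A (pure) strategy. Periods are numbered `0, 1, 2, …`. In each period the DM first chooses, as a
function of the history, a multiset of sources (given by its multiplicities; its size is the
intensity), then observes the signals, and then chooses an action. -/
structure Strategy (K : ℕ) (A : ℕ → Type u) [∀ t, MeasurableSpace (A t)] where
  /-- information acquisition strategy -/
  acquire : ∀ t, History K t → (Fin K → ℕ)
  measurable_acquire : ∀ t, Measurable (acquire t)
  /-- decision strategy -/
  act : ∀ t, History K (t + 1) → A t
  measurable_act : ∀ t, Measurable (act t)

/-- The acquisition strategy chooses signals myopically given its intensities: at every history, the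
chosen multiset minimizes the next posterior variance of `θ₁` among all multisets of the same
size. -/
def Strategy.Myopic {K : ℕ} [NeZero K] {A : ℕ → Type u} [∀ t, MeasurableSpace (A t)]
    (s : Strategy K A) (E : InfoEnv K) : Prop :=
  ∀ t (h : History K t) (m : Fin K → ℕ), ∑ k, m k = ∑ k, s.acquire t h k →
    E.posteriorVar (h.counts + s.acquire t h) ≤ E.posteriorVar (h.counts + m)

/-! ### The probability model -/

/-- An outcome: the state vector `θ`, and for all `t`, `k`, `j` the noise in the `j`-th observation
of source `k` in period `t`. -/
abbrev Outcome (K : ℕ) : Type := EuclideanSpace ℝ (Fin K) × (ℕ × Fin K × ℕ → ℝ)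

/-- The law of the outcome: `θ ∼ 𝒩(μ⁰, V⁰)`, the noise terms are `𝒩(0, σ_k²)`, and all of these are
independent. -/
noncomputable def law {K : ℕ} (E : InfoEnv K) (μ₀ : EuclideanSpace ℝ (Fin K)) :
    Measure (Outcome K) :=
  (multivariateGaussian μ₀ E.V₀).prod
    (Measure.infinitePi fun i : ℕ × Fin K × ℕ => gaussianReal 0 (E.sigmaSq i.2.1))

/-- The `j`-th observation of source `k` in period `t`. -/
noncomputable def signal {K : ℕ} (E : InfoEnv K) (ω : Outcome K) (t : ℕ) (k : Fin K) (j : ℕ) : ℝ :=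
  (∑ i, E.C k i * ω.1 i) + ω.2 (t, k, j)

/-- The history of the first `t` periods that a strategy generates. -/
noncomputable def Strategy.history {K : ℕ} {A : ℕ → Type u} [∀ t, MeasurableSpace (A t)]
    (s : Strategy K A) (E : InfoEnv K) (ω : Outcome K) : (t : ℕ) → History K t
  | 0 => Fin.elim0
  | t + 1 => Fin.snoc (α := fun _ => Observation K) (s.history E ω t)
      ⟨s.acquire t (s.history E ω t), fun k j => signal E ω t k j⟩

/-! ### Payoffs -/

/-- A decision problem with endogenous intensities: an arbitrary (measurable) payoff function
`U(a₁, a₂, …; θ₁)`, a flow cost `κ` with `κ(0) = 0` of the number of signals acquired in a period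
(the value `∞` is allowed), a discount factor `δ`, and the prior mean `μ⁰` of the states. -/
structure DecisionProblem (K : ℕ) (A : ℕ → Type u) [∀ t, MeasurableSpace (A t)] where
  /-- gross payoff -/
  U : ((t : ℕ) → A t) → ℝ → ℝ
  measurable_U : Measurable (Function.uncurry U)
  /-- flow cost of information acquisition -/
  κ : ℕ → ℝ≥0∞
  κ_zero : κ 0 = 0
  /-- discount factor -/
  δ : ℝ
  δ_pos : 0 < δ
  δ_le_one : δ ≤ 1
  /-- prior mean -/
  μ₀ : EuclideanSpace ℝ (Fin K)

namespace DecisionProblem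

variable {K : ℕ} [NeZero K] {A : ℕ → Type u} [∀ t, MeasurableSpace (A t)]

/-- The discounted total cost of information acquisition; the first period, which is not discounted,
has index `0`. -/
noncomputable def totalCost (P : DecisionProblem K A) (E : InfoEnv K) (s : Strategy K A)
    (ω : Outcome K) : ℝ≥0∞ :=
  ∑' t, ENNReal.ofReal P.δ ^ t * P.κ (∑ k, s.acquire t (s.history E ω t) k)

/-- The realized payoff `U(a₁, a₂, …; θ₁)` minus the total cost of information. -/
noncomputable def payoff (P : DecisionProblem K A) (E : InfoEnv K) (s : Strategy K A)
    (ω : Outcome K) : EReal :=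
  ((P.U (fun t => s.act t (s.history E ω (t + 1))) (ω.1 0) : ℝ) : EReal)
    - (P.totalCost E s ω : EReal)

/-- The expected payoff of `s` is well defined in `[-∞, ∞)`: the positive part of the payoff is
integrable. -/
def WellDefined (P : DecisionProblem K A) (E : InfoEnv K) (s : Strategy K A) : Prop :=
  ∫⁻ ω, (P.payoff E s ω).toENNReal ∂(law E P.μ₀) < ∞

/-- The expected payoff of `s`: expected positive part minus expected negative part. -/
noncomputable def expectedPayoff (P : DecisionProblem K A) (E : InfoEnv K) (s : Strategy K A) :
    EReal :=
  ((∫⁻ ω, (P.payoff E s ω).toENNReal ∂(law E P.μ₀) : ℝ≥0∞) : EReal)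
    - ((∫⁻ ω, (-P.payoff E s ω).toENNReal ∂(law E P.μ₀) : ℝ≥0∞) : EReal)

/-- `s` maximizes the expected payoff among all strategies whose expected payoff is well defined. -/
def IsOptimal (P : DecisionProblem K A) (E : InfoEnv K) (s : Strategy K A) : Prop :=
  P.WellDefined E s ∧
    ∀ s' : Strategy K A, P.WellDefined E s' → P.expectedPayoff E s' ≤ P.expectedPayoff E s

/-- Choosing signals myopically is optimal: every strategy is weakly dominated, in expected payoff,
by one that chooses signals myopically; and if there is an optimal strategy, then there is one that
chooses signals myopically. -/
def MyopicOptimal (P : DecisionProblem K A) (E : InfoEnv K) : Prop :=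
  (∀ s : Strategy K A, P.WellDefined E s →
    ∃ s' : Strategy K A, s'.Myopic E ∧ P.WellDefined E s' ∧
      P.expectedPayoff E s ≤ P.expectedPayoff E s') ∧
  ((∃ s : Strategy K A, P.IsOptimal E s) →
    ∃ s : Strategy K A, P.IsOptimal E s ∧ s.Myopic E)

end DecisionProblem

end SignalAcquisition

/-!
A better informed DM can simulate a strategy: given the signals of the past, the posterior mean of
`θ₁` of the DM with the smaller posterior variance, blurred by independent noise, has the law of the
posterior mean of the less informed one. Regressing signals on it, with fresh random numbers for the
residuals, he generates fictitious signals that are distributed jointly with `θ₁` as those of the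
original strategy; acting on them, he obtains the same gross payoff. So it suffices that myopic
sampling, with the same or somewhat larger intensities, is at each time at least as informative.

In a separable environment, minimizing a sum of convex functions greedily is optimal for every total
number of signals. In general, optimal counts are proportional to `|(C⁻¹)₁ₖ| σₖ` up to a bounded
error, so that blocks of at least `D` signals take optimal counts to optimal counts. The simulation
therefore raises intensities between `1` and `B` to `B`, which is not more costly, until it is ahead
by `D` signals. From then on its counts, which stay proportional up to a bounded error, exceed the
optimal counts for the original total source by source.

Averaging over the random numbers gives a deterministic strategy. The cost saved by the raised
intensities is bounded, which keeps the positive part of the payoff integrable.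
-/

namespace SignalAcquisition

section Matrix

variable {ι : Type*}

lemma transpose_eq_of_posDef {P : Matrix ι ι ℝ} (hP : P.PosDef) : Pᵀ = P := by
  simpa only [Matrix.conjTranspose_eq_transpose_of_trivial] using hP.isHermitian.eq

variable [Fintype ι]

lemma exists_abs_mulVec_le (M : Matrix ι ι ℝ) :
    ∃ L : ℝ, 0 < L ∧ ∀ (x : ι → ℝ) (r : ℝ), (∀ i, |x i| ≤ r) → ∀ i, |(M *ᵥ x) i| ≤ L * r := by
  obtain ⟨L, hL, hle⟩ := M.mulVecLin.toContinuousLinearMap.isBoundedLinearMap.bound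
  refine ⟨L, hL, fun x r hx i => ?_⟩
  have hr : 0 ≤ r := (abs_nonneg _).trans (hx i)
  calc |(M *ᵥ x) i| ≤ ‖M *ᵥ x‖ := norm_le_pi_norm (M *ᵥ x) i
    _ ≤ L * ‖x‖ := hle x
    _ ≤ L * r := by gcongr; exact (pi_norm_le_iff_of_nonneg hr).2 hx

variable [DecidableEq ι]

lemma isUnit_det_of_posDef {P : Matrix ι ι ℝ} (hP : P.PosDef) : IsUnit P.det :=
  (Matrix.isUnit_iff_isUnit_det P).1 hP.isUnit

lemma two_mul_dotProduct_sub_le {P : Matrix ι ι ℝ} (hP : P.PosDef) (b y : ι → ℝ) :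
    2 * (b ⬝ᵥ y) - y ⬝ᵥ (P *ᵥ y) ≤ b ⬝ᵥ (P⁻¹ *ᵥ b) := by
  have hPu : P *ᵥ (P⁻¹ *ᵥ b) = b := by
    rw [Matrix.mulVec_mulVec, Matrix.mul_nonsing_inv _ (isUnit_det_of_posDef hP),
      Matrix.one_mulVec]
  have huPy : (P⁻¹ *ᵥ b) ⬝ᵥ (P *ᵥ y) = b ⬝ᵥ y := by
    rw [Matrix.dotProduct_mulVec, ← Matrix.mulVec_transpose, transpose_eq_of_posDef hP, hPu]
  have hnonneg := hP.posSemidef.dotProduct_mulVec_nonneg (y - P⁻¹ *ᵥ b)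
  simp only [star_trivial, Matrix.mulVec_sub, sub_dotProduct, dotProduct_sub, hPu, huPy,
    dotProduct_comm y b, dotProduct_comm (P⁻¹ *ᵥ b) b] at hnonneg
  linarith

lemma sq_dotProduct_le {P : Matrix ι ι ℝ} (hP : P.PosDef) (b y : ι → ℝ) :
    (b ⬝ᵥ y) ^ 2 ≤ (y ⬝ᵥ (P *ᵥ y)) * (b ⬝ᵥ (P⁻¹ *ᵥ b)) := by
  have hquad (s : ℝ) :
      0 ≤ y ⬝ᵥ (P *ᵥ y) * (s * s) + -2 * (b ⬝ᵥ y) * s + b ⬝ᵥ (P⁻¹ *ᵥ b) := by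
    have h := two_mul_dotProduct_sub_le hP b (s • y)
    simp only [Matrix.mulVec_smul, smul_dotProduct, dotProduct_smul, smul_eq_mul] at h
    linarith
  have hdiscrim := discrim_le_zero hquad
  rw [discrim] at hdiscrim
  linarith

end Matrix

namespace InfoEnv

variable {K : ℕ} {E : InfoEnv K}

/-- The Fisher information about the state vector of `q k` observations of each source `k`. -/
noncomputable def obsInfo (E : InfoEnv K) (q : Fin K → ℕ) : Matrix (Fin K) (Fin K) ℝ :=
  E.Cᵀ * Matrix.diagonal (fun k => (q k : ℝ) / (E.sigmaSq k : ℝ)) * E.C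

/-- The precision (inverse covariance) matrix of the state vector after `q k` observations of each
source `k`. -/
noncomputable def precision (E : InfoEnv K) (q : Fin K → ℕ) : Matrix (Fin K) (Fin K) ℝ :=
  E.V₀⁻¹ + E.obsInfo q

/-- The posterior covariance matrix of the state vector. -/
noncomputable def postCov (E : InfoEnv K) (q : Fin K → ℕ) : Matrix (Fin K) (Fin K) ℝ :=
  (E.precision q)⁻¹

lemma obsInfo_zero : E.obsInfo 0 = 0 := by
  simp [obsInfo]

lemma obsInfo_add (q n : Fin K → ℕ) : E.obsInfo (q + n) = E.obsInfo q + E.obsInfo n := by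
  simp only [obsInfo, Pi.add_apply, Nat.cast_add, add_div, ← Matrix.diagonal_add, Matrix.mul_add,
    Matrix.add_mul]

lemma dotProduct_obsInfo_mulVec (q : Fin K → ℕ) (x y : Fin K → ℝ) :
    x ⬝ᵥ (E.obsInfo q *ᵥ y) =
      ∑ k, (q k : ℝ) / (E.sigmaSq k : ℝ) * ((E.C *ᵥ x) k * (E.C *ᵥ y) k) := by
  rw [obsInfo, ← Matrix.mulVec_mulVec, ← Matrix.mulVec_mulVec, Matrix.dotProduct_mulVec,
    Matrix.vecMul_transpose, dotProduct]
  refine Finset.sum_congr rfl fun k _ => ?_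
  rw [Matrix.mulVec_diagonal]
  ring

lemma obsInfo_posSemidef (q : Fin K → ℕ) : (E.obsInfo q).PosSemidef := by
  have hdiag : (Matrix.diagonal fun k => (q k : ℝ) / (E.sigmaSq k : ℝ)).PosSemidef :=
    Matrix.PosSemidef.diagonal fun k => by positivity
  simpa only [obsInfo, Matrix.conjTranspose_eq_transpose_of_trivial]
    using hdiag.conjTranspose_mul_mul_same E.C

lemma precision_posDef (hV : E.V₀.PosDef) (q : Fin K → ℕ) : (E.precision q).PosDef :=
  hV.inv.add_posSemidef (obsInfo_posSemidef q)

lemma postCov_posDef (hV : E.V₀.PosDef) (q : Fin K → ℕ) : (E.postCov q).PosDef :=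
  (precision_posDef hV q).inv

lemma postCov_zero (hV : E.V₀.PosDef) : E.postCov 0 = E.V₀ := by
  rw [postCov, precision, obsInfo_zero, add_zero,
    Matrix.nonsing_inv_nonsing_inv _ (isUnit_det_of_posDef hV)]

lemma precision_mul_postCov (hV : E.V₀.PosDef) (q : Fin K → ℕ) :
    E.precision q * E.postCov q = 1 :=
  Matrix.mul_nonsing_inv _ (isUnit_det_of_posDef (precision_posDef hV q))

lemma postCov_mul_precision (hV : E.V₀.PosDef) (q : Fin K → ℕ) :
    E.postCov q * E.precision q = 1 :=
  Matrix.nonsing_inv_mul _ (isUnit_det_of_posDef (precision_posDef hV q))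

lemma precision_add (q n : Fin K → ℕ) : E.precision (q + n) = E.precision q + E.obsInfo n := by
  rw [precision, precision, obsInfo_add, add_assoc]

lemma postCov_eq_add (hV : E.V₀.PosDef) (q n : Fin K → ℕ) :
    E.postCov q = E.postCov (q + n) + E.postCov q * E.obsInfo n * E.postCov (q + n) := by
  calc E.postCov q = E.postCov q * (E.precision (q + n) * E.postCov (q + n)) := by
        rw [precision_mul_postCov hV, mul_one]
    _ = _ := by
        rw [precision_add, ← mul_assoc, mul_add, postCov_mul_precision hV, add_mul, one_mul]

lemma dotProduct_precision_mulVec (q : Fin K → ℕ) (y : Fin K → ℝ) :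
    y ⬝ᵥ (E.precision q *ᵥ y) =
      y ⬝ᵥ (E.V₀⁻¹ *ᵥ y) + ∑ k, (q k : ℝ) / (E.sigmaSq k : ℝ) * (E.C *ᵥ y) k ^ 2 := by
  simp only [precision, Matrix.add_mulVec, dotProduct_add, dotProduct_obsInfo_mulVec, pow_two]

variable [NeZero K]

/-- The posterior covariances of the payoff-relevant state with all states. -/
noncomputable def covRow (E : InfoEnv K) (q : Fin K → ℕ) : Fin K → ℝ :=
  E.postCov q *ᵥ Pi.single 0 1

/-- The posterior covariances of the payoff-relevant state with the signal means. -/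
noncomputable def sourceCov (E : InfoEnv K) (q : Fin K → ℕ) : Fin K → ℝ :=
  E.C *ᵥ E.covRow q

lemma posteriorVar_eq_postCov (q : Fin K → ℕ) : E.posteriorVar q = E.postCov q 0 0 := rfl

lemma posteriorVar_pos (hV : E.V₀.PosDef) (q : Fin K → ℕ) : 0 < E.posteriorVar q :=
  (postCov_posDef hV q).diag_pos

lemma covRow_apply_zero (q : Fin K → ℕ) : E.covRow q 0 = E.posteriorVar q := by
  simp only [covRow, Matrix.mulVec_single_one, Matrix.col_apply, posteriorVar_eq_postCov]

lemma precision_mulVec_covRow (hV : E.V₀.PosDef) (q : Fin K → ℕ) :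
    E.precision q *ᵥ E.covRow q = Pi.single 0 1 := by
  rw [covRow, Matrix.mulVec_mulVec, precision_mul_postCov hV, Matrix.one_mulVec]

lemma covRow_dotProduct_precision (hV : E.V₀.PosDef) (q : Fin K → ℕ) :
    E.covRow q ⬝ᵥ (E.precision q *ᵥ E.covRow q) = E.posteriorVar q := by
  rw [precision_mulVec_covRow hV, dotProduct_single, mul_one, covRow_apply_zero]

lemma two_mul_sub_le_posteriorVar (hV : E.V₀.PosDef) (q : Fin K → ℕ) (y : Fin K → ℝ) :
    2 * y 0 - y ⬝ᵥ (E.precision q *ᵥ y) ≤ E.posteriorVar q := by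
  have h := two_mul_dotProduct_sub_le (precision_posDef hV q) (Pi.single 0 1) y
  rwa [single_dotProduct, single_dotProduct, one_mul, one_mul, ← postCov, ← covRow,
    covRow_apply_zero] at h

lemma posteriorVar_eq_add (hV : E.V₀.PosDef) (q : Fin K → ℕ) :
    E.posteriorVar q = E.covRow q ⬝ᵥ (E.V₀⁻¹ *ᵥ E.covRow q) +
      ∑ k, (q k : ℝ) / (E.sigmaSq k : ℝ) * E.sourceCov q k ^ 2 := by
  rw [← covRow_dotProduct_precision hV, dotProduct_precision_mulVec, sourceCov]

lemma covRow_dotProduct_prior_nonneg (hV : E.V₀.PosDef) (q : Fin K → ℕ) :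
    0 ≤ E.covRow q ⬝ᵥ (E.V₀⁻¹ *ᵥ E.covRow q) := by
  simpa only [star_trivial] using hV.inv.posSemidef.dotProduct_mulVec_nonneg (E.covRow q)

-- The bracket is optimal for `q'` at `y = E.covRow q'`; evaluate the one for `q` at the same `y`.
lemma posteriorVar_add_sum_le (hV : E.V₀.PosDef) (q q' : Fin K → ℕ) :
    E.posteriorVar q' + ∑ k, ((q' k : ℝ) - q k) / (E.sigmaSq k : ℝ) * E.sourceCov q' k ^ 2 ≤
      E.posteriorVar q := by
  have hq := two_mul_sub_le_posteriorVar hV q (E.covRow q')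
  have hq' := posteriorVar_eq_add hV q'
  rw [dotProduct_precision_mulVec, covRow_apply_zero, ← sourceCov] at hq
  simp only [sub_div, sub_mul, Finset.sum_sub_distrib]
  linarith

lemma posteriorVar_antitone (hV : E.V₀.PosDef) : Antitone E.posteriorVar := by
  refine fun q q' hqq' => le_trans (le_add_of_nonneg_right ?_) (posteriorVar_add_sum_le hV q q')
  refine Finset.sum_nonneg fun k _ => mul_nonneg (div_nonneg ?_ (by positivity)) (sq_nonneg _)
  exact sub_nonneg_of_le (Nat.cast_le.2 (hqq' k))

lemma posteriorVar_le_two_mul (hV : E.V₀.PosDef) {q q' : Fin K → ℕ}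
    (h : ∀ k, q k ≤ 2 * q' k) : E.posteriorVar q' ≤ 2 * E.posteriorVar q := by
  have hhalf := two_mul_sub_le_posteriorVar hV q ((1 / 2 : ℝ) • E.covRow q')
  have hq' := posteriorVar_eq_add hV q'
  have hprior := covRow_dotProduct_prior_nonneg hV q'
  have hsum : ∑ k, (q k : ℝ) / (E.sigmaSq k : ℝ) * E.sourceCov q' k ^ 2 ≤
      2 * ∑ k, (q' k : ℝ) / (E.sigmaSq k : ℝ) * E.sourceCov q' k ^ 2 := by
    simp only [Finset.mul_sum, ← mul_assoc, ← mul_div_assoc]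
    gcongr with k
    exact_mod_cast h k
  rw [Matrix.mulVec_smul, smul_dotProduct, dotProduct_smul, dotProduct_precision_mulVec,
    ← sourceCov, Pi.smul_apply, covRow_apply_zero] at hhalf
  simp only [smul_eq_mul] at hhalf
  linarith

lemma sum_mul_sq_sourceCov_le (hV : E.V₀.PosDef) (q : Fin K → ℕ) :
    ∑ k, (q k : ℝ) / (E.sigmaSq k : ℝ) * E.sourceCov q k ^ 2 ≤ E.posteriorVar q := by
  linarith [posteriorVar_eq_add hV q, covRow_dotProduct_prior_nonneg hV q]

lemma sq_sourceCov_le (hV : E.V₀.PosDef) (q : Fin K → ℕ) (k : Fin K) :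
    E.sourceCov q k ^ 2 ≤ (E.C * E.V₀ * E.Cᵀ) k k * E.posteriorVar q := by
  have hrow : (E.C * E.V₀ * E.Cᵀ) k k = E.C k ⬝ᵥ (E.V₀ *ᵥ E.C k) := by
    rw [Matrix.mul_assoc, Matrix.mul_apply]
    rfl
  have hprior : E.covRow q ⬝ᵥ (E.V₀⁻¹ *ᵥ E.covRow q) ≤ E.posteriorVar q := by
    rw [posteriorVar_eq_add hV q]
    exact le_add_of_nonneg_right (Finset.sum_nonneg fun k _ => by positivity)
  have hnonneg : 0 ≤ E.C k ⬝ᵥ (E.V₀ *ᵥ E.C k) := by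
    simpa only [star_trivial] using hV.posSemidef.dotProduct_mulVec_nonneg (E.C k)
  calc E.sourceCov q k ^ 2 = (E.covRow q ⬝ᵥ E.C k) ^ 2 := by rw [dotProduct_comm]; rfl
    _ ≤ (E.C k ⬝ᵥ (E.V₀ *ᵥ E.C k)) * (E.covRow q ⬝ᵥ (E.V₀⁻¹ *ᵥ E.covRow q)) :=
        sq_dotProduct_le hV _ _
    _ ≤ _ := by rw [hrow]; gcongr

lemma covRow_eq_of_sourceCov_eq_zero (hV : E.V₀.PosDef) {q q' : Fin K → ℕ}
    (h : ∀ k, q k ≠ q' k → E.sourceCov q k = 0) : E.covRow q' = E.covRow q := by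
  have hdiag : Matrix.diagonal (fun k => (q' k : ℝ) / (E.sigmaSq k : ℝ)) *ᵥ E.sourceCov q =
      Matrix.diagonal (fun k => (q k : ℝ) / (E.sigmaSq k : ℝ)) *ᵥ E.sourceCov q := by
    ext k
    rw [Matrix.mulVec_diagonal, Matrix.mulVec_diagonal]
    by_cases hk : q k = q' k
    · rw [hk]
    · rw [h k hk, mul_zero, mul_zero]
  have hinfo : E.obsInfo q' *ᵥ E.covRow q = E.obsInfo q *ᵥ E.covRow q := by
    simp only [obsInfo, ← Matrix.mulVec_mulVec]
    rw [← sourceCov, hdiag]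
  have hprecision : E.precision q' *ᵥ E.covRow q = Pi.single 0 1 := by
    rw [← precision_mulVec_covRow hV q, precision, precision, Matrix.add_mulVec, hinfo,
      ← Matrix.add_mulVec]
  rw [covRow, ← hprecision, Matrix.mulVec_mulVec, postCov_mul_precision hV, Matrix.one_mulVec]

/-- The prior precision matrix of the vector `C θ` of signal means. -/
noncomputable def sourcePrecision (E : InfoEnv K) : Matrix (Fin K) (Fin K) ℝ :=
  (E.C⁻¹)ᵀ * E.V₀⁻¹ * E.C⁻¹

section IsUnit

variable (hC : IsUnit E.C)
include hC

lemma inv_mulVec_sourceCov (q : Fin K → ℕ) :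
    E.C⁻¹ *ᵥ E.sourceCov q = E.covRow q := by
  rw [sourceCov, Matrix.mulVec_mulVec,
    Matrix.nonsing_inv_mul _ ((Matrix.isUnit_iff_isUnit_det _).1 hC), Matrix.one_mulVec]

lemma posteriorVar_eq_sum (q : Fin K → ℕ) :
    E.posteriorVar q = ∑ k, E.C⁻¹ 0 k * E.sourceCov q k := by
  rw [← covRow_apply_zero, ← inv_mulVec_sourceCov hC]
  rfl

lemma posteriorVar_le_sum (hV : E.V₀.PosDef) (hσ : ∀ k, 0 < E.sigmaSq k)
    {q : Fin K → ℕ} (hq : ∀ k, 0 < q k) :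
    E.posteriorVar q ≤ ∑ k, E.C⁻¹ 0 k ^ 2 * E.sigmaSq k / q k := by
  have hterm (k : Fin K) : 2 * (E.C⁻¹ 0 k * E.sourceCov q k) -
      (q k : ℝ) / (E.sigmaSq k : ℝ) * E.sourceCov q k ^ 2 ≤
        E.C⁻¹ 0 k ^ 2 * E.sigmaSq k / q k := by
    have hs : (0 : ℝ) < E.sigmaSq k := hσ k
    have hk : (0 : ℝ) < q k := Nat.cast_pos.2 (hq k)
    have hsq : E.C⁻¹ 0 k ^ 2 * E.sigmaSq k / q k - (2 * (E.C⁻¹ 0 k * E.sourceCov q k) -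
        (q k : ℝ) / (E.sigmaSq k : ℝ) * E.sourceCov q k ^ 2) =
        (E.C⁻¹ 0 k * E.sigmaSq k - q k * E.sourceCov q k) ^ 2 / (E.sigmaSq k * q k) := by
      field_simp
      ring
    exact sub_nonneg.1 (hsq ▸ by positivity)
  have hsum := Finset.sum_le_sum fun k (_ : k ∈ Finset.univ) => hterm k
  rw [Finset.sum_sub_distrib, ← Finset.mul_sum, ← posteriorVar_eq_sum hC] at hsum
  linarith [sum_mul_sq_sourceCov_le hV q]

-- In the coordinates `C θ` each source observes a single coordinate, so that the posterior
-- precision is `sourcePrecision` plus a diagonal matrix.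
lemma count_mul_sourceCov (hV : E.V₀.PosDef) (q : Fin K → ℕ) (k : Fin K) :
    (q k : ℝ) / (E.sigmaSq k : ℝ) * E.sourceCov q k =
      E.C⁻¹ 0 k - (E.sourcePrecision *ᵥ E.sourceCov q) k := by
  have hdet := (Matrix.isUnit_iff_isUnit_det _).1 hC
  have hprior : E.sourcePrecision *ᵥ E.sourceCov q = (E.C⁻¹)ᵀ *ᵥ (E.V₀⁻¹ *ᵥ E.covRow q) := by
    rw [← inv_mulVec_sourceCov hC, Matrix.mulVec_mulVec, Matrix.mulVec_mulVec, sourcePrecision,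
      Matrix.mul_assoc]
  have hobs : (E.C⁻¹)ᵀ *ᵥ (E.obsInfo q *ᵥ E.covRow q) =
      Matrix.diagonal (fun k => (q k : ℝ) / (E.sigmaSq k : ℝ)) *ᵥ E.sourceCov q := by
    rw [obsInfo, sourceCov, Matrix.mulVec_mulVec, Matrix.mulVec_mulVec, ← Matrix.mul_assoc,
      ← Matrix.mul_assoc, ← Matrix.transpose_mul, Matrix.mul_nonsing_inv _ hdet,
      Matrix.transpose_one, Matrix.one_mul]
  have h := congrArg (fun v => ((E.C⁻¹)ᵀ *ᵥ v) k) (precision_mulVec_covRow hV q)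
  simp only [precision, Matrix.add_mulVec, Matrix.mulVec_add, hobs, ← hprior, Pi.add_apply,
    Matrix.mulVec_diagonal, Matrix.mulVec_single_one, Matrix.col_apply,
    Matrix.transpose_apply] at h
  linarith

end IsUnit

end InfoEnv

end SignalAcquisition

namespace SignalAcquisition

namespace InfoEnv

variable {K : ℕ} {E : InfoEnv K}

section Exchange

lemma cast_le_sum (q : Fin K → ℕ) (k : Fin K) : (q k : ℝ) ≤ ((∑ i, q i : ℕ) : ℝ) :=
  Nat.cast_le.2 (Finset.single_le_sum (fun _ _ => Nat.zero_le _) (Finset.mem_univ k))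

/-- The counts obtained from `q` by replacing one observation of source `j` by one of source `k`.
The subtraction is truncated, so that this is meant for `1 ≤ q j`. -/
def exchange (q : Fin K → ℕ) (j k : Fin K) : Fin K → ℕ :=
  q - Pi.single j 1 + Pi.single k 1

variable {q : Fin K → ℕ} {j : Fin K}

lemma single_le (hj : 1 ≤ q j) : Pi.single j 1 ≤ q := by
  intro i
  obtain rfl | hij := eq_or_ne i j
  · rwa [Pi.single_eq_same]
  · rw [Pi.single_eq_of_ne hij]
    exact Nat.zero_le _

lemma exchange_add_single (hj : 1 ≤ q j) (k : Fin K) :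
    exchange q j k + Pi.single j 1 = q + Pi.single k 1 := by
  rw [exchange, add_right_comm, tsub_add_cancel_of_le (single_le hj)]

lemma sum_exchange (hj : 1 ≤ q j) (k : Fin K) : ∑ i, exchange q j k i = ∑ i, q i := by
  have h := congrArg (fun m : Fin K → ℕ => ∑ i, m i) (exchange_add_single hj k)
  simpa [Finset.sum_add_distrib] using h

lemma exchange_add (hj : 1 ≤ q j) (c : Fin K → ℕ) (k : Fin K) :
    exchange (c + q) j k = c + exchange q j k := by
  rw [exchange, exchange, add_tsub_assoc_of_le (single_le hj), add_assoc]

lemma cast_exchange_sub (hj : 1 ≤ q j) (k i : Fin K) :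
    (exchange q j k i : ℝ) - q i = (if i = k then 1 else 0) - (if i = j then 1 else 0) := by
  have h := congrArg (fun m : Fin K → ℕ => (m i : ℝ)) (exchange_add_single hj k)
  simp only [Pi.add_apply, Nat.cast_add, Pi.single_apply, Nat.cast_ite, Nat.cast_one,
    Nat.cast_zero] at h
  linarith

lemma le_exchange_add_one (hj : 1 ≤ q j) (k i : Fin K) : q i ≤ exchange q j k i + 1 := by
  have h := congrFun (exchange_add_single hj k) i
  simp only [Pi.add_apply, Pi.single_apply] at h
  split_ifs at h <;> omega

lemma exchange_le_add_one (hj : 1 ≤ q j) (k i : Fin K) : exchange q j k i ≤ q i + 1 := by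
  have h := congrFun (exchange_add_single hj k) i
  simp only [Pi.add_apply, Pi.single_apply] at h
  split_ifs at h <;> omega

lemma le_two_mul_exchange (hj : 2 ≤ q j) (k i : Fin K) : q i ≤ 2 * exchange q j k i := by
  have h := congrFun (exchange_add_single (one_le_two.trans hj) k) i
  simp only [Pi.add_apply, Pi.single_apply] at h
  obtain rfl | hij := eq_or_ne i j
  · split_ifs at h <;> omega
  · rw [if_neg hij] at h
    omega

end Exchange

variable [NeZero K]

section OptimalCounts

/-- Signal counts that minimize the posterior variance among all counts of the same total. -/
def IsOptCount (E : InfoEnv K) (q : Fin K → ℕ) : Prop :=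
  ∀ m : Fin K → ℕ, ∑ k, m k = ∑ k, q k → E.posteriorVar q ≤ E.posteriorVar m

lemma exists_myopicBlock (E : InfoEnv K) (c : Fin K → ℕ) (N : ℕ) :
    ∃ m : Fin K → ℕ, ∑ k, m k = N ∧ ∀ m' : Fin K → ℕ, ∑ k, m' k = N →
      E.posteriorVar (c + m) ≤ E.posteriorVar (c + m') := by
  have hne : (Finset.piAntidiag (Finset.univ : Finset (Fin K)) N).Nonempty :=
    ⟨Pi.single 0 N, by simp [Finset.mem_piAntidiag]⟩
  obtain ⟨m, hm, hmin⟩ := Finset.exists_min_image _ (fun m => E.posteriorVar (c + m)) hne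
  exact ⟨m, by simpa using hm, fun m' hm' => hmin m' (by simpa using hm')⟩

/-- A multiset of `N` sources whose observation, given the counts `c`, minimizes the posterior
variance. -/
noncomputable def myopicBlock (E : InfoEnv K) (c : Fin K → ℕ) (N : ℕ) : Fin K → ℕ :=
  (E.exists_myopicBlock c N).choose

@[simp]
lemma sum_myopicBlock (c : Fin K → ℕ) (N : ℕ) : ∑ k, E.myopicBlock c N k = N :=
  (E.exists_myopicBlock c N).choose_spec.1

lemma posteriorVar_add_myopicBlock_le (c : Fin K → ℕ) {N : ℕ} {m : Fin K → ℕ}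
    (hm : ∑ k, m k = N) : E.posteriorVar (c + E.myopicBlock c N) ≤ E.posteriorVar (c + m) :=
  (E.exists_myopicBlock c N).choose_spec.2 m hm

lemma exists_isOptCount (E : InfoEnv K) (N : ℕ) :
    ∃ q : Fin K → ℕ, ∑ k, q k = N ∧ E.IsOptCount q := by
  refine ⟨E.myopicBlock 0 N, sum_myopicBlock 0 N, fun m hm => ?_⟩
  rw [sum_myopicBlock] at hm
  simpa only [zero_add] using posteriorVar_add_myopicBlock_le (E := E) 0 hm

lemma isOptCount_zero (E : InfoEnv K) : E.IsOptCount 0 := by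
  intro m hm
  have hm0 : m = 0 := by simpa [Finset.sum_eq_zero_iff, funext_iff] using hm
  rw [hm0]

lemma IsOptCount.add_myopicBlock {c q : Fin K → ℕ} (hq : E.IsOptCount q) (hcq : c ≤ q) {N : ℕ}
    (hN : ∑ k, q k = ∑ k, c k + N) : E.IsOptCount (c + E.myopicBlock c N) := by
  obtain ⟨d, rfl⟩ := exists_add_of_le hcq
  have hd : ∑ k, d k = N := by simpa [Finset.sum_add_distrib] using hN
  intro m hm
  refine (posteriorVar_add_myopicBlock_le c hd).trans (hq m ?_)
  rw [hm, hN]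
  simp [Finset.sum_add_distrib]

lemma exists_le_sum_eq (q : Fin K → ℕ) {N : ℕ} (hN : ∑ k, q k ≤ N) :
    ∃ q' : Fin K → ℕ, q ≤ q' ∧ ∑ k, q' k = N := by
  refine ⟨q + Pi.single 0 (N - ∑ k, q k), le_self_add, ?_⟩
  simp [Finset.sum_add_distrib, Nat.add_sub_cancel' hN]

lemma IsOptCount.le_of_sum_le (hV : E.V₀.PosDef) {c q : Fin K → ℕ} (hc : E.IsOptCount c)
    (h : ∑ k, q k ≤ ∑ k, c k) : E.posteriorVar c ≤ E.posteriorVar q := by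
  obtain ⟨q', hle, hsum⟩ := exists_le_sum_eq q h
  exact (hc q' hsum).trans (posteriorVar_antitone hV hle)

end OptimalCounts

section ExchangeInequality

lemma sq_sourceCov_exchange_le (hV : E.V₀.PosDef) {q : Fin K → ℕ} {j k : Fin K} (hj : 1 ≤ q j)
    (hle : E.posteriorVar q ≤ E.posteriorVar (exchange q j k)) :
    E.sourceCov (exchange q j k) k ^ 2 / E.sigmaSq k ≤
      E.sourceCov (exchange q j k) j ^ 2 / E.sigmaSq j := by
  have h := posteriorVar_add_sum_le hV q (exchange q j k)
  have hsum : ∑ i, ((exchange q j k i : ℝ) - q i) / (E.sigmaSq i : ℝ) *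
      E.sourceCov (exchange q j k) i ^ 2 = E.sourceCov (exchange q j k) k ^ 2 / E.sigmaSq k -
        E.sourceCov (exchange q j k) j ^ 2 / E.sigmaSq j := by
    simp only [cast_exchange_sub hj, sub_div, ite_div, zero_div, sub_mul, ite_mul, zero_mul,
      Finset.sum_sub_distrib, Finset.sum_ite_eq', Finset.mem_univ, if_true]
    ring
  linarith

lemma sqrt_mul_abs_sub_eq (hV : E.V₀.PosDef) (hσ : ∀ k, 0 < E.sigmaSq k) (hC : IsUnit E.C)
    (q : Fin K → ℕ) (i : Fin K) :
    √(E.sigmaSq i) * |E.C⁻¹ 0 i - (E.sourcePrecision *ᵥ E.sourceCov q) i| =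
      q i * √(E.sourceCov q i ^ 2 / E.sigmaSq i) := by
  have hs : (0 : ℝ) < E.sigmaSq i := hσ i
  have : 0 < √(E.sigmaSq i : ℝ) := Real.sqrt_pos.2 hs
  rw [← count_mul_sourceCov hC hV, abs_mul, abs_of_nonneg (by positivity),
    Real.sqrt_div' _ hs.le, Real.sqrt_sq_eq_abs]
  nth_rewrite 2 [← Real.sq_sqrt hs.le]
  field_simp

lemma exchange_inequality (hV : E.V₀.PosDef) (hσ : ∀ k, 0 < E.sigmaSq k) (hC : IsUnit E.C)
    {q q' : Fin K → ℕ} {j k : Fin K} (hq' : q' = exchange q j k) (hj : 1 ≤ q j)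
    (hle : E.posteriorVar q ≤ E.posteriorVar q') :
    √(E.sigmaSq k) * |E.C⁻¹ 0 k - (E.sourcePrecision *ᵥ E.sourceCov q') k| * q' j ≤
      √(E.sigmaSq j) * |E.C⁻¹ 0 j - (E.sourcePrecision *ᵥ E.sourceCov q') j| * q' k := by
  subst hq'
  rw [sqrt_mul_abs_sub_eq hV hσ hC, sqrt_mul_abs_sub_eq hV hσ hC]
  have h := Real.sqrt_le_sqrt (sq_sourceCov_exchange_le hV hj hle)
  calc _ ≤ (exchange q j k k : ℝ) *
        √(E.sourceCov (exchange q j k) j ^ 2 / E.sigmaSq j) * exchange q j k j := by gcongr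
    _ = _ := by ring

end ExchangeInequality

section Balance

/-- The weight to which the number of observations of a source is asymptotically proportional. -/
noncomputable def weight (E : InfoEnv K) (k : Fin K) : ℝ :=
  |E.C⁻¹ 0 k| * √(E.sigmaSq k)

/-- The counts are proportional to the weights, up to the additive error `D`. -/
def Balanced (E : InfoEnv K) (D : ℝ) (q : Fin K → ℕ) : Prop :=
  ∀ j k, q j * E.weight k - q k * E.weight j ≤ D

/-- The counts can be in excess imbalance, beyond the error `D`, only where replacing an observation
of the overrepresented source does not lower the posterior variance. -/
def ExchangeStable (E : InfoEnv K) (D : ℝ) (q : Fin K → ℕ) : Prop :=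
  ∀ j k, q j * E.weight k - q k * E.weight j ≤ D ∨
    (1 ≤ q j ∧ E.posteriorVar q ≤ E.posteriorVar (exchange q j k))

lemma Balanced.mono {D D' : ℝ} {q : Fin K → ℕ} (h : E.Balanced D q) (hD : D ≤ D') :
    E.Balanced D' q :=
  fun j k => (h j k).trans hD

lemma weight_nonneg (k : Fin K) : 0 ≤ E.weight k :=
  mul_nonneg (abs_nonneg _) (Real.sqrt_nonneg _)

lemma weight_le_sum (k : Fin K) : E.weight k ≤ ∑ i, E.weight i :=
  Finset.single_le_sum (fun i _ => weight_nonneg i) (Finset.mem_univ k)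

lemma balanced_of_sum_le {q : Fin K → ℕ} {n : ℕ} (hq : ∑ k, q k ≤ n) :
    E.Balanced (n * ∑ i, E.weight i) q := by
  intro j k
  have hjn : (q j : ℝ) ≤ n := (cast_le_sum q j).trans (Nat.cast_le.2 hq)
  calc q j * E.weight k - q k * E.weight j ≤ q j * E.weight k :=
        sub_le_self _ (mul_nonneg (by positivity) (weight_nonneg j))
    _ ≤ n * ∑ i, E.weight i :=
        mul_le_mul hjn (weight_le_sum k) (weight_nonneg k) (Nat.cast_nonneg n)

lemma Balanced.sum_mul_weight_le {D : ℝ} {q : Fin K → ℕ} (h : E.Balanced D q) (k : Fin K) :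
    ((∑ j, q j : ℕ) : ℝ) * E.weight k ≤ q k * ∑ j, E.weight j + K * D := by
  have hsum := Finset.sum_le_sum fun j (_ : j ∈ Finset.univ) => h j k
  simp only [Finset.sum_sub_distrib, ← Finset.sum_mul, ← Finset.mul_sum, Finset.sum_const,
    Finset.card_univ, Fintype.card_fin, nsmul_eq_mul] at hsum
  push_cast
  linarith

lemma Balanced.mul_sum_weight_le {D : ℝ} {q : Fin K → ℕ} (h : E.Balanced D q) (j : Fin K) :
    q j * ∑ k, E.weight k ≤ ((∑ k, q k : ℕ) : ℝ) * E.weight j + K * D := by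
  have hsum := Finset.sum_le_sum fun k (_ : k ∈ Finset.univ) => h j k
  simp only [Finset.sum_sub_distrib, ← Finset.sum_mul, ← Finset.mul_sum, Finset.sum_const,
    Finset.card_univ, Fintype.card_fin, nsmul_eq_mul] at hsum
  push_cast
  linarith

lemma IsOptCount.exchangeStable {D : ℝ} (hD : 0 ≤ D) {q : Fin K → ℕ} (hq : E.IsOptCount q) :
    E.ExchangeStable D q := by
  intro j k
  obtain hj | hj := Nat.eq_zero_or_pos (q j)
  · left
    rw [hj, Nat.cast_zero, zero_mul, zero_sub]
    exact (neg_nonpos.2 (mul_nonneg (Nat.cast_nonneg _) (weight_nonneg j))).trans hD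
  · exact Or.inr ⟨hj, hq _ (sum_exchange hj k)⟩

lemma Balanced.exchangeStable_add_myopicBlock {D : ℝ} {c : Fin K → ℕ} (hc : E.Balanced D c)
    (N : ℕ) : E.ExchangeStable D (c + E.myopicBlock c N) := by
  intro j k
  obtain hj | hj := Nat.eq_zero_or_pos (E.myopicBlock c N j)
  · left
    refine le_trans (sub_le_sub (le_of_eq ?_) ?_) (hc j k)
    · rw [Pi.add_apply, hj, add_zero]
    · exact mul_le_mul_of_nonneg_right (Nat.cast_le.2 (Nat.le_add_right _ _)) (weight_nonneg j)
  · refine Or.inr ⟨hj.trans_le (Nat.le_add_left _ _), ?_⟩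
    rw [exchange_add hj]
    exact posteriorVar_add_myopicBlock_le c ((sum_exchange hj k).trans (sum_myopicBlock c N))

variable (hV : E.V₀.PosDef) (hσ : ∀ k, 0 < E.sigmaSq k) (hC : E.NonRedundant)

include hσ hC in
lemma weight_pos (k : Fin K) : 0 < E.weight k :=
  mul_pos (abs_pos.2 (hC.2 k)) (Real.sqrt_pos.2 (hσ k))

include hσ hC in
lemma exists_le_mul_weight (c : ℝ) : ∃ n₀ : ℕ, ∀ n ≥ n₀, ∀ k, c ≤ n * E.weight k := by
  refine Filter.eventually_atTop.1 (Filter.eventually_all.2 fun k => ?_)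
  exact (tendsto_natCast_atTop_atTop.atTop_mul_const (weight_pos hσ hC k)).eventually_ge_atTop c

include hV hC in
lemma exists_abs_sourcePrecision_mulVec_le_half :
    ∃ ε : ℝ, 0 < ε ∧ ∀ q, E.posteriorVar q ≤ ε →
      ∀ i, |(E.sourcePrecision *ᵥ E.sourceCov q) i| ≤ |E.C⁻¹ 0 i| / 2 := by
  obtain ⟨L, hL, hLle⟩ := exists_abs_mulVec_le E.sourcePrecision
  obtain ⟨i₀, -, hi₀⟩ := Finset.exists_min_image Finset.univ (fun i => |E.C⁻¹ 0 i|)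
    Finset.univ_nonempty
  obtain ⟨k₀, -, hk₀⟩ := Finset.exists_max_image Finset.univ
    (fun k => (E.C * E.V₀ * E.Cᵀ) k k) Finset.univ_nonempty
  have ha₀ : 0 < |E.C⁻¹ 0 i₀| := abs_pos.2 (hC.2 i₀)
  set a₀ := |E.C⁻¹ 0 i₀|
  set M := (E.C * E.V₀ * E.Cᵀ) k₀ k₀
  refine ⟨(a₀ / (2 * L)) ^ 2 / (|M| + 1), by positivity, fun q hq i => ?_⟩
  have hx (k : Fin K) : |E.sourceCov q k| ≤ a₀ / (2 * L) := by
    refine abs_le_of_sq_le_sq ?_ (by positivity)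
    have hf := (posteriorVar_pos hV q).le
    calc E.sourceCov q k ^ 2 ≤ (E.C * E.V₀ * E.Cᵀ) k k * E.posteriorVar q := sq_sourceCov_le hV q k
      _ ≤ (|M| + 1) * E.posteriorVar q :=
          mul_le_mul_of_nonneg_right
            ((hk₀ k (Finset.mem_univ k)).trans (by linarith [le_abs_self M])) hf
      _ ≤ (|M| + 1) * ((a₀ / (2 * L)) ^ 2 / (|M| + 1)) := by gcongr
      _ = (a₀ / (2 * L)) ^ 2 := by field_simp
  calc |(E.sourcePrecision *ᵥ E.sourceCov q) i| ≤ L * (a₀ / (2 * L)) := hLle _ _ hx i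
    _ = a₀ / 2 := by field_simp
    _ ≤ |E.C⁻¹ 0 i| / 2 := by gcongr; exact hi₀ i (Finset.mem_univ i)

include hV hσ in
lemma mul_weight_sub_le (hC : IsUnit E.C) {q q' : Fin K → ℕ} {j k : Fin K}
    (hq' : q' = exchange q j k) (hj : 1 ≤ q j) (hle : E.posteriorVar q ≤ E.posteriorVar q') {R : ℝ}
    (hR : ∀ i, ((∑ l, q l : ℕ) : ℝ) * |(E.sourcePrecision *ᵥ E.sourceCov q') i| ≤ R) :
    q j * E.weight k - q k * E.weight j ≤
      2 * ∑ i, E.weight i + 2 * ((∑ i, √(E.sigmaSq i : ℝ)) * R) := by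
  have hsum : ∑ l, q l = ∑ l, q' l := hq' ▸ (sum_exchange hj k).symm
  rw [hsum] at hR
  have : 0 ≤ R := le_trans (by positivity) (hR j)
  have herror (i l : Fin K) :
      √(E.sigmaSq i) * |(E.sourcePrecision *ᵥ E.sourceCov q') i| * q' l ≤
        (∑ i, √(E.sigmaSq i : ℝ)) * R := by
    have hS : √(E.sigmaSq i : ℝ) ≤ ∑ i, √(E.sigmaSq i : ℝ) :=
      Finset.single_le_sum (f := fun i => √(E.sigmaSq i : ℝ)) (fun _ _ => by positivity)
        (Finset.mem_univ i)
    calc _ ≤ √(E.sigmaSq i) * |(E.sourcePrecision *ᵥ E.sourceCov q') i| *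
          ((∑ l, q' l : ℕ) : ℝ) := by gcongr; exact_mod_cast cast_le_sum q' l
      _ = √(E.sigmaSq i) *
          (((∑ l, q' l : ℕ) : ℝ) * |(E.sourcePrecision *ᵥ E.sourceCov q') i|) := by ring
      _ ≤ (∑ i, √(E.sigmaSq i : ℝ)) * R := by gcongr; exact hR i
  have hexchange : (E.weight k - √(E.sigmaSq k) *
        |(E.sourcePrecision *ᵥ E.sourceCov q') k|) * q' j ≤
      (E.weight j + √(E.sigmaSq j) * |(E.sourcePrecision *ᵥ E.sourceCov q') j|) * q' k := by
    have hlower := abs_sub_abs_le_abs_sub (E.C⁻¹ 0 k) ((E.sourcePrecision *ᵥ E.sourceCov q') k)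
    have hupper := abs_sub (E.C⁻¹ 0 j) ((E.sourcePrecision *ᵥ E.sourceCov q') j)
    rw [weight, weight, mul_comm |E.C⁻¹ 0 k|, mul_comm |E.C⁻¹ 0 j|, ← mul_sub, ← mul_add]
    calc _ ≤ √(E.sigmaSq k) * |E.C⁻¹ 0 k - (E.sourcePrecision *ᵥ E.sourceCov q') k| * q' j := by
          gcongr
      _ ≤ √(E.sigmaSq j) * |E.C⁻¹ 0 j - (E.sourcePrecision *ᵥ E.sourceCov q') j| * q' k :=
          exchange_inequality hV hσ hC hq' hj hle
      _ ≤ _ := by gcongr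
  have hq'j : E.weight k * q j ≤ E.weight k * (q' j + 1) :=
    mul_le_mul_of_nonneg_left (by exact_mod_cast hq' ▸ le_exchange_add_one hj k j) (weight_nonneg k)
  have hq'k : E.weight j * q' k ≤ E.weight j * (q k + 1) :=
    mul_le_mul_of_nonneg_left (by exact_mod_cast hq' ▸ exchange_le_add_one hj k k) (weight_nonneg j)
  linarith [herror k j, herror j k, weight_le_sum (E := E) k, weight_le_sum (E := E) j]

include hV hσ hC

lemma exists_posteriorVar_le {ε : ℝ} (hε : 0 < ε) :
    ∃ m : ℕ, ∀ q : Fin K → ℕ, (∀ k, m ≤ q k) → E.posteriorVar q ≤ ε := by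
  set s : ℝ := ∑ k, E.C⁻¹ 0 k ^ 2 * E.sigmaSq k with hs
  obtain ⟨m, hm⟩ := exists_nat_ge (s / ε)
  rw [div_le_iff₀ hε] at hm
  refine ⟨m + 1, fun q hq => ?_⟩
  calc E.posteriorVar q ≤ ∑ k, E.C⁻¹ 0 k ^ 2 * E.sigmaSq k / q k :=
        posteriorVar_le_sum hC.1 hV hσ fun k => (Nat.succ_pos m).trans_le (hq k)
    _ ≤ s / (m + 1) := by
        rw [hs, Finset.sum_div]
        gcongr with k
        exact_mod_cast hq k
    _ ≤ ε := by
        rw [div_le_iff₀ (by positivity)]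
        linarith

lemma exists_isOptCount_posteriorVar_le {ε : ℝ} (hε : 0 < ε) :
    ∃ n₀ : ℕ, ∀ q, n₀ ≤ ∑ k, q k → E.IsOptCount q → E.posteriorVar q ≤ ε := by
  obtain ⟨m, hm⟩ := exists_posteriorVar_le hV hσ hC hε
  exact ⟨∑ _k : Fin K, m, fun q hq hopt => (hopt.le_of_sum_le hV hq).trans (hm _ fun _ => le_rfl)⟩

lemma exists_balanced_posteriorVar_le {ε : ℝ} (hε : 0 < ε) (D : ℝ) :
    ∃ n₀ : ℕ, ∀ q, n₀ ≤ ∑ k, q k → E.Balanced D q → E.posteriorVar q ≤ ε := by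
  obtain ⟨m, hm⟩ := exists_posteriorVar_le hV hσ hC hε
  obtain ⟨n₀, hn₀⟩ := exists_le_mul_weight hσ hC (m * ∑ i, E.weight i + K * D)
  refine ⟨n₀, fun q hq hbal => hm q fun k => ?_⟩
  have hW : 0 < ∑ i, E.weight i :=
    Finset.sum_pos (fun i _ => weight_pos hσ hC i) Finset.univ_nonempty
  have hk : (m : ℝ) * ∑ i, E.weight i ≤ q k * ∑ i, E.weight i := by
    linarith [hn₀ _ hq k, hbal.sum_mul_weight_le k]
  exact_mod_cast le_of_mul_le_mul_right hk hW

lemma exists_exchangeStable_mul_weight_le :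
    ∃ ε : ℝ, 0 < ε ∧ ∀ (D : ℝ) (q : Fin K → ℕ), E.posteriorVar q ≤ ε → E.ExchangeStable D q →
      ∀ j k, q j * E.weight k ≤ 3 * (q k * E.weight j) + (4 * ∑ i, E.weight i + |D|) := by
  obtain ⟨ε, hε, hhalf⟩ := exists_abs_sourcePrecision_mulVec_le_half hV hC
  refine ⟨ε / 2, by positivity, fun D q hq hstable j k => ?_⟩
  have hj := weight_le_sum (E := E) j
  have hk := weight_le_sum (E := E) k
  have hj₀ := weight_nonneg (E := E) j
  have hk₀ := weight_nonneg (E := E) k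
  have hqk : 0 ≤ (q k : ℝ) * E.weight j := mul_nonneg (Nat.cast_nonneg _) hj₀
  obtain h | ⟨hqj, hle⟩ := hstable j k
  · linarith [le_abs_self D]
  obtain hqj1 | hqj2 : q j ≤ 1 ∨ 2 ≤ q j := by omega
  · have : (q j : ℝ) * E.weight k ≤ 1 * E.weight k :=
      mul_le_mul_of_nonneg_right (by exact_mod_cast hqj1) hk₀
    linarith [abs_nonneg D]
  set q' := exchange q j k with hq'
  have hfq' : E.posteriorVar q' ≤ ε := by
    linarith [posteriorVar_le_two_mul hV (q' := q') (le_two_mul_exchange hqj2 k)]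
  have hcompare : E.weight k / 2 * q' j ≤ 3 / 2 * E.weight j * q' k := by
    have hlower := abs_sub_abs_le_abs_sub (E.C⁻¹ 0 k) ((E.sourcePrecision *ᵥ E.sourceCov q') k)
    have hupper := abs_sub (E.C⁻¹ 0 j) ((E.sourcePrecision *ᵥ E.sourceCov q') j)
    calc E.weight k / 2 * q' j = √(E.sigmaSq k) * (|E.C⁻¹ 0 k| / 2) * q' j := by
          rw [weight]; ring
      _ ≤ √(E.sigmaSq k) * |E.C⁻¹ 0 k - (E.sourcePrecision *ᵥ E.sourceCov q') k| * q' j := by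
          gcongr; linarith [hhalf q' hfq' k]
      _ ≤ √(E.sigmaSq j) * |E.C⁻¹ 0 j - (E.sourcePrecision *ᵥ E.sourceCov q') j| * q' k :=
          exchange_inequality hV hσ hC.1 hq' hqj hle
      _ ≤ √(E.sigmaSq j) * (3 / 2 * |E.C⁻¹ 0 j|) * q' k := by
          gcongr; linarith [hhalf q' hfq' j]
      _ = 3 / 2 * E.weight j * q' k := by rw [weight]; ring
  have hq'j : E.weight k * q j ≤ E.weight k * (q' j + 1) :=
    mul_le_mul_of_nonneg_left (by exact_mod_cast le_exchange_add_one hqj k j) hk₀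
  have hq'k : E.weight j * q' k ≤ E.weight j * (q k + 1) :=
    mul_le_mul_of_nonneg_left (by exact_mod_cast exchange_le_add_one hqj k k) hj₀
  linarith [abs_nonneg D]

lemma exists_exchangeStable_linear_le :
    ∃ ε : ℝ, 0 < ε ∧ ∀ D : ℝ, ∃ n₀ : ℕ, ∀ q : Fin K → ℕ, n₀ ≤ ∑ k, q k →
      E.posteriorVar q ≤ ε → E.ExchangeStable D q →
      ∀ k, ((∑ i, q i : ℕ) : ℝ) * E.weight k + 4 * ∑ i, E.weight i ≤
        4 * (∑ i, E.weight i) * q k := by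
  obtain ⟨ε, hε, hle⟩ := exists_exchangeStable_mul_weight_le hV hσ hC
  refine ⟨ε, hε, fun D => ?_⟩
  set W := ∑ i, E.weight i
  obtain ⟨n₀, hn₀⟩ := exists_le_mul_weight hσ hC (4 * (K * (4 * W + |D|) + 3 * W))
  refine ⟨n₀, fun q hq hf hstable k => ?_⟩
  have hsum := Finset.sum_le_sum fun j (_ : j ∈ Finset.univ) => hle D q hf hstable j k
  simp only [Finset.sum_add_distrib, ← Finset.sum_mul, ← Finset.mul_sum, Finset.sum_const,
    Finset.card_univ, Fintype.card_fin, nsmul_eq_mul] at hsum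
  have hlarge := hn₀ _ hq k
  push_cast at hlarge ⊢
  linarith

lemma mul_abs_sourceCov_le {q : Fin K → ℕ} {i : Fin K}
    (hhalf : |(E.sourcePrecision *ᵥ E.sourceCov q) i| ≤ |E.C⁻¹ 0 i| / 2) {n : ℝ}
    (hn : n * E.weight i ≤ 4 * (∑ k, E.weight k) * q i) :
    n * |E.sourceCov q i| ≤ 6 * (∑ k, E.weight k) * √(E.sigmaSq i) := by
  have hs : (0 : ℝ) < E.sigmaSq i := hσ i
  have hW : 0 ≤ ∑ k, E.weight k := Finset.sum_nonneg fun k _ => weight_nonneg k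
  have hsq := sqrt_mul_abs_sub_eq hV hσ hC.1 q i
  rw [Real.sqrt_div' _ hs.le, Real.sqrt_sq_eq_abs, mul_div_assoc', eq_div_iff (by positivity)]
    at hsq
  have hupper := abs_sub (E.C⁻¹ 0 i) ((E.sourcePrecision *ᵥ E.sourceCov q) i)
  refine le_of_mul_le_mul_right ?_ (weight_pos hσ hC i)
  calc n * |E.sourceCov q i| * E.weight i = n * E.weight i * |E.sourceCov q i| := by ring
    _ ≤ 4 * (∑ k, E.weight k) * q i * |E.sourceCov q i| := by gcongr
    _ = 4 * (∑ k, E.weight k) * (√(E.sigmaSq i) *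
          |E.C⁻¹ 0 i - (E.sourcePrecision *ᵥ E.sourceCov q) i| * √(E.sigmaSq i)) := by
        rw [hsq]; ring
    _ ≤ 4 * (∑ k, E.weight k) * (√(E.sigmaSq i) * (3 / 2 * |E.C⁻¹ 0 i|) * √(E.sigmaSq i)) := by
        gcongr; linarith
    _ = 6 * (∑ k, E.weight k) * √(E.sigmaSq i) * E.weight i := by rw [weight]; ring

lemma exists_balanced_of_exchangeStable :
    ∃ D ε : ℝ, 0 ≤ D ∧ 0 < ε ∧ ∀ D' : ℝ, ∃ n₀ : ℕ, ∀ q : Fin K → ℕ, n₀ ≤ ∑ k, q k →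
      E.posteriorVar q ≤ ε → E.ExchangeStable D' q → E.Balanced (max D D') q := by
  obtain ⟨ε₁, hε₁, hlinear⟩ := exists_exchangeStable_linear_le hV hσ hC
  obtain ⟨ε₂, hε₂, hhalf⟩ := exists_abs_sourcePrecision_mulVec_le_half hV hC
  obtain ⟨L, hL, hLle⟩ := exists_abs_mulVec_le E.sourcePrecision
  set W := ∑ i, E.weight i
  set S := ∑ i, √(E.sigmaSq i : ℝ)
  have hW : 0 ≤ W := Finset.sum_nonneg fun i _ => weight_nonneg i
  have hS (i : Fin K) : √(E.sigmaSq i : ℝ) ≤ S :=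
    Finset.single_le_sum (f := fun i => √(E.sigmaSq i : ℝ)) (fun _ _ => by positivity)
      (Finset.mem_univ i)
  refine ⟨2 * W + 2 * (S * (L * (6 * W * S))), min ε₁ (ε₂ / 2), by positivity, by positivity,
    fun D' => ?_⟩
  obtain ⟨n₀, hn₀⟩ := hlinear D'
  refine ⟨max n₀ 1, fun q hq hf hstable j k => ?_⟩
  obtain h | ⟨hj, hle⟩ := hstable j k
  · exact h.trans (le_max_right _ _)
  refine le_trans ?_ (le_max_left _ _)
  have hlin := hn₀ q ((le_max_left _ _).trans hq) (hf.trans (min_le_left _ _)) hstable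
  have hn : (1 : ℝ) ≤ ((∑ i, q i : ℕ) : ℝ) := by exact_mod_cast (le_max_right _ _).trans hq
  have hj2 : 2 ≤ q j := by
    by_contra! hlt
    have hq1 : W * q j ≤ W * 1 := by gcongr; exact_mod_cast Nat.le_of_lt_succ hlt
    nlinarith [hlin j, weight_pos hσ hC j]
  have hhalf' := hhalf (exchange q j k) (by
    linarith [posteriorVar_le_two_mul hV (le_two_mul_exchange hj2 k), min_le_right ε₁ (ε₂ / 2)])
  have hx (i : Fin K) :
      |((∑ l, q l : ℕ) : ℝ) * E.sourceCov (exchange q j k) i| ≤ 6 * W * S := by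
    rw [abs_mul, Nat.abs_cast]
    refine (mul_abs_sourceCov_le hV hσ hC (hhalf' i) ?_).trans (by gcongr; exact hS i)
    have hqi : W * q i ≤ W * (exchange q j k i + 1) := by
      gcongr
      exact_mod_cast le_exchange_add_one hj k i
    linarith [hlin i]
  refine mul_weight_sub_le hV hσ hC.1 rfl hj hle fun i => ?_
  have hi := hLle (((∑ l, q l : ℕ) : ℝ) • E.sourceCov (exchange q j k)) _ hx i
  rwa [Matrix.mulVec_smul, Pi.smul_apply, smul_eq_mul, abs_mul, Nat.abs_cast] at hi

lemma exists_isOptCount_balanced (D : ℝ) :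
    ∃ D₀ ≥ D, ∀ q, E.IsOptCount q → E.Balanced D₀ q := by
  obtain ⟨D₁, ε, hD₁, hε, hbal⟩ := exists_balanced_of_exchangeStable hV hσ hC
  obtain ⟨n₁, hn₁⟩ := hbal D₁
  obtain ⟨n₂, hn₂⟩ := exists_isOptCount_posteriorVar_le hV hσ hC hε
  refine ⟨max D (max D₁ ((max n₁ n₂ : ℕ) * ∑ i, E.weight i)), le_max_left _ _, fun q hq => ?_⟩
  obtain hlarge | hsmall := le_total (max n₁ n₂) (∑ k, q k)
  · have hf := hn₂ q ((le_max_right _ _).trans hlarge) hq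
    refine (hn₁ q ((le_max_left _ _).trans hlarge) hf (hq.exchangeStable hD₁)).mono ?_
    rw [max_self]
    exact (le_max_left _ _).trans (le_max_right _ _)
  · exact (balanced_of_sum_le hsmall).mono ((le_max_right _ _).trans (le_max_right _ _))

lemma exists_balance_const :
    ∃ (D : ℝ) (n₀ : ℕ), (∀ q, E.IsOptCount q → E.Balanced D q) ∧
      ∀ (c : Fin K → ℕ) (N : ℕ), n₀ ≤ ∑ k, c k → E.Balanced D c →
        E.Balanced D (c + E.myopicBlock c N) := by
  obtain ⟨D₁, ε, -, hε, hbal⟩ := exists_balanced_of_exchangeStable hV hσ hC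
  obtain ⟨D, hD, hopt⟩ := exists_isOptCount_balanced hV hσ hC D₁
  obtain ⟨n₁, hn₁⟩ := hbal D
  obtain ⟨n₂, hn₂⟩ := exists_balanced_posteriorVar_le hV hσ hC hε D
  refine ⟨D, max n₁ n₂, hopt, fun c N hc hcbal => ?_⟩
  have hle : c ≤ c + E.myopicBlock c N := le_self_add
  have hlarge : n₁ ≤ ∑ k, (c + E.myopicBlock c N) k :=
    ((le_max_left _ _).trans hc).trans (Finset.sum_le_sum fun k _ => hle k)
  have hf : E.posteriorVar (c + E.myopicBlock c N) ≤ ε :=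
    (posteriorVar_antitone hV hle).trans (hn₂ c ((le_max_right _ _).trans hc) hcbal)
  simpa only [max_eq_right hD] using hn₁ _ hlarge hf (hcbal.exchangeStable_add_myopicBlock N)

end Balance

end InfoEnv

end SignalAcquisition

namespace SignalAcquisition

/-- The simulated intensity, given the original intensity `N` and the number `lead` of signals by
which the simulation is ahead: as long as the lead is less than `D`, an intensity between `1` and
`B` is raised to `B`. -/
def boost (B D N lead : ℕ) : ℕ := if 1 ≤ N ∧ N < B ∧ lead < D then B else N

lemma le_boost (B D N lead : ℕ) : N ≤ boost B D N lead := by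
  unfold boost; split_ifs <;> omega

@[simp]
lemma boost_zero_intensity (B D lead : ℕ) : boost B D 0 lead = 0 := by
  simp [boost]

lemma le_boost_of_lead_lt {B D N lead : ℕ} (hN : N ≠ 0) (h : lead < D) :
    B ≤ boost B D N lead := by
  unfold boost; split_ifs <;> omega

namespace InfoEnv

variable {K : ℕ} {E : InfoEnv K}

section Convex

lemma IsConvex.add_le_add_of_lt {g : ℝ≥0 → EReal} (hg : IsConvex g) {u v : ℕ} (huv : u < v)
    (hu : g u ≠ ⊤) (hv : g v ≠ ⊤) :
    g ((u + 1 : ℕ) : ℝ≥0) + g ((v - 1 : ℕ) : ℝ≥0) ≤ g u + g v := by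
  obtain ⟨d, rfl⟩ := Nat.exists_eq_add_of_lt huv
  obtain rfl | hd := Nat.eq_zero_or_pos d
  · simp [add_comm]
  have : (0 : ℝ≥0) < d := Nat.cast_pos.2 hd
  set a : ℝ≥0 := d / (d + 1) with ha
  set b : ℝ≥0 := 1 / (d + 1) with hb
  have hab : a + b = 1 := by rw [ha, hb, ← add_div, div_self (by positivity)]
  have hleft : a * u + b * (u + d + 1 : ℕ) = ((u + 1 : ℕ) : ℝ≥0) := by
    rw [ha, hb]; push_cast; field_simp; ring
  have hright : b * u + a * (u + d + 1 : ℕ) = ((u + d + 1 - 1 : ℕ) : ℝ≥0) := by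
    rw [ha, hb, Nat.add_sub_cancel]; push_cast; field_simp; ring
  have hgleft := hg.2 u (u + d + 1 : ℕ) a b (by positivity) (by positivity) hab
  have hgright := hg.2 u (u + d + 1 : ℕ) b a (by positivity) (by positivity) (add_comm a b ▸ hab)
  rw [hleft] at hgleft
  rw [hright] at hgright
  refine (add_le_add hgleft hgright).trans (le_of_eq ?_)
  lift g u to ℝ using ⟨hu, hg.1 _⟩ with x
  lift g (u + d + 1 : ℕ) to ℝ using ⟨hv, hg.1 _⟩ with y
  have hab' : (a : ℝ) + b = 1 := by exact_mod_cast hab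
  norm_cast
  linear_combination (x + y) * hab'

variable {g : Fin K → ℝ≥0 → EReal} (hg : ∀ k, IsConvex (g k))

include hg

lemma sum_ne_bot_of_isConvex (q : Fin K → ℕ) : ∑ k, g k (q k) ≠ ⊥ :=
  Finset.sum_induction _ (· ≠ ⊥) (fun a b ha hb => by simp [ha, hb]) (by simp)
    fun k _ => (hg k).1 _

lemma ne_top_of_sum_ne_top {q : Fin K → ℕ} (hq : ∑ k, g k (q k) ≠ ⊤) (k : Fin K) :
    g k (q k) ≠ ⊤ := by
  intro hk
  refine hq ?_
  rw [← Finset.add_sum_erase _ _ (Finset.mem_univ k), hk]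
  exact EReal.top_add_of_ne_bot (Finset.sum_induction _ (· ≠ ⊥)
    (fun a b ha hb => by simp [ha, hb]) (by simp) fun i _ => (hg i).1 _)

lemma sum_exchange_add_sum_exchange_le {c q : Fin K → ℕ} {i j : Fin K} (hi : c i < q i)
    (hj : q j < c j) (hc : ∑ k, g k (c k) ≠ ⊤) (hq : ∑ k, g k (q k) ≠ ⊤) :
    ∑ k, g k (exchange q i j k) + ∑ k, g k (exchange c j i k) ≤
      ∑ k, g k (q k) + ∑ k, g k (c k) := by
  have hij : i ≠ j := by rintro rfl; omega
  rw [← Finset.sum_add_distrib, ← Finset.sum_add_distrib]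
  refine Finset.sum_le_sum fun k _ => ?_
  have hck := ne_top_of_sum_ne_top hg hc k
  have hqk := ne_top_of_sum_ne_top hg hq k
  have hqx := congrFun (exchange_add_single (Nat.one_le_of_lt hi) j) k
  have hcx := congrFun (exchange_add_single (Nat.one_le_of_lt hj) i) k
  simp only [Pi.add_apply, Pi.single_apply] at hqx hcx
  obtain rfl | hki := eq_or_ne k i
  · simp only [↓reduceIte, if_neg hij, add_zero] at hqx hcx
    rw [hcx, Nat.eq_sub_of_add_eq hqx, add_comm, add_comm (g k (q k))]
    exact (hg k).add_le_add_of_lt hi hck hqk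
  obtain rfl | hkj := eq_or_ne k j
  · simp only [↓reduceIte, if_neg hki, add_zero] at hqx hcx
    rw [hqx, Nat.eq_sub_of_add_eq hcx]
    exact (hg k).add_le_add_of_lt hj hqk hck
  · simp only [if_neg hki, if_neg hkj, add_zero] at hqx hcx
    rw [hqx, hcx]

end Convex

lemma sum_sub_exchange_lt {c q : Fin K → ℕ} {i j : Fin K} (hi : c i < q i) (hj : q j < c j) :
    ∑ k, (c k - exchange q i j k) < ∑ k, (c k - q k) := by
  have hx (k : Fin K) := congrFun (exchange_add_single (Nat.one_le_of_lt hi) j) k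
  simp only [Pi.add_apply, Pi.single_apply] at hx
  refine Finset.sum_lt_sum (fun k _ => ?_) ⟨j, Finset.mem_univ j, ?_⟩
  · have hxk := hx k
    obtain rfl | hki := eq_or_ne k i
    · split_ifs at hxk <;> omega
    · rw [if_neg hki] at hxk
      omega
  · have hxj := hx j
    rw [if_pos rfl, if_neg (by rintro rfl; omega)] at hxj
    omega

variable [NeZero K]

/-- A relation between the signal counts `c` of a simulation and the counts `q` of the simulated
strategy that ensures that the simulation is at least as well informed, and that is maintained if
the simulation chooses signals myopically, with boosted intensities. -/
structure IsSimulationInvariant (E : InfoEnv K) (B D : ℕ)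
    (R : (Fin K → ℕ) → (Fin K → ℕ) → Prop) : Prop where
  zero : R 0 0
  posteriorVar_le : ∀ c q, R c q → E.posteriorVar c ≤ E.posteriorVar q
  sum_le : ∀ c q, R c q → ∑ k, q k ≤ ∑ k, c k
  step : ∀ c q n, R c q →
    R (c + E.myopicBlock c (boost B D (∑ k, n k) (∑ k, c k - ∑ k, q k))) (q + n)

section NonRedundant

variable (hV : E.V₀.PosDef) (hσ : ∀ k, 0 < E.sigmaSq k) (hC : E.NonRedundant)

include hσ hC in
lemma exists_balanced_le (D : ℝ) : ∃ n₁ : ℕ, ∀ c q, E.Balanced D c → E.Balanced D q →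
    ∑ k, q k + n₁ ≤ ∑ k, c k → q ≤ c := by
  obtain ⟨n₁, hn₁⟩ := exists_le_mul_weight hσ hC (2 * (K * D))
  have hW : 0 < ∑ i, E.weight i :=
    Finset.sum_pos (fun i _ => weight_pos hσ hC i) Finset.univ_nonempty
  refine ⟨n₁, fun c q hc hq hsum k => ?_⟩
  have hgap : (((∑ j, q j : ℕ) : ℝ) + n₁) * E.weight k ≤ ((∑ j, c j : ℕ) : ℝ) * E.weight k :=
    mul_le_mul_of_nonneg_right (by exact_mod_cast hsum) (weight_nonneg k)
  have hk : (q k : ℝ) * ∑ i, E.weight i ≤ c k * ∑ i, E.weight i := by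
    linarith [hc.sum_mul_weight_le k, hq.mul_sum_weight_le k, hn₁ n₁ le_rfl k]
  exact_mod_cast le_of_mul_le_mul_right hk hW

include hV hσ hC in
/-- As long as the lead is small, blocks of at least `D` signals take optimal counts to optimal
counts; once the lead is at least `D`, it suffices that the simulation stays balanced. -/
lemma exists_simulationInvariant :
    ∃ D : ℕ, ∀ B, D ≤ B → ∃ R, E.IsSimulationInvariant B D R := by
  obtain ⟨D₁, n₀, hopt, hstep⟩ := exists_balance_const hV hσ hC
  obtain ⟨n₁, hdom⟩ := exists_balanced_le hσ hC D₁
  set D := max n₀ n₁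
  have hn₀ : n₀ ≤ D := le_max_left _ _
  have hn₁ : n₁ ≤ D := le_max_right _ _
  refine ⟨D, fun B hB => ⟨fun c q => ∑ k, q k ≤ ∑ k, c k ∧ (E.IsOptCount c ∨
    ∑ k, q k + D ≤ ∑ k, c k ∧ E.Balanced D₁ c), ?_, ?_, fun c q h => h.1, ?_⟩⟩
  · exact ⟨le_rfl, Or.inl E.isOptCount_zero⟩
  · rintro c q ⟨hle, hc | ⟨hlead, hc⟩⟩
    · exact hc.le_of_sum_le hV hle
    · obtain ⟨q', hq', ho⟩ := E.exists_isOptCount (∑ k, q k)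
      have hle : q' ≤ c := hdom c q' hc (hopt q' ho) (by omega)
      exact (posteriorVar_antitone hV hle).trans (ho q hq'.symm)
  · rintro c q n ⟨hle, hinv⟩
    have hb := le_boost B D (∑ k, n k) (∑ k, c k - ∑ k, q k)
    simp only [Pi.add_apply, Finset.sum_add_distrib, sum_myopicBlock]
    refine ⟨by omega, ?_⟩
    obtain hlead | hlead := le_or_gt (∑ k, q k + D) (∑ k, c k)
    · exact Or.inr ⟨by omega, hstep c _ (by omega) (hinv.elim (hopt c) And.right)⟩
    · have hc : E.IsOptCount c := hinv.resolve_right fun h => h.1.not_gt hlead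
      refine Or.inl ?_
      obtain hn | hn := eq_or_ne (∑ k, n k) 0
      · rw [hn, boost_zero_intensity]
        exact hc.add_myopicBlock le_rfl (add_zero _).symm
      · have hBb := le_boost_of_lead_lt (B := B) (D := D) (lead := ∑ k, c k - ∑ k, q k) hn
          (by omega)
        obtain ⟨q', hq', ho⟩ := E.exists_isOptCount
          (∑ k, c k + boost B D (∑ k, n k) (∑ k, c k - ∑ k, q k))
        exact ho.add_myopicBlock (hdom q' c (hopt q' ho) (hopt c hc) (by omega)) hq'

end NonRedundant

section Separable

lemma posteriorVar_eq_of_le_single (hV : E.V₀.PosDef) (hσ : ∀ k, 0 < E.sigmaSq k)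
    (h : ∀ k, E.posteriorVar 0 ≤ E.posteriorVar (Pi.single k 1)) (q : Fin K → ℕ) :
    E.posteriorVar q = E.posteriorVar 0 := by
  have hsingle (k : Fin K) : E.sourceCov (Pi.single k 1) k = 0 := by
    have hle := posteriorVar_add_sum_le hV 0 (Pi.single k 1)
    rw [Finset.sum_eq_single k (fun i _ hi => by simp [hi]) (by simp)] at hle
    simp only [Pi.single_eq_same, Nat.cast_one, Pi.zero_apply, Nat.cast_zero, sub_zero] at hle
    have hs : (0 : ℝ) < 1 / E.sigmaSq k := one_div_pos.2 (hσ k)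
    have hsq : E.sourceCov (Pi.single k 1) k ^ 2 ≤ 0 :=
      nonpos_of_mul_nonpos_right (by linarith [h k]) hs
    exact pow_eq_zero_iff two_ne_zero |>.1 (le_antisymm hsq (sq_nonneg _))
  have hzero (k : Fin K) : E.sourceCov 0 k = 0 := by
    have hrow : E.covRow 0 = E.covRow (Pi.single k 1) := by
      refine covRow_eq_of_sourceCov_eq_zero hV fun i hi => ?_
      obtain rfl | hik := eq_or_ne i k
      · exact hsingle i
      · simp [hik] at hi
    rw [← hsingle k, sourceCov, sourceCov, hrow]
  have hrow : E.covRow q = E.covRow 0 := covRow_eq_of_sourceCov_eq_zero hV fun k _ => hzero k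
  rw [← covRow_apply_zero, ← covRow_apply_zero, hrow]

variable {g : Fin K → ℝ≥0 → EReal} (hg : ∀ k, IsConvex (g k))

include hg in
lemma exists_le_sum_le_of_isConvex {c : Fin K → ℕ} (hc : ∑ k, g k (c k) ≠ ⊤)
    (hmin : ∀ m : Fin K → ℕ, ∑ k, m k = ∑ k, c k → ∑ k, g k (c k) ≤ ∑ k, g k (m k))
    (q : Fin K → ℕ) (hcq : ∑ k, c k ≤ ∑ k, q k) :
    ∃ q', c ≤ q' ∧ ∑ k, q' k = ∑ k, q k ∧ ∑ k, g k (q' k) ≤ ∑ k, g k (q k) := by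
  by_cases hq : ∑ k, g k (q k) = ⊤
  · obtain ⟨q', hle, hsum⟩ := exists_le_sum_eq c hcq
    exact ⟨q', hle, hsum, hq ▸ le_top⟩
  induction hdef : ∑ k, (c k - q k) using Nat.strong_induction_on generalizing q with
  | _ deficit ih =>
    by_cases hle : c ≤ q
    · exact ⟨q, hle, rfl, le_rfl⟩
    obtain ⟨j, hj⟩ : ∃ j, q j < c j := by simpa [Pi.le_def] using hle
    obtain ⟨i, hi⟩ : ∃ i, c i < q i := by
      by_contra! h
      exact hcq.not_gt (Finset.sum_lt_sum (fun k _ => h k) ⟨j, Finset.mem_univ j, hj⟩)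
    have hsum := sum_exchange (Nat.one_le_of_lt hi) j
    have hvalue : ∑ k, g k (exchange q i j k) ≤ ∑ k, g k (q k) := by
      have hexchange := (add_le_add_right (hmin _ (sum_exchange (Nat.one_le_of_lt hj) i)) _).trans
        (sum_exchange_add_sum_exchange_le hg hi hj hc hq)
      lift ∑ k, g k (c k) to ℝ using ⟨hc, sum_ne_bot_of_isConvex hg c⟩ with x
      exact (EReal.addLECancellable_coe x).add_le_add_iff_right.1 hexchange
    obtain ⟨q', hcq', hq', hle'⟩ := ih _ (hdef ▸ sum_sub_exchange_lt hi hj) (exchange q i j)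
      (hcq.trans hsum.ge)
      (ne_top_of_le_ne_top hq hvalue) rfl
    exact ⟨q', hcq', hq'.trans hsum, hle'.trans hvalue⟩

lemma Separable.add_myopicBlock (hV : E.V₀.PosDef) (hσ : ∀ k, 0 < E.sigmaSq k)
    (hsep : E.Separable) {c : Fin K → ℕ} (hc : E.IsOptCount c) (N : ℕ) :
    E.IsOptCount (c + E.myopicBlock c N) := by
  by_cases huninformative : ∀ k, E.posteriorVar 0 ≤ E.posteriorVar (Pi.single k 1)
  · intro m _
    rw [posteriorVar_eq_of_le_single hV hσ huninformative m,
      posteriorVar_eq_of_le_single hV hσ huninformative]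
  push Not at huninformative
  obtain ⟨k, hk⟩ := huninformative
  obtain ⟨q, hq, ho⟩ := E.exists_isOptCount (∑ k, c k + N)
  obtain hc₀ | hc₀ := Nat.eq_zero_or_pos (∑ k, c k)
  · refine ho.add_myopicBlock (fun k => ?_) hq
    rw [Finset.sum_eq_zero_iff.1 hc₀ k (Finset.mem_univ k)]
    exact Nat.zero_le _
  obtain ⟨g, F, hg, hF, hfF⟩ := hsep
  have hiff (q q' : Fin K → ℕ) :
      E.posteriorVar q ≤ E.posteriorVar q' ↔ ∑ k, g k (q k) ≤ ∑ k, g k (q' k) := by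
    rw [hfF, hfF]
    exact hF.le_iff_le ⟨q, rfl⟩ ⟨q', rfl⟩
  have hctop : ∑ k, g k (c k) ≠ ⊤ := by
    intro htop
    have hsingle : E.posteriorVar c ≤ E.posteriorVar (Pi.single k 1) :=
      hc.le_of_sum_le hV (by simpa using Nat.one_le_of_lt hc₀)
    have hzero : E.posteriorVar 0 ≤ E.posteriorVar c := (hiff _ _).2 (htop ▸ le_top)
    exact (hk.trans_le hzero).not_ge hsingle
  obtain ⟨q', hcq', hsum, hle⟩ := exists_le_sum_le_of_isConvex hg hctop
    (fun m hm => (hiff _ _).1 (hc m hm)) q (hq ▸ Nat.le_add_right _ _)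
  have ho' : E.IsOptCount q' := fun m hm => ((hiff _ _).2 hle).trans (ho m (hm.trans hsum))
  exact ho'.add_myopicBlock hcq' (hsum.trans hq)

lemma Separable.isSimulationInvariant (hV : E.V₀.PosDef) (hσ : ∀ k, 0 < E.sigmaSq k)
    (hsep : E.Separable) :
    E.IsSimulationInvariant 0 0 fun c q => E.IsOptCount c ∧ ∑ k, q k = ∑ k, c k where
  zero := ⟨E.isOptCount_zero, rfl⟩
  posteriorVar_le _ q h := h.1 q h.2
  sum_le _ _ h := h.2.le
  step c q n h := by
    refine ⟨hsep.add_myopicBlock hV hσ h.1 _, ?_⟩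
    simp [Finset.sum_add_distrib, boost, h.2]

end Separable

end InfoEnv

end SignalAcquisition

namespace SignalAcquisition

section CenteredGaussian

variable {Ω Ω' : Type*} [MeasurableSpace Ω] [MeasurableSpace Ω'] {μ : Measure Ω}
  {ν : Measure Ω'} {v w : ℝ}

lemma hasLaw_gaussianReal_prod_add {X : Ω → ℝ} {Y : Ω' → ℝ} (hv : 0 ≤ v) (hw : 0 ≤ w)
    (hX : HasLaw X (gaussianReal 0 v.toNNReal) μ) (hY : HasLaw Y (gaussianReal 0 w.toNNReal) ν) :
    HasLaw (fun p : Ω × Ω' => X p.1 + Y p.2) (gaussianReal 0 (v + w).toNNReal) (μ.prod ν) := by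
  have := hX.isProbabilityMeasure
  have := hY.isProbabilityMeasure
  have hX' := hX.comp (measurePreserving_fst (ν := ν)).hasLaw
  have hY' := hY.comp (measurePreserving_snd (μ := μ)).hasLaw
  have hlaw := gaussianReal_conv_gaussianReal (m₁ := 0) (m₂ := 0) (v₁ := v.toNNReal)
    (v₂ := w.toNNReal)
  rw [add_zero, ← Real.toNNReal_add hv hw] at hlaw
  rw [← hlaw]
  exact (indepFun_prod₀ hX.aemeasurable hY.aemeasurable).hasLaw_fun_add hX' hY'

lemma hasLaw_gaussianReal_const_mul {X : Ω → ℝ} (hX : HasLaw X (gaussianReal 0 v.toNNReal) μ)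
    (c : ℝ) : HasLaw (fun ω => c * X ω) (gaussianReal 0 (c ^ 2 * v).toNNReal) μ := by
  have h := gaussianReal_const_mul hX c
  rw [mul_zero] at h
  convert h
  rw [Real.toNNReal_mul (sq_nonneg c), Real.toNNReal_of_nonneg (sq_nonneg c)]

lemma hasLaw_gaussianReal_pi_sum {ι : Type*} [Fintype ι] {Ω : ι → Type*}
    [∀ i, MeasurableSpace (Ω i)] {μ : ∀ i, Measure (Ω i)} {X : ∀ i, Ω i → ℝ} {v : ι → ℝ}
    (hv : ∀ i, 0 ≤ v i) (hX : ∀ i, HasLaw (X i) (gaussianReal 0 (v i).toNNReal) (μ i)) :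
    HasLaw (fun ω => ∑ i, X i (ω i)) (gaussianReal 0 (∑ i, v i).toNNReal) (Measure.pi μ) := by
  have (i : ι) := (hX i).isProbabilityMeasure
  have hcomp (i : ι) : HasLaw (fun ω => X i (ω i)) (gaussianReal 0 (v i).toNNReal)
      (Measure.pi μ) := (hX i).fun_comp (measurePreserving_eval μ i).hasLaw
  have hindep : iIndepFun (fun i (ω : ∀ i, Ω i) => X i (ω i)) (Measure.pi μ) :=
    iIndepFun_pi fun i => (hX i).aemeasurable
  have hm : AEMeasurable (fun ω => ∑ i, X i (ω i)) (Measure.pi μ) :=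
    Finset.aemeasurable_fun_sum _ fun i _ => (hcomp i).aemeasurable
  refine ⟨hm, Measure.ext_of_charFun (funext fun r => ?_)⟩
  rw [hindep.charFun_map_fun_sum_eq_prod fun i => (hcomp i).aemeasurable]
  simp only [Finset.prod_apply, (hcomp _).map_eq, charFun_gaussianReal]
  rw [← Complex.exp_sum, Real.coe_toNNReal _ (Finset.sum_nonneg fun i _ => hv i)]
  congr 1
  simp only [Real.coe_toNNReal _ (hv _), Complex.ofReal_zero, mul_zero, zero_mul, zero_sub,
    Complex.ofReal_sum, Finset.sum_neg_distrib, Finset.sum_mul, Finset.sum_div]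

lemma hasLaw_sqrt_mul (hv : 0 ≤ v) :
    HasLaw (fun g => √v * g) (gaussianReal 0 v.toNNReal) (gaussianReal 0 1) := by
  have h : HasLaw (fun g : ℝ => g) (gaussianReal 0 (1 : ℝ).toNNReal) (gaussianReal 0 1) := by
    rw [Real.toNNReal_one]; exact HasLaw.id
  simpa only [Real.sq_sqrt hv, mul_one] using hasLaw_gaussianReal_const_mul h √v

lemma identDistrib_of_forall_strongDual {F : Type*} [NormedAddCommGroup F] [NormedSpace ℝ F]
    [CompleteSpace F] [SecondCountableTopology F] [MeasurableSpace F] [BorelSpace F]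
    [IsFiniteMeasure μ] [IsFiniteMeasure ν] {X : Ω → F} {Y : Ω' → F}
    (hX : AEMeasurable X μ) (hY : AEMeasurable Y ν)
    (h : ∀ L : StrongDual ℝ F, IdentDistrib (fun ω => L (X ω)) (fun ω => L (Y ω)) μ ν) :
    IdentDistrib X Y μ ν := by
  refine ⟨hX, hY, Measure.ext_of_charFunDual (funext fun L => ?_)⟩
  rw [charFunDual_eq_charFun_map_one, charFunDual_eq_charFun_map_one,
    AEMeasurable.map_map_of_aemeasurable (by fun_prop) hX,
    AEMeasurable.map_map_of_aemeasurable (by fun_prop) hY]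
  exact congrArg (charFun · 1) (h L).map_eq

end CenteredGaussian

/-- The realizations of a block of signals. -/
abbrev Block {K : ℕ} (n : Fin K → ℕ) : Type := (k : Fin K) → Fin (n k) → ℝ

section BlockDot

variable {K : ℕ} {n : Fin K → ℕ}

/-- The linear functional of a block of signals with coefficients `u`. -/
def blockDot (u y : Block n) : ℝ := ∑ k, ∑ j, u k j * y k j

lemma blockDot_add_left (u v y : Block n) :
    blockDot (u + v) y = blockDot u y + blockDot v y := by
  simp only [blockDot, Pi.add_apply, add_mul, Finset.sum_add_distrib]

lemma exists_strongDual_eq_blockDot (L : StrongDual ℝ (Block n)) :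
    ∃ u : Block n, ∀ y, L y = blockDot u y := by
  refine ⟨fun k j => L (Pi.single k (Pi.single j 1)), fun y => ?_⟩
  have h : y = ∑ k, ∑ j, y k j • (Pi.single k (Pi.single j 1) : Block n) := by
    ext k j
    simp only [Finset.sum_apply, Pi.smul_apply, smul_eq_mul]
    rw [Finset.sum_eq_single k, Finset.sum_eq_single j]
    · simp
    · intro i _ hi; simp [hi.symm]
    · simp
    · intro i _ hi; simp [hi.symm]
    · simp
  conv_lhs => rw [h]
  simp only [map_sum, map_smul, blockDot, smul_eq_mul, mul_comm]

lemma exists_strongDual_eq_dotProduct {ι : Type*} [Fintype ι]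
    (L : StrongDual ℝ (EuclideanSpace ℝ ι)) :
    ∃ w : ι → ℝ, ∀ x, L x = w ⬝ᵥ WithLp.ofLp x := by
  classical
  refine ⟨fun i => L (EuclideanSpace.single i 1), fun x => ?_⟩
  have h : x = ∑ i, x i • EuclideanSpace.single i (1 : ℝ) := by
    ext i
    simp [Finset.sum_apply, Pi.single_apply]
  conv_lhs => rw [h]
  simp only [map_sum, map_smul, dotProduct, smul_eq_mul, mul_comm]

lemma identDistrib_of_forall_blockDot {Ω Ω' F : Type*} [MeasurableSpace Ω] [MeasurableSpace Ω']
    {μ : Measure Ω} {ν : Measure Ω'} [IsFiniteMeasure μ] [IsFiniteMeasure ν]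
    [NormedAddCommGroup F] [NormedSpace ℝ F] [CompleteSpace F] [SecondCountableTopology F]
    [MeasurableSpace F] [BorelSpace F] {X : Ω → Block n × F} {Y : Ω' → Block n × F}
    (hX : AEMeasurable X μ) (hY : AEMeasurable Y ν)
    (h : ∀ (u : Block n) (L : StrongDual ℝ F),
      IdentDistrib (fun ω => blockDot u (X ω).1 + L (X ω).2)
        (fun ω => blockDot u (Y ω).1 + L (Y ω).2) μ ν) :
    IdentDistrib X Y μ ν := by
  refine identDistrib_of_forall_strongDual hX hY fun L => ?_
  obtain ⟨u, L', hL⟩ : ∃ (u : Block n) (L' : StrongDual ℝ F),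
      ∀ p : Block n × F, L p = blockDot u p.1 + L' p.2 := by
    obtain ⟨u, hu⟩ := exists_strongDual_eq_blockDot
      (L.comp (ContinuousLinearMap.inl ℝ (Block n) F))
    refine ⟨u, L.comp (ContinuousLinearMap.inr ℝ (Block n) F), fun p => ?_⟩
    rw [← hu, ContinuousLinearMap.comp_inl_add_comp_inr]
  simp only [hL]
  exact h u L'

end BlockDot

namespace InfoEnv

variable {K : ℕ} {E : InfoEnv K} {n : Fin K → ℕ}

/-- The law of the noise in a block of signals. -/
noncomputable def blockNoise (E : InfoEnv K) (n : Fin K → ℕ) : Measure (Block n) :=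
  Measure.pi fun k => Measure.pi fun _ : Fin (n k) => gaussianReal 0 (E.sigmaSq k)

instance : IsProbabilityMeasure (E.blockNoise n) := by
  unfold blockNoise; infer_instance

/-- The signals at the state `θ` with noise `e`. -/
noncomputable def observe (E : InfoEnv K) (θ : EuclideanSpace ℝ (Fin K)) (e : Block n) :
    Block n :=
  fun k j => (∑ i, E.C k i * θ i) + e k j

/-- The standard Gaussian law of state vectors. -/
noncomputable abbrev stdState (K : ℕ) : Measure (EuclideanSpace ℝ (Fin K)) :=
  stdGaussian (EuclideanSpace ℝ (Fin K))

open scoped MatrixOrder in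
/-- The square root of the posterior covariance matrix; it maps `stdState` to the law of the state
around the posterior mean. -/
noncomputable def root (E : InfoEnv K) (q : Fin K → ℕ) :
    EuclideanSpace ℝ (Fin K) →L[ℝ] EuclideanSpace ℝ (Fin K) :=
  Matrix.toEuclideanCLM (𝕜 := ℝ) (CFC.sqrt (E.postCov q))

/-- The change of the posterior mean of the states caused by the signal innovations `y`, where `q`
are the counts including the block. -/
noncomputable def gain (E : InfoEnv K) (q : Fin K → ℕ) (y : Block n) :
    EuclideanSpace ℝ (Fin K) :=
  WithLp.toLp 2 (E.postCov q *ᵥ (E.Cᵀ *ᵥ fun k => (∑ j, y k j) / (E.sigmaSq k : ℝ)))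

section Measurability

variable {α : Type*} [MeasurableSpace α]

@[fun_prop]
lemma measurable_observe {f : α → EuclideanSpace ℝ (Fin K)} {g : α → Block n}
    (hf : Measurable f) (hg : Measurable g) : Measurable fun a => E.observe (f a) (g a) := by
  refine measurable_pi_lambda _ fun k => measurable_pi_lambda _ fun j => ?_
  unfold observe
  fun_prop

@[fun_prop]
lemma measurable_gain (q : Fin K → ℕ) {f : α → Block n} (hf : Measurable f) :
    Measurable fun a => E.gain q (f a) := by
  unfold gain
  refine (WithLp.measurable_toLp 2 _).comp (measurable_pi_lambda _ fun i => ?_)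
  simp only [Matrix.mulVec, dotProduct]
  fun_prop

end Measurability

section LinearFunctionals

/-- The coefficients of the states in the linear functional `blockDot u` of a block of signals. -/
noncomputable def loading (E : InfoEnv K) (u : Block n) : Fin K → ℝ :=
  E.Cᵀ *ᵥ fun k => ∑ j, u k j

/-- The variance of the noise in the linear functional `blockDot u` of a block of signals. -/
noncomputable def noiseVar (E : InfoEnv K) (u : Block n) : ℝ :=
  ∑ k, ∑ j, u k j ^ 2 * (E.sigmaSq k : ℝ)

/-- The variance of `blockDot u y + w ⬝ᵥ θ` when `θ` has covariance matrix `postCov q` and `y` are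
the signals at `θ`. -/
noncomputable def obsVar (E : InfoEnv K) (q : Fin K → ℕ) (u : Block n) (w : Fin K → ℝ) : ℝ :=
  (E.loading u + w) ⬝ᵥ (E.postCov q *ᵥ (E.loading u + w)) + E.noiseVar u

/-- The coefficients of the linear functional `w` of the gain. -/
noncomputable def gainCoeff (E : InfoEnv K) (q n : Fin K → ℕ) (w : Fin K → ℝ) : Block n :=
  fun k _ => (E.C *ᵥ (E.postCov q *ᵥ w)) k / (E.sigmaSq k : ℝ)

lemma loading_dotProduct (u : Block n) (x : Fin K → ℝ) :
    E.loading u ⬝ᵥ x = ∑ k, (∑ j, u k j) * (E.C *ᵥ x) k := by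
  rw [loading, Matrix.mulVec_transpose, ← Matrix.dotProduct_mulVec]
  rfl

lemma loading_add (u v : Block n) : E.loading (u + v) = E.loading u + E.loading v := by
  rw [loading, loading, loading, ← Matrix.mulVec_add]
  congr 1
  ext k
  simp only [Pi.add_apply, Finset.sum_add_distrib]

lemma loading_gainCoeff (q : Fin K → ℕ) (w : Fin K → ℝ) :
    E.loading (E.gainCoeff q n w) = E.obsInfo n *ᵥ (E.postCov q *ᵥ w) := by
  rw [loading, obsInfo, ← Matrix.mulVec_mulVec, ← Matrix.mulVec_mulVec]
  congr 1
  ext k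
  simp only [gainCoeff, Finset.sum_const, Finset.card_univ, Fintype.card_fin, nsmul_eq_mul,
    Matrix.mulVec_diagonal]
  ring

lemma noiseVar_add_gainCoeff (hσ : ∀ k, 0 < E.sigmaSq k) (q : Fin K → ℕ) (u : Block n)
    (w : Fin K → ℝ) :
    E.noiseVar (u + E.gainCoeff q n w) = E.noiseVar u + 2 * (E.loading u ⬝ᵥ (E.postCov q *ᵥ w)) +
      E.loading (E.gainCoeff q n w) ⬝ᵥ (E.postCov q *ᵥ w) := by
  simp only [loading_dotProduct, noiseVar, Finset.sum_mul, Finset.mul_sum]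
  rw [← Finset.sum_add_distrib, ← Finset.sum_add_distrib]
  refine Finset.sum_congr rfl fun k _ => ?_
  rw [← Finset.sum_add_distrib, ← Finset.sum_add_distrib]
  refine Finset.sum_congr rfl fun j _ => ?_
  have hk : (E.sigmaSq k : ℝ) ≠ 0 := by exact_mod_cast (hσ k).ne'
  simp only [Pi.add_apply, gainCoeff]
  field_simp
  ring

lemma dotProduct_postCov_mulVec_comm (hV : E.V₀.PosDef) (q : Fin K → ℕ) (x y : Fin K → ℝ) :
    x ⬝ᵥ (E.postCov q *ᵥ y) = y ⬝ᵥ (E.postCov q *ᵥ x) := by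
  rw [Matrix.dotProduct_mulVec, ← Matrix.mulVec_transpose,
    transpose_eq_of_posDef (postCov_posDef hV q), dotProduct_comm]

lemma dotProduct_postCov_mulVec_nonneg (hV : E.V₀.PosDef) (q : Fin K → ℕ) (x : Fin K → ℝ) :
    0 ≤ x ⬝ᵥ (E.postCov q *ᵥ x) := by
  simpa only [star_trivial] using (postCov_posDef hV q).posSemidef.dotProduct_mulVec_nonneg x

lemma noiseVar_nonneg (u : Block n) : 0 ≤ E.noiseVar u := by
  unfold noiseVar
  positivity

lemma obsVar_nonneg (hV : E.V₀.PosDef) (q : Fin K → ℕ) (u : Block n) (w : Fin K → ℝ) :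
    0 ≤ E.obsVar q u w :=
  add_nonneg (dotProduct_postCov_mulVec_nonneg hV q _) (noiseVar_nonneg u)

lemma obsVar_eq (hV : E.V₀.PosDef) (q : Fin K → ℕ) (u : Block n) (w : Fin K → ℝ) :
    E.obsVar q u w = E.obsVar q u 0 + 2 * (E.loading u ⬝ᵥ (E.postCov q *ᵥ w)) +
      w ⬝ᵥ (E.postCov q *ᵥ w) := by
  simp only [obsVar, add_zero, Matrix.mulVec_add, dotProduct_add, add_dotProduct,
    dotProduct_postCov_mulVec_comm hV q w (E.loading u)]
  ring

/-- The law of total variance: the gain is the projection of the state on the signals, and the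
remaining error has covariance `postCov (q + n)`. -/
lemma obsVar_add_gainCoeff (hV : E.V₀.PosDef) (hσ : ∀ k, 0 < E.sigmaSq k) (q : Fin K → ℕ)
    (u : Block n) (w : Fin K → ℝ) :
    E.obsVar q (u + E.gainCoeff (q + n) n w) 0 + w ⬝ᵥ (E.postCov (q + n) *ᵥ w) =
      E.obsVar q u w := by
  set a := E.loading u
  set x := E.postCov (q + n) *ᵥ w with hx
  have hcov : E.postCov q *ᵥ (E.obsInfo n *ᵥ x) = E.postCov q *ᵥ w - x := by
    have h := congrArg (· *ᵥ w) (postCov_eq_add hV q n)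
    simp only [Matrix.add_mulVec, ← Matrix.mulVec_mulVec, ← hx] at h
    rw [h, add_sub_cancel_left]
  have ha := dotProduct_postCov_mulVec_comm hV q (E.obsInfo n *ᵥ x) a
  have hw := dotProduct_postCov_mulVec_comm hV q (E.obsInfo n *ᵥ x) w
  rw [hcov, dotProduct_sub] at ha hw
  rw [obsVar_eq hV q u w]
  simp only [obsVar, loading_add, loading_gainCoeff, noiseVar_add_gainCoeff hσ, ← hx, add_zero,
    Matrix.mulVec_add, dotProduct_add, add_dotProduct, hcov, dotProduct_sub]
  linarith

lemma dotProduct_gain (hV : E.V₀.PosDef) (q : Fin K → ℕ) (w : Fin K → ℝ) (y : Block n) :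
    w ⬝ᵥ WithLp.ofLp (E.gain q y) = blockDot (E.gainCoeff q n w) y := by
  simp only [gain]
  rw [dotProduct_postCov_mulVec_comm hV, Matrix.mulVec_transpose, ← Matrix.dotProduct_mulVec]
  simp only [blockDot, gainCoeff, dotProduct, ← Finset.mul_sum]
  exact Finset.sum_congr rfl fun k _ => by ring

lemma blockDot_observe (u e : Block n) (θ : EuclideanSpace ℝ (Fin K)) :
    blockDot u (E.observe θ e) = E.loading u ⬝ᵥ WithLp.ofLp θ + blockDot u e := by
  rw [loading_dotProduct]
  simp only [blockDot, observe, mul_add, Finset.sum_add_distrib, ← Finset.sum_mul]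
  rfl

end LinearFunctionals

section Laws

lemma hasLaw_dotProduct_root (hV : E.V₀.PosDef) (q : Fin K → ℕ) (w : Fin K → ℝ) :
    HasLaw (fun z => w ⬝ᵥ WithLp.ofLp (E.root q z))
      (gaussianReal 0 (w ⬝ᵥ (E.postCov q *ᵥ w)).toNNReal) (stdState K) := by
  have hm : Measurable fun z => w ⬝ᵥ WithLp.ofLp (E.root q z) := by
    unfold dotProduct
    fun_prop
  refine ⟨hm.aemeasurable, Measure.ext_of_charFun (funext fun r => ?_)⟩
  have h := charFun_multivariateGaussian (μ := 0) (postCov_posDef hV q).posSemidef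
    (WithLp.toLp 2 (r • w))
  rw [charFun_apply, multivariateGaussian,
    integral_map (by fun_prop) (Measurable.aestronglyMeasurable (by fun_prop))] at h
  simp only [zero_add, inner_zero_right, Complex.ofReal_zero, zero_mul, zero_sub,
    EuclideanSpace.inner_eq_star_dotProduct, star_trivial, Matrix.mulVec_smul, dotProduct_smul,
    smul_dotProduct, smul_eq_mul, Complex.ofReal_mul] at h
  rw [charFun_apply_real, integral_map (by fun_prop)
    (Measurable.aestronglyMeasurable (by fun_prop)), charFun_gaussianReal,
    Real.coe_toNNReal _ (dotProduct_postCov_mulVec_nonneg hV q w)]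
  refine h.trans (congrArg Complex.exp ?_)
  push_cast
  ring

lemma hasLaw_blockDot (u : Block n) :
    HasLaw (blockDot u) (gaussianReal 0 (E.noiseVar u).toNNReal) (E.blockNoise n) := by
  have hterm (k : Fin K) (j : Fin (n k)) : 0 ≤ u k j ^ 2 * (E.sigmaSq k : ℝ) := by positivity
  refine hasLaw_gaussianReal_pi_sum (fun k => Finset.sum_nonneg fun j _ => hterm k j) fun k =>
    hasLaw_gaussianReal_pi_sum (hterm k) fun j =>
      hasLaw_gaussianReal_const_mul (X := fun x => x) ?_ (u k j)
  rw [Real.toNNReal_coe]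
  exact HasLaw.id

lemma hasLaw_blockDot_observe (hV : E.V₀.PosDef) (q : Fin K → ℕ) (u : Block n)
    (w : Fin K → ℝ) :
    HasLaw (fun p : EuclideanSpace ℝ (Fin K) × Block n =>
        blockDot u (E.observe (E.root q p.1) p.2) + w ⬝ᵥ WithLp.ofLp (E.root q p.1))
      (gaussianReal 0 (E.obsVar q u w).toNNReal) ((stdState K).prod (E.blockNoise n)) := by
  convert hasLaw_gaussianReal_prod_add (dotProduct_postCov_mulVec_nonneg hV q _)
    (noiseVar_nonneg u) (hasLaw_dotProduct_root hV q (E.loading u + w))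
    (hasLaw_blockDot u) using 2 with p
  · rw [blockDot_observe, add_dotProduct]
    ring
  · rfl

lemma identDistrib_observe_root (hV : E.V₀.PosDef) (hσ : ∀ k, 0 < E.sigmaSq k)
    (q n : Fin K → ℕ) :
    IdentDistrib
      (fun p : EuclideanSpace ℝ (Fin K) × Block n =>
        (E.observe (E.root q p.1) p.2, E.root q p.1))
      (fun p : (EuclideanSpace ℝ (Fin K) × Block n) × EuclideanSpace ℝ (Fin K) =>
        (E.observe (E.root q p.1.1) p.1.2,
          E.gain (q + n) (E.observe (E.root q p.1.1) p.1.2) + E.root (q + n) p.2))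
      ((stdState K).prod (E.blockNoise n))
      (((stdState K).prod (E.blockNoise n)).prod (stdState K)) := by
  refine identDistrib_of_forall_blockDot (by fun_prop) (by fun_prop) fun u L => ?_
  obtain ⟨w, hw⟩ := exists_strongDual_eq_dotProduct L
  simp only [hw]
  refine (hasLaw_blockDot_observe hV q u w).identDistrib ?_
  convert hasLaw_gaussianReal_prod_add (obsVar_nonneg hV q _ 0)
    (dotProduct_postCov_mulVec_nonneg hV (q + n) w)
    (hasLaw_blockDot_observe hV q (u + E.gainCoeff (q + n) n w) 0)
    (hasLaw_dotProduct_root hV (q + n) w) using 2 with p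
  · rw [WithLp.ofLp_add, dotProduct_add, dotProduct_gain hV, blockDot_add_left, zero_dotProduct]
    ring
  · rw [obsVar_add_gainCoeff hV hσ]

end Laws

end InfoEnv

end SignalAcquisition

namespace SignalAcquisition

section GaussianReal

variable {α : Type*} [MeasurableSpace α]

lemma lintegral_gaussianReal (m : ℝ) (v : ℝ≥0) {f : ℝ → ℝ≥0∞} (hf : Measurable f) :
    ∫⁻ x, f x ∂(gaussianReal m v) = ∫⁻ a, f (m + a) ∂(gaussianReal 0 v) := by
  rw [← lintegral_map hf (measurable_const_add m), gaussianReal_map_const_add, zero_add]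

lemma lintegral_lintegral_gaussianReal (m : ℝ) (v w : ℝ≥0) {f : ℝ → ℝ≥0∞} (hf : Measurable f) :
    ∫⁻ x, ∫⁻ y, f y ∂(gaussianReal x w) ∂(gaussianReal m v) =
      ∫⁻ y, f y ∂(gaussianReal m (v + w)) := by
  simp_rw [fun x => lintegral_gaussianReal x w hf]
  rw [← Measure.lintegral_conv hf, gaussianReal_conv_gaussianReal, add_zero]

lemma measurable_lintegral_gaussianReal {m : α → ℝ} {v : α → ℝ≥0} (hm : Measurable m)
    (hv : Measurable v) {f : α × ℝ → ℝ≥0∞} (hf : Measurable f) :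
    Measurable fun a => ∫⁻ x, f (a, x) ∂(gaussianReal (m a) (v a)) := by
  have hscale (v : ℝ≥0) : (gaussianReal 0 1).map (√(v : ℝ) * ·) = gaussianReal 0 v := by
    simpa only [Real.toNNReal_coe] using (hasLaw_sqrt_mul v.coe_nonneg).map_eq
  have hstd (a : α) : ∫⁻ x, f (a, x) ∂(gaussianReal (m a) (v a)) =
      ∫⁻ g, f (a, m a + √(v a : ℝ) * g) ∂(gaussianReal 0 1) := by
    rw [lintegral_gaussianReal _ _ (by fun_prop), ← hscale,
      lintegral_map (by fun_prop) (by fun_prop)]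
  simp_rw [hstd]
  exact Measurable.lintegral_prod_right' (f := fun p : α × ℝ =>
    f (p.1, m p.1 + √(v p.1 : ℝ) * p.2)) (by fun_prop)

end GaussianReal

namespace InfoEnv

variable {K : ℕ} {E : InfoEnv K}

lemma lintegral_observe (hV : E.V₀.PosDef) (hσ : ∀ k, 0 < E.sigmaSq k) (q n : Fin K → ℕ)
    {g : Block n × EuclideanSpace ℝ (Fin K) → ℝ≥0∞} (hg : Measurable g) :
    ∫⁻ z, ∫⁻ e, g (E.observe (E.root q z) e, E.root q z) ∂(E.blockNoise n) ∂(stdState K) =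
      ∫⁻ z, ∫⁻ e, ∫⁻ z', g (E.observe (E.root q z) e,
          E.gain (q + n) (E.observe (E.root q z) e) + E.root (q + n) z')
        ∂(stdState K) ∂(E.blockNoise n) ∂(stdState K) := by
  have key := ((identDistrib_observe_root hV hσ q n).comp hg).lintegral_eq
  have hm : Measurable fun p : (EuclideanSpace ℝ (Fin K) × Block n) × EuclideanSpace ℝ (Fin K) =>
      g (E.observe (E.root q p.1.1) p.1.2,
        E.gain (q + n) (E.observe (E.root q p.1.1) p.1.2) + E.root (q + n) p.2) := by
    fun_prop
  simp only [Function.comp_def] at key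
  rwa [lintegral_prod _ (Measurable.aemeasurable (by fun_prop)), lintegral_prod _ hm.aemeasurable,
    lintegral_prod _ hm.lintegral_prod_right'.aemeasurable] at key

variable {n : Fin K → ℕ}

lemma obsVar_zero (q : Fin K → ℕ) : E.obsVar q (0 : Block n) 0 = 0 := by
  simp only [obsVar, loading, noiseVar, Pi.zero_apply, Finset.sum_const_zero, zero_pow two_ne_zero,
    zero_mul, add_zero]
  exact (congrArg (· ⬝ᵥ _) (Matrix.mulVec_zero _)).trans (zero_dotProduct _)

variable [NeZero K]

section PayoffRelevant

lemma postCov_mulVec_single (q : Fin K → ℕ) (r : ℝ) :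
    E.postCov q *ᵥ Pi.single 0 r = r • E.covRow q := by
  rw [covRow, ← Matrix.mulVec_smul, ← Pi.single_smul, smul_eq_mul, mul_one]

lemma single_dotProduct_postCov_mulVec (q : Fin K → ℕ) (r : ℝ) :
    (Pi.single 0 r : Fin K → ℝ) ⬝ᵥ (E.postCov q *ᵥ Pi.single 0 r) =
      r ^ 2 * E.posteriorVar q := by
  rw [postCov_mulVec_single, single_dotProduct, Pi.smul_apply, covRow_apply_zero, smul_eq_mul]
  ring

lemma obsVar_add_gainCoeff_single (hV : E.V₀.PosDef) (hσ : ∀ k, 0 < E.sigmaSq k) (q : Fin K → ℕ)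
    (u : Block n) (r : ℝ) :
    E.obsVar q (u + E.gainCoeff (q + n) n (Pi.single 0 r)) 0 =
      E.obsVar q u 0 + 2 * r * (E.loading u ⬝ᵥ E.covRow q) +
        r ^ 2 * (E.posteriorVar q - E.posteriorVar (q + n)) := by
  have h := obsVar_add_gainCoeff hV hσ q u (Pi.single 0 r)
  rw [obsVar_eq hV q u, single_dotProduct_postCov_mulVec, single_dotProduct_postCov_mulVec,
    postCov_mulVec_single, dotProduct_smul, smul_eq_mul] at h
  linarith

lemma hasLaw_root_zero (hV : E.V₀.PosDef) (q : Fin K → ℕ) :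
    HasLaw (fun z => E.root q z 0) (gaussianReal 0 (E.posteriorVar q).toNNReal) (stdState K) := by
  convert hasLaw_dotProduct_root hV q (Pi.single 0 1) using 2 with z
  · rw [single_dotProduct, one_mul]
  · rw [single_dotProduct_postCov_mulVec, one_pow, one_mul]

lemma hasLaw_blockDot_add_gain (hV : E.V₀.PosDef) (hσ : ∀ k, 0 < E.sigmaSq k) (q : Fin K → ℕ)
    (u : Block n) (r : ℝ) :
    HasLaw (fun p : EuclideanSpace ℝ (Fin K) × Block n =>
        blockDot u (E.observe (E.root q p.1) p.2) +
          r * E.gain (q + n) (E.observe (E.root q p.1) p.2) 0)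
      (gaussianReal 0 (E.obsVar q u 0 + 2 * r * (E.loading u ⬝ᵥ E.covRow q) +
        r ^ 2 * (E.posteriorVar q - E.posteriorVar (q + n))).toNNReal)
      ((stdState K).prod (E.blockNoise n)) := by
  rw [← obsVar_add_gainCoeff_single hV hσ]
  convert hasLaw_blockDot_observe hV q (u + E.gainCoeff (q + n) n (Pi.single 0 r)) 0 using 2
    with p
  rw [zero_dotProduct, add_zero, blockDot_add_left, ← dotProduct_gain hV, single_dotProduct]

lemma hasLaw_gain_zero (hV : E.V₀.PosDef) (hσ : ∀ k, 0 < E.sigmaSq k) (q n : Fin K → ℕ) :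
    HasLaw (fun p : EuclideanSpace ℝ (Fin K) × Block n =>
        E.gain (q + n) (E.observe (E.root q p.1) p.2) 0)
      (gaussianReal 0 (E.posteriorVar q - E.posteriorVar (q + n)).toNNReal)
      ((stdState K).prod (E.blockNoise n)) := by
  convert hasLaw_blockDot_add_gain hV hσ q (0 : Block n) 1 using 2 with p
  · simp only [blockDot, Pi.zero_apply, zero_mul, Finset.sum_const_zero, zero_add, one_mul]
  · rw [obsVar_zero, loading_dotProduct]
    simp only [Pi.zero_apply, Finset.sum_const_zero, zero_mul, mul_zero, zero_add, one_pow,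
      one_mul]

lemma obsVar_blurred_nonneg (hV : E.V₀.PosDef) (hσ : ∀ k, 0 < E.sigmaSq k) (q : Fin K → ℕ)
    {v : ℝ} (hv : v ≤ E.posteriorVar (q + n)) (u : Block n) (r : ℝ) :
    0 ≤ E.obsVar q u 0 + 2 * r * (E.loading u ⬝ᵥ E.covRow q) +
      r ^ 2 * (E.posteriorVar q - v) := by
  have hgain := obsVar_nonneg hV q (u + E.gainCoeff (q + n) n (Pi.single 0 r)) 0
  rw [obsVar_add_gainCoeff_single hV hσ] at hgain
  have hblur := mul_nonneg (sq_nonneg r) (sub_nonneg_of_le hv)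
  linarith

-- A blurred gain without variance has no covariance with the block either.
lemma loading_dotProduct_covRow_div_mul_cancel (hV : E.V₀.PosDef) (hσ : ∀ k, 0 < E.sigmaSq k)
    (q : Fin K → ℕ) {v : ℝ} (hv : v ≤ E.posteriorVar (q + n)) (u : Block n) :
    E.loading u ⬝ᵥ E.covRow q / (E.posteriorVar q - v) * (E.posteriorVar q - v) =
      E.loading u ⬝ᵥ E.covRow q := by
  refine div_mul_cancel_of_imp fun hd => ?_
  by_contra hne
  set γ := E.loading u ⬝ᵥ E.covRow q with hγ
  have hnonneg := obsVar_blurred_nonneg hV hσ q hv u (-(E.obsVar q u 0 + 1) / (2 * γ))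
  rw [hd, mul_zero, add_zero, ← hγ] at hnonneg
  have hneg : 2 * (-(E.obsVar q u 0 + 1) / (2 * γ)) * γ = -(E.obsVar q u 0 + 1) := by field_simp
  linarith

end PayoffRelevant

section Simulate

/-- The change of the posterior mean of the payoff-relevant state, blurred by independent noise so
that its variance becomes `posteriorVar q - v`. -/
noncomputable def blurredGain (E : InfoEnv K) (q n : Fin K → ℕ) (v : ℝ)
    (p : (EuclideanSpace ℝ (Fin K) × Block n) × ℝ) : ℝ :=
  E.gain (q + n) (E.observe (E.root q p.1.1) p.1.2) 0 + √(E.posteriorVar (q + n) - v) * p.2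

/-- A block of centered signals, simulated from the value `a` of a blurred change of the posterior
mean and independent noise `p`: a fresh block, corrected by the regression of blocks on blurred
changes. -/
noncomputable def simulate (E : InfoEnv K) (q n : Fin K → ℕ) (v a : ℝ)
    (p : (EuclideanSpace ℝ (Fin K) × Block n) × ℝ) : Block n :=
  fun k j => E.observe (E.root q p.1.1) p.1.2 k j +
    E.sourceCov q k / (E.posteriorVar q - v) * (a - E.blurredGain q n v p)

@[fun_prop]
lemma measurable_blurredGain (q n : Fin K → ℕ) (v : ℝ) : Measurable (E.blurredGain q n v) := by
  unfold blurredGain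
  fun_prop

@[fun_prop]
lemma measurable_simulate (q : Fin K → ℕ) (v : ℝ) {α : Type*} [MeasurableSpace α] {f : α → ℝ}
    {g : α → (EuclideanSpace ℝ (Fin K) × Block n) × ℝ} (hf : Measurable f) (hg : Measurable g) :
    Measurable fun a => E.simulate q n v (f a) (g a) := by
  refine measurable_pi_lambda _ fun k => measurable_pi_lambda _ fun j => ?_
  unfold simulate
  fun_prop

lemma hasLaw_blockDot_add_blurredGain (hV : E.V₀.PosDef) (hσ : ∀ k, 0 < E.sigmaSq k)
    (q : Fin K → ℕ) {v : ℝ} (hv : v ≤ E.posteriorVar (q + n)) (u : Block n) (r : ℝ) :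
    HasLaw (fun p : (EuclideanSpace ℝ (Fin K) × Block n) × ℝ =>
        blockDot u (E.observe (E.root q p.1.1) p.1.2) + r * E.blurredGain q n v p)
      (gaussianReal 0 (E.obsVar q u 0 + 2 * r * (E.loading u ⬝ᵥ E.covRow q) +
        r ^ 2 * (E.posteriorVar q - v)).toNNReal)
      (((stdState K).prod (E.blockNoise n)).prod (gaussianReal 0 1)) := by
  have hgain := obsVar_nonneg hV q (u + E.gainCoeff (q + n) n (Pi.single 0 r)) 0
  rw [obsVar_add_gainCoeff_single hV hσ] at hgain
  convert hasLaw_gaussianReal_prod_add hgain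
    (mul_nonneg (sq_nonneg r) (sub_nonneg_of_le hv)) (hasLaw_blockDot_add_gain hV hσ q u r)
    (hasLaw_gaussianReal_const_mul (hasLaw_sqrt_mul (sub_nonneg_of_le hv)) r) using 2 with p
  · rw [blurredGain]; ring
  · congr 1; ring

lemma blockDot_simulate (q : Fin K → ℕ) (v a : ℝ) (u : Block n)
    (p : (EuclideanSpace ℝ (Fin K) × Block n) × ℝ) :
    blockDot u (E.simulate q n v a p) = blockDot u (E.observe (E.root q p.1.1) p.1.2) +
      E.loading u ⬝ᵥ E.covRow q / (E.posteriorVar q - v) * (a - E.blurredGain q n v p) := by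
  have hγ : E.loading u ⬝ᵥ E.covRow q = ∑ k, (∑ j, u k j) * E.sourceCov q k :=
    loading_dotProduct u _
  simp only [blockDot, simulate, mul_add, Finset.sum_add_distrib, ← Finset.sum_mul, hγ,
    Finset.sum_div]
  rw [Finset.sum_mul]
  simp only [← mul_assoc, mul_div_assoc]

lemma identDistrib_simulate (hV : E.V₀.PosDef) (hσ : ∀ k, 0 < E.sigmaSq k) (q n : Fin K → ℕ)
    {v : ℝ} (hv : v ≤ E.posteriorVar (q + n)) :
    IdentDistrib
      (fun p : ℝ × ((EuclideanSpace ℝ (Fin K) × Block n) × ℝ) => (E.simulate q n v p.1 p.2, p.1))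
      (fun p : (EuclideanSpace ℝ (Fin K) × Block n) × ℝ =>
        (E.observe (E.root q p.1.1) p.1.2, E.blurredGain q n v p))
      ((gaussianReal 0 (E.posteriorVar q - v).toNNReal).prod
        (((stdState K).prod (E.blockNoise n)).prod (gaussianReal 0 1)))
      (((stdState K).prod (E.blockNoise n)).prod (gaussianReal 0 1)) := by
  refine identDistrib_of_forall_blockDot (by fun_prop) (by fun_prop) fun u L => ?_
  obtain ⟨r, hr⟩ : ∃ r : ℝ, ∀ x, L x = r * x := ⟨L 1, fun x => by
    simpa only [smul_eq_mul, mul_one] using (L.map_smul x 1).trans (mul_comm _ _)⟩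
  simp only [hr]
  set d := E.posteriorVar q - v
  set β := E.loading u ⬝ᵥ E.covRow q / d
  have hd : 0 ≤ d := sub_nonneg_of_le (hv.trans (posteriorVar_antitone hV le_self_add))
  have hcancel : β * d = E.loading u ⬝ᵥ E.covRow q :=
    loading_dotProduct_covRow_div_mul_cancel hV hσ q hv u
  have hvar : E.obsVar q u 0 + 2 * r * (E.loading u ⬝ᵥ E.covRow q) + r ^ 2 * d =
      (β + r) ^ 2 * d +
        (E.obsVar q u 0 + 2 * (-β) * (E.loading u ⬝ᵥ E.covRow q) + (-β) ^ 2 * d) := by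
    rw [← hcancel]
    ring
  have hresidual := obsVar_blurred_nonneg hV hσ q hv u (-β)
  refine HasLaw.identDistrib ?_ (hasLaw_blockDot_add_blurredGain hV hσ q hv u r)
  convert hasLaw_gaussianReal_prod_add (mul_nonneg (sq_nonneg (β + r)) hd) hresidual
    (hasLaw_gaussianReal_const_mul HasLaw.id (β + r))
    (hasLaw_blockDot_add_blurredGain hV hσ q hv u (-β)) using 2 with p
  · rw [blockDot_simulate, id]
    ring
  · rw [hvar]

end Simulate

section PayoffIntegrals

lemma lintegral_root_zero (hV : E.V₀.PosDef) (q : Fin K → ℕ) {f : ℝ → ℝ≥0∞} (hf : Measurable f)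
    (x : ℝ) :
    ∫⁻ z, f (x + E.root q z 0) ∂(stdState K) =
      ∫⁻ y, f y ∂(gaussianReal x (E.posteriorVar q).toNNReal) := by
  rw [lintegral_gaussianReal x _ hf]
  exact (hasLaw_root_zero hV q).lintegral_comp (f := fun a => f (x + a)) (by fun_prop)

lemma lintegral_gain_zero (hV : E.V₀.PosDef) (hσ : ∀ k, 0 < E.sigmaSq k) (q n : Fin K → ℕ)
    {f : ℝ → ℝ≥0∞} (hf : Measurable f) (x : ℝ) :
    ∫⁻ z, ∫⁻ e, f (x + E.gain (q + n) (E.observe (E.root q z) e) 0) ∂(E.blockNoise n)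
        ∂(stdState K) =
      ∫⁻ y, f y ∂(gaussianReal x (E.posteriorVar q - E.posteriorVar (q + n)).toNNReal) := by
  have hg := (hasLaw_gain_zero hV hσ q n).lintegral_comp (f := fun a => f (x + a)) (by fun_prop)
  rw [lintegral_prod _ (Measurable.aemeasurable (by fun_prop))] at hg
  rw [lintegral_gaussianReal x _ hf, ← hg]

lemma lintegral_simulate (hV : E.V₀.PosDef) (hσ : ∀ k, 0 < E.sigmaSq k) (q n : Fin K → ℕ) {v : ℝ}
    (hv : v ≤ E.posteriorVar (q + n)) {f : Block n × ℝ → ℝ≥0∞} (hf : Measurable f) :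
    ∫⁻ a, ∫⁻ p, f (E.simulate q n v a p, a)
        ∂(((stdState K).prod (E.blockNoise n)).prod (gaussianReal 0 1))
        ∂(gaussianReal 0 (E.posteriorVar q - v).toNNReal) =
      ∫⁻ z, ∫⁻ e, ∫⁻ x, f (E.observe (E.root q z) e, x)
        ∂(gaussianReal (E.gain (q + n) (E.observe (E.root q z) e) 0)
          (E.posteriorVar (q + n) - v).toNNReal)
        ∂(E.blockNoise n) ∂(stdState K) := by
  have key := ((identDistrib_simulate hV hσ q n hv).comp hf).lintegral_eq
  simp only [Function.comp_def] at key
  rw [lintegral_prod _ (Measurable.aemeasurable (by fun_prop))] at key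
  refine key.trans ?_
  have hm : Measurable fun p : (EuclideanSpace ℝ (Fin K) × Block n) × ℝ =>
      f (E.observe (E.root q p.1.1) p.1.2, E.blurredGain q n v p) := by
    fun_prop
  rw [lintegral_prod _ hm.aemeasurable, lintegral_prod _ hm.lintegral_prod_right'.aemeasurable]
  refine lintegral_congr fun z => lintegral_congr fun e => ?_
  have hfe : Measurable fun x => f (E.observe (E.root q z) e, x) := by fun_prop
  rw [lintegral_gaussianReal _ _ hfe,
    ← (hasLaw_sqrt_mul (sub_nonneg_of_le hv)).lintegral_comp (by fun_prop)]
  rfl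

end PayoffIntegrals

end InfoEnv

end SignalAcquisition

namespace SignalAcquisition

section Resampling

variable {ι X : Type*} [MeasurableSpace X] (μ : ι → Measure X) [∀ i, IsProbabilityMeasure (μ i)]

lemma measurable_piecewise_prod (S : Set ι) [DecidablePred (· ∈ S)] :
    Measurable fun p : (ι → X) × (ι → X) => S.piecewise p.1 p.2 := by
  refine measurable_pi_lambda _ fun i => ?_
  by_cases hi : i ∈ S
  · simp only [Set.piecewise_eq_of_mem _ _ _ hi]; fun_prop
  · simp only [Set.piecewise_eq_of_notMem _ _ _ hi]; fun_prop

lemma map_piecewise_infinitePi (S : Set ι) [DecidablePred (· ∈ S)] :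
    ((Measure.infinitePi μ).prod (Measure.infinitePi μ)).map (fun p => S.piecewise p.1 p.2) =
      Measure.infinitePi μ := by
  refine Measure.eq_infinitePi _ fun s t ht => ?_
  rw [Measure.map_apply (measurable_piecewise_prod S)
    (MeasurableSet.pi s.countable_toSet fun i _ => ht i)]
  have hpre : (fun p : (ι → X) × (ι → X) => S.piecewise p.1 p.2) ⁻¹' (Set.pi s t) =
      (Set.pi (s.filter (· ∈ S) : Finset ι) t) ×ˢ (Set.pi (s.filter (· ∉ S) : Finset ι) t) := by
    ext p
    simp only [Set.mem_preimage, Set.mem_pi, Set.mem_prod, Finset.coe_filter, Set.mem_ofPred_eq,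
      ← forall_and]
    refine forall_congr' fun i => ?_
    by_cases hi : i ∈ S <;> simp [hi]
  rw [hpre, Measure.prod_prod, Measure.infinitePi_pi _ fun i _ => ht i,
    Measure.infinitePi_pi _ fun i _ => ht i]
  exact Finset.prod_filter_mul_prod_filter_not s (· ∈ S) fun i => μ i (t i)

lemma lintegral_piecewise (S : Set ι) [DecidablePred (· ∈ S)] {f : (ι → X) → ℝ≥0∞}
    (hf : Measurable f) :
    ∫⁻ x, f x ∂(Measure.infinitePi μ) =
      ∫⁻ x, ∫⁻ y, f (S.piecewise y x) ∂(Measure.infinitePi μ) ∂(Measure.infinitePi μ) := by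
  have hm := measurable_piecewise_prod (X := X) S
  conv_lhs => rw [← map_piecewise_infinitePi μ S]
  rw [lintegral_map hf hm]
  exact lintegral_prod_symm (fun p : (ι → X) × (ι → X) => f (S.piecewise p.1 p.2))
    (hf.comp hm).aemeasurable

lemma lintegral_infinitePi_update [DecidableEq ι] (i : ι) {f : (ι → X) → ℝ≥0∞}
    (hf : Measurable f) :
    ∫⁻ x, f x ∂(Measure.infinitePi μ) =
      ∫⁻ x, ∫⁻ w, f (Function.update x i w) ∂(μ i) ∂(Measure.infinitePi μ) := by
  rw [lintegral_piecewise μ {i} hf]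
  refine lintegral_congr fun x => ?_
  have heval := measurePreserving_eval_infinitePi μ i
  have hm : Measurable fun w => f (Function.update x i w) := hf.comp (measurable_update x)
  rw [← heval.map_eq, lintegral_map hm heval.measurable]
  simp only [Set.piecewise_singleton, Function.eval]

end Resampling

lemma measurable_of_countable_index {ι α β : Type*} [MeasurableSpace ι] [Countable ι]
    [MeasurableSingletonClass ι] [MeasurableSpace α] [MeasurableSpace β] {c : α → ι}
    (hc : Measurable c) {G : ι → α → β} (hG : ∀ i, Measurable (G i)) :
    Measurable fun a => G (c a) a := by
  have h : Measurable fun p : α × ι => G p.2 p.1 := measurable_from_prod_countable_left hG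
  exact h.comp (measurable_id.prodMk hc)

variable {K : ℕ} {α : Type*} [MeasurableSpace α]

namespace Observation

lemma measurable_of_forall_mk {β : Type*} [MeasurableSpace β] {f : Observation K → β}
    (hf : ∀ n, Measurable fun y : Block n => f ⟨n, y⟩) : Measurable f := by
  intro s hs
  rw [MeasurableSpace.measurableSet_iInf]
  exact fun n => hf n hs

@[fun_prop]
lemma measurable_fst {o : α → Observation K} (ho : Measurable o) : Measurable fun a => (o a).1 :=
  (measurable_of_forall_mk (f := fun o : Observation K => o.1) fun _ => measurable_const).comp ho

lemma measurable_mk (n : Fin K → ℕ) :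
    Measurable fun y : Block n => (⟨n, y⟩ : Observation K) :=
  measurable_iff_comap_le.2 (by
    rintro _ ⟨s, hs, rfl⟩
    exact (MeasurableSpace.measurableSet_iInf.1 hs) n)

/-- The realizations in an observation as a block of prescribed size `n`, with `0` for the signals
that are missing. It makes all observations take values in the same space. -/
noncomputable def block (n : Fin K → ℕ) (o : Observation K) : Block n :=
  fun k j => if h : (j : ℕ) < o.1 k then o.2 k ⟨j, h⟩ else 0

lemma block_fst (o : Observation K) : o.block o.1 = o.2 := by
  ext k j
  exact dif_pos j.2

@[fun_prop]
lemma measurable_block (n : Fin K → ℕ) {o : α → Observation K} (ho : Measurable o) :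
    Measurable fun a => (o a).block n := by
  refine (measurable_of_forall_mk fun m => ?_ : Measurable (block n)).comp ho
  refine measurable_pi_lambda _ fun k => measurable_pi_lambda _ fun j => ?_
  by_cases h : (j : ℕ) < m k
  · simp only [block, dif_pos h]
    exact (measurable_pi_apply (⟨j, h⟩ : Fin (m k))).comp (measurable_pi_apply k)
  · simp only [block, dif_neg h]
    fun_prop

end Observation

namespace History

variable {t : ℕ}

/-- The history `h` followed by a period in which the multiset `n` of sources is sampled and the
signals `y` are realized. -/
def extend (h : History K t) (n : Fin K → ℕ) (y : Block n) : History K (t + 1) :=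
  Fin.snoc (α := fun _ => Observation K) h ⟨n, y⟩

/-- The history before the last period. -/
def init (h : History K (t + 1)) : History K t := Fin.init h

@[simp]
lemma init_extend (h : History K t) (n : Fin K → ℕ) (y : Block n) : (h.extend n y).init = h :=
  Fin.init_snoc _ _

@[simp]
lemma extend_last (h : History K t) (n : Fin K → ℕ) (y : Block n) :
    h.extend n y (Fin.last t) = ⟨n, y⟩ :=
  Fin.snoc_last _ _

lemma counts_zero (h : History K 0) : h.counts = 0 := by
  ext k
  simp [counts]

lemma counts_succ (h : History K (t + 1)) : h.counts = h.init.counts + (h (Fin.last t)).1 := by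
  ext k
  simp [counts, init, Fin.init, Fin.sum_univ_castSucc]

lemma counts_extend (h : History K t) (n : Fin K → ℕ) (y : Block n) :
    (h.extend n y).counts = h.counts + n := by
  rw [counts_succ, init_extend, extend_last]

@[fun_prop]
lemma measurable_extend {f : α → History K t} {n : Fin K → ℕ} {y : α → Block n}
    (hf : Measurable f) (hy : Measurable y) : Measurable fun a => (f a).extend n (y a) := by
  refine measurable_pi_lambda _ fun i => Fin.lastCases ?_ (fun i => ?_) i
  · simpa only [extend_last, Function.comp_def] using (Observation.measurable_mk n).comp hy
  · simpa only [extend, Fin.snoc_castSucc, Function.comp_def] using (measurable_pi_apply i).comp hf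

@[fun_prop]
lemma measurable_init {f : α → History K (t + 1)} (hf : Measurable f) :
    Measurable fun a => (f a).init :=
  measurable_pi_lambda _ fun i => (measurable_pi_apply i.castSucc).comp hf

@[fun_prop]
lemma measurable_counts {f : α → History K t} (hf : Measurable f) :
    Measurable fun a => (f a).counts := by
  unfold counts
  fun_prop

end History

namespace InfoEnv

variable {E : InfoEnv K} {t : ℕ}

lemma observe_add (m θ : EuclideanSpace ℝ (Fin K)) {n : Fin K → ℕ} (e : Block n) :
    E.observe (m + θ) e = E.observe m (E.observe θ e) := by
  ext k j
  simp only [observe, PiLp.add_apply, mul_add, Finset.sum_add_distrib, add_assoc]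

lemma observe_neg_observe (m : EuclideanSpace ℝ (Fin K)) {n : Fin K → ℕ} (y : Block n) :
    E.observe (-m) (E.observe m y) = y := by
  ext k j
  simp only [observe, PiLp.neg_apply, mul_neg, Finset.sum_neg_distrib, neg_add_cancel_left]

/-- The posterior mean of the states given a history. -/
noncomputable def postMean (E : InfoEnv K) (μ₀ : EuclideanSpace ℝ (Fin K)) :
    {t : ℕ} → History K t → EuclideanSpace ℝ (Fin K)
  | 0, _ => μ₀
  | t + 1, h => postMean E μ₀ h.init +
      E.gain h.counts (E.observe (-postMean E μ₀ h.init) (h (Fin.last t)).2)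

variable {μ₀ : EuclideanSpace ℝ (Fin K)}

lemma postMean_extend (h : History K t) (n : Fin K → ℕ) (y : Block n) :
    E.postMean μ₀ (h.extend n y) = E.postMean μ₀ h +
      E.gain (h.counts + n) (E.observe (-E.postMean μ₀ h) y) := by
  rw [postMean, History.init_extend, History.counts_extend, History.extend_last]

@[fun_prop]
lemma measurable_postMean {f : α → History K t} (hf : Measurable f) :
    Measurable fun a => E.postMean μ₀ (f a) := by
  refine Measurable.comp (g := fun h => E.postMean μ₀ h) ?_ hf
  clear hf f
  induction t with
  | zero => exact measurable_const
  | succ t ih =>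
    have hinit : Measurable fun h : History K (t + 1) => E.postMean μ₀ h.init :=
      ih.comp (by fun_prop)
    have h := measurable_of_countable_index
      (c := fun h : History K (t + 1) => (h.counts, (h (Fin.last t)).1)) (by fun_prop)
      (G := fun i h => E.postMean μ₀ h.init +
        E.gain i.1 (E.observe (-E.postMean μ₀ h.init) ((h (Fin.last t)).block i.2)))
      fun i => by fun_prop
    simp only [Observation.block_fst] at h
    exact h

/-- The law of the states given a history. -/
noncomputable def posteriorLaw (E : InfoEnv K) (μ₀ : EuclideanSpace ℝ (Fin K)) (h : History K t) :
    Measure (EuclideanSpace ℝ (Fin K)) :=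
  (stdState K).map fun z => E.postMean μ₀ h + E.root h.counts z

lemma lintegral_posteriorLaw (h : History K t) {f : EuclideanSpace ℝ (Fin K) → ℝ≥0∞}
    (hf : Measurable f) :
    ∫⁻ θ, f θ ∂(E.posteriorLaw μ₀ h) =
      ∫⁻ z, f (E.postMean μ₀ h + E.root h.counts z) ∂(stdState K) :=
  lintegral_map hf (by fun_prop)

lemma measurable_lintegral_posteriorLaw {f : History K t × EuclideanSpace ℝ (Fin K) → ℝ≥0∞}
    (hf : Measurable f) :
    Measurable fun h => ∫⁻ θ, f (h, θ) ∂(E.posteriorLaw μ₀ h) := by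
  simp_rw [fun h : History K t => lintegral_posteriorLaw (E := E) (μ₀ := μ₀) h
    (f := fun θ => f (h, θ)) (by fun_prop)]
  refine measurable_of_countable_index (c := fun h : History K t => h.counts) (by fun_prop)
    (G := fun q h => ∫⁻ z, f (h, E.postMean μ₀ h + E.root q z) ∂(stdState K)) fun q => ?_
  exact Measurable.lintegral_prod_right' (f := fun p : History K t × EuclideanSpace ℝ (Fin K) =>
    f (p.1, E.postMean μ₀ p.1 + E.root q p.2)) (by fun_prop)

lemma measurable_lintegral_blockNoise {c : α → Fin K → ℕ} (hc : Measurable c)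
    {f : (n : Fin K → ℕ) → α × Block n → ℝ≥0∞} (hf : ∀ n, Measurable (f n)) :
    Measurable fun a => ∫⁻ e, f (c a) (a, e) ∂(E.blockNoise (c a)) :=
  measurable_of_countable_index hc
    (G := fun n a => ∫⁻ e, f n (a, e) ∂(E.blockNoise n)) fun n => (hf n).lintegral_prod_right'

lemma postMean_extend_observe (h : History K t) (n : Fin K → ℕ) (y : Block n) :
    E.postMean μ₀ (h.extend n (E.observe (E.postMean μ₀ h) y)) =
      E.postMean μ₀ h + E.gain (h.counts + n) y := by
  rw [postMean_extend, observe_neg_observe]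

lemma lintegral_posteriorLaw_extend (hV : E.V₀.PosDef) (hσ : ∀ k, 0 < E.sigmaSq k)
    (h : History K t) (n : Fin K → ℕ)
    {f : History K (t + 1) × EuclideanSpace ℝ (Fin K) → ℝ≥0∞} (hf : Measurable f) :
    ∫⁻ θ, ∫⁻ e, f (h.extend n (E.observe θ e), θ) ∂(E.blockNoise n) ∂(E.posteriorLaw μ₀ h) =
      ∫⁻ θ, ∫⁻ e, ∫⁻ θ', f (h.extend n (E.observe θ e), θ')
          ∂(E.posteriorLaw μ₀ (h.extend n (E.observe θ e)))
        ∂(E.blockNoise n) ∂(E.posteriorLaw μ₀ h) := by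
  have hL : Measurable fun p : EuclideanSpace ℝ (Fin K) × Block n =>
      f (h.extend n (E.observe p.1 p.2), p.1) := by fun_prop
  have hR : Measurable fun p : EuclideanSpace ℝ (Fin K) × Block n =>
      ∫⁻ θ', f (h.extend n (E.observe p.1 p.2), θ')
        ∂(E.posteriorLaw μ₀ (h.extend n (E.observe p.1 p.2))) :=
    (measurable_lintegral_posteriorLaw hf).comp (by fun_prop)
  rw [lintegral_posteriorLaw h hL.lintegral_prod_right',
    lintegral_posteriorLaw h hR.lintegral_prod_right']
  simp only [observe_add]
  refine (lintegral_observe hV hσ h.counts n (g := fun p =>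
    f (h.extend n (E.observe (E.postMean μ₀ h) p.1), E.postMean μ₀ h + p.2)) (by fun_prop)).trans ?_
  refine lintegral_congr fun z => lintegral_congr fun e => ?_
  rw [lintegral_posteriorLaw _ (by fun_prop)]
  simp only [postMean_extend_observe, History.counts_extend, add_assoc]

section PayoffRelevant

variable [NeZero K]

lemma lintegral_posteriorLaw_zero (hV : E.V₀.PosDef) (h : History K t) {f : ℝ → ℝ≥0∞}
    (hf : Measurable f) :
    ∫⁻ θ, f (θ 0) ∂(E.posteriorLaw μ₀ h) =
      ∫⁻ x, f x ∂(gaussianReal (E.postMean μ₀ h 0) (E.posteriorVar h.counts).toNNReal) := by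
  rw [lintegral_posteriorLaw h (by fun_prop)]
  exact lintegral_root_zero hV h.counts hf _

lemma lintegral_postMean_extend_zero (hV : E.V₀.PosDef) (hσ : ∀ k, 0 < E.sigmaSq k)
    (h : History K t) (n : Fin K → ℕ) {f : ℝ → ℝ≥0∞} (hf : Measurable f) :
    ∫⁻ θ, ∫⁻ e, f (E.postMean μ₀ (h.extend n (E.observe θ e)) 0) ∂(E.blockNoise n)
        ∂(E.posteriorLaw μ₀ h) =
      ∫⁻ x, f x ∂(gaussianReal (E.postMean μ₀ h 0)
        (E.posteriorVar h.counts - E.posteriorVar (h.counts + n)).toNNReal) := by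
  have hm : Measurable fun p : EuclideanSpace ℝ (Fin K) × Block n =>
      f (E.postMean μ₀ (h.extend n (E.observe p.1 p.2)) 0) := by fun_prop
  rw [lintegral_posteriorLaw h hm.lintegral_prod_right']
  simp only [observe_add, postMean_extend_observe, PiLp.add_apply]
  exact lintegral_gain_zero hV hσ h.counts n hf _

end PayoffRelevant

/-- The law of all noise terms. -/
noncomputable abbrev noiseLaw (E : InfoEnv K) : Measure (ℕ × Fin K × ℕ → ℝ) :=
  Measure.infinitePi fun i : ℕ × Fin K × ℕ => gaussianReal 0 (E.sigmaSq i.2.1)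

end InfoEnv

/-- The noise terms of a block of signals in period `t`. -/
def blockAt (t : ℕ) (n : Fin K → ℕ) (y : ℕ × Fin K × ℕ → ℝ) : Block n :=
  fun k j => y (t, k, j)

@[fun_prop]
lemma measurable_blockAt (t : ℕ) (n : Fin K → ℕ) {f : α → ℕ × Fin K × ℕ → ℝ}
    (hf : Measurable f) : Measurable fun a => blockAt t n (f a) := by
  unfold blockAt
  fun_prop

lemma measurePreserving_blockAt (E : InfoEnv K) (t : ℕ) (n : Fin K → ℕ) :
    MeasurePreserving (blockAt t n) E.noiseLaw (E.blockNoise n) := by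
  refine ⟨by fun_prop, ?_⟩
  have hinj : Function.Injective
      fun a : (k : Fin K) × Fin (n k) => (t, a.1, (a.2 : ℕ)) := by
    rintro ⟨k, j⟩ ⟨k', j'⟩ h
    simp only [Prod.mk.injEq, true_and] at h
    obtain ⟨rfl, h⟩ := h
    rw [Fin.val_inj.1 h]
  have hcurry := Measure.infinitePi_map_piCurry (ι := Fin K) (κ := fun k => Fin (n k))
    (X := fun _ _ => ℝ) (fun k _ => gaussianReal 0 (E.sigmaSq k))
  rw [InfoEnv.blockNoise, ← Measure.infinitePi_eq_pi]
  simp only [← Measure.infinitePi_eq_pi]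
  rw [← hcurry, ← Measure.map_infinitePi_infinitePi_of_inj
    (P := fun i : ℕ × Fin K × ℕ => gaussianReal 0 (E.sigmaSq i.2.1)) hinj,
    Measure.map_map (by fun_prop) (by fun_prop)]
  rfl

instance (E : InfoEnv K) (μ₀ : EuclideanSpace ℝ (Fin K)) : IsProbabilityMeasure (law E μ₀) := by
  unfold law; infer_instance

namespace Strategy

variable {A : ℕ → Type u} [∀ t, MeasurableSpace (A t)]

@[fun_prop]
lemma measurable_acquire_comp (s : Strategy K A) {t : ℕ} {f : α → History K t}
    (hf : Measurable f) : Measurable fun a => s.acquire t (f a) :=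
  (s.measurable_acquire t).comp hf

lemma history_succ (s : Strategy K A) (E : InfoEnv K) (ω : Outcome K) (t : ℕ) :
    s.history E ω (t + 1) = (s.history E ω t).extend (s.acquire t (s.history E ω t))
      (E.observe ω.1 (blockAt t (s.acquire t (s.history E ω t)) ω.2)) := rfl

lemma init_history_succ (s : Strategy K A) (E : InfoEnv K) (ω : Outcome K) (t : ℕ) :
    (s.history E ω (t + 1)).init = s.history E ω t := by
  rw [history_succ, History.init_extend]

lemma history_congr_noise (s : Strategy K A) (E : InfoEnv K) (θ : EuclideanSpace ℝ (Fin K))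
    {x y : ℕ × Fin K × ℕ → ℝ} {t : ℕ} (h : ∀ i < t, ∀ n, blockAt i n x = blockAt i n y) :
    s.history E (θ, x) t = s.history E (θ, y) t := by
  induction t with
  | zero => rfl
  | succ t ih =>
    rw [history_succ, history_succ, ih fun i hi => h i (hi.trans t.lt_succ_self)]
    simp only [h t t.lt_succ_self]

lemma measurable_history_family {X : Type*} [MeasurableSpace X] {S : X → Strategy K A}
    (hS : ∀ t, Measurable fun p : X × History K t => (S p.1).acquire t p.2) (E : InfoEnv K)
    (t : ℕ) : Measurable fun p : X × Outcome K => (S p.1).history E p.2 t := by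
  induction t with
  | zero => exact measurable_const
  | succ t ih =>
    exact measurable_of_countable_index ((hS t).comp (measurable_fst.prodMk ih))
      (G := fun n p => ((S p.1).history E p.2 t).extend n
        (E.observe p.2.1 (blockAt t n p.2.2))) fun n => by fun_prop

@[fun_prop]
lemma measurable_history (s : Strategy K A) (E : InfoEnv K) (t : ℕ) {f : α → Outcome K}
    (hf : Measurable f) : Measurable fun a => s.history E (f a) t :=
  (measurable_history_family (S := fun _ : Unit => s) (fun t => by fun_prop) E t).comp
    (f := fun a => ((), f a)) (by fun_prop)

/-- The noise of the last period is independent of everything before. -/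
lemma lintegral_history_succ (s : Strategy K A) (E : InfoEnv K) (μ₀ : EuclideanSpace ℝ (Fin K))
    (t : ℕ) {f : History K (t + 1) × EuclideanSpace ℝ (Fin K) → ℝ≥0∞} (hf : Measurable f) :
    ∫⁻ ω, f (s.history E ω (t + 1), ω.1) ∂(law E μ₀) =
      ∫⁻ ω, ∫⁻ e, f ((s.history E ω t).extend (s.acquire t (s.history E ω t)) (E.observe ω.1 e),
        ω.1) ∂(E.blockNoise (s.acquire t (s.history E ω t))) ∂(law E μ₀) := by
  have hR := InfoEnv.measurable_lintegral_blockNoise (E := E)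
    (c := fun ω => s.acquire t (s.history E ω t)) (by fun_prop)
    (f := fun n p => f ((s.history E p.1 t).extend n (E.observe p.1.1 p.2), p.1.1))
    fun n => by fun_prop
  rw [law, lintegral_prod _ (Measurable.aemeasurable (by fun_prop)),
    lintegral_prod _ hR.aemeasurable]
  refine lintegral_congr fun θ => ?_
  refine (lintegral_piecewise _ {i : ℕ × Fin K × ℕ | i.1 = t}
    (f := fun x => f (s.history E (θ, x) (t + 1), θ)) (by fun_prop)).trans ?_
  refine lintegral_congr fun x => ?_
  rw [← (measurePreserving_blockAt E t _).lintegral_comp (by fun_prop)]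
  refine lintegral_congr fun y => ?_
  have hpast (i : ℕ) (hi : i < t) (n : Fin K → ℕ) :
      blockAt i n ({i : ℕ × Fin K × ℕ | i.1 = t}.piecewise y x) = blockAt i n x := by
    ext k j
    exact Set.piecewise_eq_of_notMem _ _ _ hi.ne
  have hpresent (n : Fin K → ℕ) :
      blockAt t n ({i : ℕ × Fin K × ℕ | i.1 = t}.piecewise y x) = blockAt t n y := by
    ext k j
    exact Set.piecewise_eq_of_mem _ _ _ rfl
  rw [history_succ, history_congr_noise s E θ hpast, hpresent]

variable {E : InfoEnv K}

lemma lintegral_history_zero (s : Strategy K A) (hV : E.V₀.PosDef)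
    (μ₀ : EuclideanSpace ℝ (Fin K)) {f : History K 0 × EuclideanSpace ℝ (Fin K) → ℝ≥0∞}
    (hf : Measurable f) :
    ∫⁻ ω, f (s.history E ω 0, ω.1) ∂(law E μ₀) =
      ∫⁻ ω, ∫⁻ θ, f (s.history E ω 0, θ) ∂(E.posteriorLaw μ₀ (s.history E ω 0)) ∂(law E μ₀) := by
  have hprior (h : History K 0) : E.posteriorLaw μ₀ h = multivariateGaussian μ₀ E.V₀ := by
    rw [InfoEnv.posteriorLaw, multivariateGaussian, History.counts_zero, InfoEnv.root,
      InfoEnv.postCov_zero hV]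
    rfl
  have : Measurable fun θ : EuclideanSpace ℝ (Fin K) => f (Fin.elim0, θ) := by fun_prop
  simp only [history, hprior, lintegral_const, measure_univ, mul_one]
  rw [law, lintegral_prod _ (Measurable.aemeasurable (by fun_prop))]
  simp only [lintegral_const, measure_univ, mul_one]

lemma lintegral_history (s : Strategy K A) (hV : E.V₀.PosDef) (hσ : ∀ k, 0 < E.sigmaSq k)
    (μ₀ : EuclideanSpace ℝ (Fin K)) (t : ℕ)
    {f : History K t × EuclideanSpace ℝ (Fin K) → ℝ≥0∞} (hf : Measurable f) :
    ∫⁻ ω, f (s.history E ω t, ω.1) ∂(law E μ₀) =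
      ∫⁻ ω, ∫⁻ θ, f (s.history E ω t, θ) ∂(E.posteriorLaw μ₀ (s.history E ω t)) ∂(law E μ₀) := by
  induction t with
  | zero => exact s.lintegral_history_zero hV μ₀ hf
  | succ t ih =>
    have hblock {g : History K (t + 1) × EuclideanSpace ℝ (Fin K) → ℝ≥0∞} (hg : Measurable g) :
        ∫⁻ ω, g (s.history E ω (t + 1), ω.1) ∂(law E μ₀) =
          ∫⁻ ω, ∫⁻ θ, ∫⁻ e, g ((s.history E ω t).extend (s.acquire t (s.history E ω t))
              (E.observe θ e), θ) ∂(E.blockNoise (s.acquire t (s.history E ω t)))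
            ∂(E.posteriorLaw μ₀ (s.history E ω t)) ∂(law E μ₀) := by
      rw [s.lintegral_history_succ E μ₀ t hg]
      exact ih (f := fun p => ∫⁻ e, g (p.1.extend (s.acquire t p.1) (E.observe p.2 e), p.2)
        ∂(E.blockNoise (s.acquire t p.1))) (InfoEnv.measurable_lintegral_blockNoise
          (c := fun p : History K t × EuclideanSpace ℝ (Fin K) => s.acquire t p.1) (by fun_prop)
          (f := fun n a => g (a.1.1.extend n (E.observe a.1.2 a.2), a.1.2)) fun n => by fun_prop)
    rw [hblock hf, hblock (g := fun p => ∫⁻ θ, f (p.1, θ) ∂(E.posteriorLaw μ₀ p.1))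
      ((InfoEnv.measurable_lintegral_posteriorLaw hf).comp measurable_fst)]
    exact lintegral_congr fun ω => InfoEnv.lintegral_posteriorLaw_extend hV hσ _ _ hf

lemma lintegral_history_block (s : Strategy K A) (hV : E.V₀.PosDef) (hσ : ∀ k, 0 < E.sigmaSq k)
    (μ₀ : EuclideanSpace ℝ (Fin K)) (t : ℕ) {f : History K (t + 1) → ℝ≥0∞} (hf : Measurable f) :
    ∫⁻ ω, f (s.history E ω (t + 1)) ∂(law E μ₀) =
      ∫⁻ ω, ∫⁻ θ, ∫⁻ e, f ((s.history E ω t).extend (s.acquire t (s.history E ω t))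
          (E.observe θ e)) ∂(E.blockNoise (s.acquire t (s.history E ω t)))
        ∂(E.posteriorLaw μ₀ (s.history E ω t)) ∂(law E μ₀) := by
  rw [s.lintegral_history_succ E μ₀ t (f := fun p => f p.1) (by fun_prop)]
  exact s.lintegral_history hV hσ μ₀ t (f := fun p => ∫⁻ e,
    f (p.1.extend (s.acquire t p.1) (E.observe p.2 e)) ∂(E.blockNoise (s.acquire t p.1)))
    (InfoEnv.measurable_lintegral_blockNoise
      (c := fun p : History K t × EuclideanSpace ℝ (Fin K) => s.acquire t p.1) (by fun_prop)
      (f := fun n a => f (a.1.1.extend n (E.observe a.1.2 a.2))) fun n => by fun_prop)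

end Strategy

end SignalAcquisition

namespace SignalAcquisition

variable {K : ℕ} {α : Type*} [MeasurableSpace α]

/-- The random numbers used in one period of a simulation: a state vector, noise terms and a
standard normal variable. -/
abbrev Tape (K : ℕ) : Type := (EuclideanSpace ℝ (Fin K) × (ℕ × Fin K × ℕ → ℝ)) × ℝ

/-- The law of the random numbers used in one period of a simulation. -/
noncomputable abbrev InfoEnv.tapeLaw (E : InfoEnv K) : Measure (Tape K) :=
  ((InfoEnv.stdState K).prod E.noiseLaw).prod (gaussianReal 0 1)

/-- The law of all random numbers used in a simulation. -/
noncomputable abbrev InfoEnv.tapesLaw (E : InfoEnv K) : Measure (ℕ → Tape K) :=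
  Measure.infinitePi fun _ => E.tapeLaw

namespace Tape

/-- The random numbers needed to simulate a block of signals. -/
def block (n : Fin K → ℕ) (w : Tape K) : (EuclideanSpace ℝ (Fin K) × Block n) × ℝ :=
  ((w.1.1, blockAt 0 n w.1.2), w.2)

@[fun_prop]
lemma measurable_block (n : Fin K → ℕ) {w : α → Tape K} (hw : Measurable w) :
    Measurable fun a => (w a).block n := by
  unfold block
  fun_prop

lemma measurePreserving_block (E : InfoEnv K) (n : Fin K → ℕ) :
    MeasurePreserving (block n) E.tapeLaw
      (((InfoEnv.stdState K).prod (E.blockNoise n)).prod (gaussianReal 0 1)) :=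
  ((MeasurePreserving.id _).prod (measurePreserving_blockAt E 0 n)).prod (MeasurePreserving.id _)

end Tape

/-- How a simulation samples: the block that it samples next, as a function of its own counts, of
the counts of the simulated strategy and of the block that the simulated strategy samples next. -/
abbrev SamplingRule (K : ℕ) : Type :=
  (Fin K → ℕ) → (Fin K → ℕ) → (Fin K → ℕ) → (Fin K → ℕ)

namespace SamplingRule

variable {t : ℕ}

/-- The counts of a simulation that follows `φ`, given the simulated history. -/
def plan (φ : SamplingRule K) : {t : ℕ} → History K t → (Fin K → ℕ)
  | 0, _ => 0
  | t + 1, h => plan φ h.init + φ (plan φ h.init) h.init.counts (h (Fin.last t)).1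

/-- The counts of a simulation that follows `φ`, given that the simulated strategy samples `n` after
the simulated history `h`. -/
def nextPlan (φ : SamplingRule K) (h : History K t) (n : Fin K → ℕ) : Fin K → ℕ :=
  φ.plan h + φ (φ.plan h) h.counts n

lemma plan_extend (φ : SamplingRule K) (h : History K t) (n : Fin K → ℕ) (y : Block n) :
    φ.plan (h.extend n y) = φ.nextPlan h n := by
  rw [plan, History.init_extend, History.extend_last, nextPlan]

lemma measurable_comp (φ : SamplingRule K) {c q n : α → Fin K → ℕ} (hc : Measurable c)
    (hq : Measurable q) (hn : Measurable n) : Measurable fun a => φ (c a) (q a) (n a) :=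
  (Measurable.of_discrete (f := fun p : (Fin K → ℕ) × (Fin K → ℕ) × (Fin K → ℕ) =>
    φ p.1 p.2.1 p.2.2)).comp (hc.prodMk (hq.prodMk hn))

@[fun_prop]
lemma measurable_plan (φ : SamplingRule K) {f : α → History K t} (hf : Measurable f) :
    Measurable fun a => φ.plan (f a) := by
  refine Measurable.comp (g := fun h => φ.plan h) ?_ hf
  clear hf f
  induction t with
  | zero => exact measurable_const
  | succ t ih =>
    have hinit : Measurable fun h : History K (t + 1) => φ.plan h.init := ih.comp (by fun_prop)
    exact hinit.add (φ.measurable_comp hinit (by fun_prop) (by fun_prop))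

@[fun_prop]
lemma measurable_nextPlan (φ : SamplingRule K) {f : α → History K t} {n : α → Fin K → ℕ}
    (hf : Measurable f) (hn : Measurable n) : Measurable fun a => φ.nextPlan (f a) (n a) :=
  (φ.measurable_plan hf).add (φ.measurable_comp (by fun_prop) (by fun_prop) hn)

/-- A simulation that follows `φ` always knows the payoff-relevant state at least as precisely as
the strategy that it simulates. -/
def IsMoreInformative [NeZero K] (φ : SamplingRule K) (E : InfoEnv K) : Prop :=
  ∀ {t : ℕ} (h : History K t), E.posteriorVar (φ.plan h) ≤ E.posteriorVar h.counts

lemma IsMoreInformative.posteriorVar_nextPlan_le [NeZero K] {φ : SamplingRule K} {E : InfoEnv K}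
    (hφ : φ.IsMoreInformative E) (h : History K t) (n : Fin K → ℕ) :
    E.posteriorVar (φ.nextPlan h n) ≤ E.posteriorVar (h.counts + n) := by
  rw [← φ.plan_extend h n 0, ← h.counts_extend n 0]
  exact hφ _

end SamplingRule

namespace Strategy

variable [NeZero K] {A : ℕ → Type u} [∀ t, MeasurableSpace (A t)] {t : ℕ}

section Definitions

variable (s : Strategy K A) (E : InfoEnv K) (φ : SamplingRule K) (μ₀ : EuclideanSpace ℝ (Fin K))

/-- The simulated history after one more period, where `h` is the simulated history before, and `x`
and `c` are the actual posterior mean of the payoff-relevant state and the actual counts after the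
period. -/
noncomputable def simStep (w : Tape K) (h : History K t) (x : ℝ) (c : Fin K → ℕ) :
    History K (t + 1) :=
  h.extend (s.acquire t h) (E.observe (E.postMean μ₀ h)
    (E.simulate h.counts (s.acquire t h) (E.posteriorVar c) (x - E.postMean μ₀ h 0)
      (w.block (s.acquire t h))))

/-- The simulated history, as a function of the actual history. -/
noncomputable def simHist (ξ : ℕ → Tape K) : {t : ℕ} → History K t → History K t
  | 0, _ => Fin.elim0
  | t + 1, h => s.simStep E μ₀ (ξ t) (simHist ξ h.init) (E.postMean μ₀ h 0) h.counts

/-- The block sampled by a simulation of `s` that follows `φ`. -/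
noncomputable def simAcquire (ξ : ℕ → Tape K) (h : History K t) : Fin K → ℕ :=
  φ h.counts (s.simHist E μ₀ ξ h).counts (s.acquire t (s.simHist E μ₀ ξ h))

end Definitions

variable {s : Strategy K A} {E : InfoEnv K} {φ : SamplingRule K} {μ₀ : EuclideanSpace ℝ (Fin K)}

@[fun_prop]
lemma measurable_simStep {w : α → Tape K} {h : α → History K t} {x : α → ℝ} {c : α → Fin K → ℕ}
    (hw : Measurable w) (hh : Measurable h) (hx : Measurable x) (hc : Measurable c) :
    Measurable fun a => s.simStep E μ₀ (w a) (h a) (x a) (c a) :=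
  measurable_of_countable_index (c := fun a => (c a, (h a).counts, s.acquire t (h a)))
    (by fun_prop)
    (G := fun i a => (h a).extend i.2.2 (E.observe (E.postMean μ₀ (h a))
      (E.simulate i.2.1 i.2.2 (E.posteriorVar i.1) (x a - E.postMean μ₀ (h a) 0)
        ((w a).block i.2.2)))) fun i => by fun_prop

@[fun_prop]
lemma measurable_simHist {ξ : α → ℕ → Tape K} {h : α → History K t} (hξ : Measurable ξ)
    (hh : Measurable h) : Measurable fun a => s.simHist E μ₀ (ξ a) (h a) := by
  induction t with
  | zero => exact measurable_const
  | succ t ih =>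
    exact measurable_simStep (by fun_prop) (ih (by fun_prop)) (by fun_prop) (by fun_prop)

@[fun_prop]
lemma measurable_simAcquire {ξ : α → ℕ → Tape K} {h : α → History K t} (hξ : Measurable ξ)
    (hh : Measurable h) : Measurable fun a => s.simAcquire E φ μ₀ (ξ a) (h a) :=
  φ.measurable_comp (by fun_prop) (by fun_prop) (by fun_prop)

variable (s E φ μ₀)

/-- The strategy that simulates `s` with the random numbers `ξ`, samples according to `φ`, and acts
as `s` would at the simulated history. -/
noncomputable def simulation (ξ : ℕ → Tape K) : Strategy K A where
  acquire _ h := s.simAcquire E φ μ₀ ξ h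
  measurable_acquire _ := by fun_prop
  act t h := s.act t (s.simHist E μ₀ ξ h)
  measurable_act t := (s.measurable_act t).comp (by fun_prop)

/-- The simulated history, as a function of the outcome. -/
noncomputable def simulatedHistory (ξ : ℕ → Tape K) (ω : Outcome K) (t : ℕ) : History K t :=
  s.simHist E μ₀ ξ ((s.simulation E φ μ₀ ξ).history E ω t)

/-- The posterior mean of the payoff-relevant state in a simulation. -/
noncomputable def simMean (ξ : ℕ → Tape K) (ω : Outcome K) (t : ℕ) : ℝ :=
  E.postMean μ₀ ((s.simulation E φ μ₀ ξ).history E ω t) 0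

variable {s E φ μ₀}

lemma acquire_simulation (ξ : ℕ → Tape K) (h : History K t) :
    (s.simulation E φ μ₀ ξ).acquire t h = s.simAcquire E φ μ₀ ξ h := rfl

lemma acquire_history_simulation (ξ : ℕ → Tape K) (ω : Outcome K) (t : ℕ) :
    (s.simulation E φ μ₀ ξ).acquire t ((s.simulation E φ μ₀ ξ).history E ω t) =
      φ ((s.simulation E φ μ₀ ξ).history E ω t).counts (s.simulatedHistory E φ μ₀ ξ ω t).counts
        (s.acquire t (s.simulatedHistory E φ μ₀ ξ ω t)) := rfl

lemma counts_history_simulation (ξ : ℕ → Tape K) (ω : Outcome K) (t : ℕ) :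
    ((s.simulation E φ μ₀ ξ).history E ω t).counts =
      φ.plan (s.simulatedHistory E φ μ₀ ξ ω t) := by
  induction t with
  | zero => exact History.counts_zero _
  | succ t ih =>
    rw [history_succ, History.counts_extend, simulatedHistory, simHist, simStep,
      SamplingRule.plan_extend, init_history_succ, ← simulatedHistory, SamplingRule.nextPlan, ← ih,
      acquire_history_simulation]

lemma counts_history_simulation_succ (ξ : ℕ → Tape K) (ω : Outcome K) (t : ℕ) :
    ((s.simulation E φ μ₀ ξ).history E ω (t + 1)).counts =
      φ.nextPlan (s.simulatedHistory E φ μ₀ ξ ω t)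
        (s.acquire t (s.simulatedHistory E φ μ₀ ξ ω t)) := by
  rw [history_succ, History.counts_extend, acquire_history_simulation, counts_history_simulation,
    SamplingRule.nextPlan]

lemma simulatedHistory_succ (ξ : ℕ → Tape K) (ω : Outcome K) (t : ℕ) :
    s.simulatedHistory E φ μ₀ ξ ω (t + 1) =
      s.simStep E μ₀ (ξ t) (s.simulatedHistory E φ μ₀ ξ ω t) (s.simMean E φ μ₀ ξ ω (t + 1))
        (φ.nextPlan (s.simulatedHistory E φ μ₀ ξ ω t)
          (s.acquire t (s.simulatedHistory E φ μ₀ ξ ω t))) := by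
  rw [← counts_history_simulation_succ, simulatedHistory, simHist, init_history_succ, simMean,
    simulatedHistory]

@[fun_prop]
lemma measurable_history_simulation {ξ : α → ℕ → Tape K} {ω : α → Outcome K} (hξ : Measurable ξ)
    (hω : Measurable ω) : Measurable fun a => (s.simulation E φ μ₀ (ξ a)).history E (ω a) t :=
  (measurable_history_family (S := fun ξ => s.simulation E φ μ₀ ξ)
    (fun _ => measurable_simAcquire measurable_fst measurable_snd) E t).comp (hξ.prodMk hω)

@[fun_prop]
lemma measurable_simulatedHistory {ξ : α → ℕ → Tape K} {ω : α → Outcome K} (hξ : Measurable ξ)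
    (hω : Measurable ω) : Measurable fun a => s.simulatedHistory E φ μ₀ (ξ a) (ω a) t := by
  unfold simulatedHistory
  fun_prop

@[fun_prop]
lemma measurable_simMean {ξ : α → ℕ → Tape K} {ω : α → Outcome K} (hξ : Measurable ξ)
    (hω : Measurable ω) : Measurable fun a => s.simMean E φ μ₀ (ξ a) (ω a) t := by
  unfold simMean
  fun_prop

lemma simHist_congr {ξ η : ℕ → Tape K} (hξ : ∀ i < t, ξ i = η i) (h : History K t) :
    s.simHist E μ₀ ξ h = s.simHist E μ₀ η h := by
  induction t with
  | zero => rfl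
  | succ t ih =>
    rw [simHist, simHist, ih fun i hi => hξ i (hi.trans t.lt_succ_self), hξ t t.lt_succ_self]

lemma history_simulation_congr {ξ η : ℕ → Tape K} (hξ : ∀ i, i + 1 < t → ξ i = η i)
    (ω : Outcome K) :
    (s.simulation E φ μ₀ ξ).history E ω t = (s.simulation E φ μ₀ η).history E ω t := by
  induction t with
  | zero => exact Subsingleton.elim _ _
  | succ t ih =>
    rw [history_succ, history_succ, ih fun i hi => hξ i (hi.trans t.lt_succ_self),
      acquire_simulation, acquire_simulation, simAcquire, simAcquire,
      simHist_congr fun i hi => hξ i (Nat.succ_lt_succ hi)]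

lemma simMean_congr {ξ η : ℕ → Tape K} (hξ : ∀ i, i + 1 < t → ξ i = η i) (ω : Outcome K) :
    s.simMean E φ μ₀ ξ ω t = s.simMean E φ μ₀ η ω t := by
  rw [simMean, history_simulation_congr hξ, simMean]

lemma simulatedHistory_congr {ξ η : ℕ → Tape K} (hξ : ∀ i < t, ξ i = η i) (ω : Outcome K) :
    s.simulatedHistory E φ μ₀ ξ ω t = s.simulatedHistory E φ μ₀ η ω t := by
  rw [simulatedHistory, history_simulation_congr fun i hi => hξ i (Nat.lt_of_succ_lt hi),
    simHist_congr hξ, simulatedHistory]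

end Strategy

end SignalAcquisition

namespace SignalAcquisition

lemma toNNReal_sub_add_toNNReal_sub {a b c : ℝ} (hab : b ≤ a) (hbc : c ≤ b) :
    (a - b).toNNReal + (b - c).toNNReal = (a - c).toNNReal := by
  rw [← Real.toNNReal_add (sub_nonneg.2 hab) (sub_nonneg.2 hbc), sub_add_sub_cancel]

variable {K : ℕ} [NeZero K] {A : ℕ → Type u} [∀ t, MeasurableSpace (A t)] {t : ℕ}

@[fun_prop]
lemma InfoEnv.measurable_posteriorVar (E : InfoEnv K) {α : Type*} [MeasurableSpace α]
    {c : α → Fin K → ℕ} (hc : Measurable c) : Measurable fun a => E.posteriorVar (c a) :=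
  (Measurable.of_discrete (f := E.posteriorVar)).comp hc

namespace Strategy

variable {s : Strategy K A} {E : InfoEnv K} {φ : SamplingRule K} {μ₀ : EuclideanSpace ℝ (Fin K)}

lemma lintegral_postMean_succ (s : Strategy K A) (hV : E.V₀.PosDef) (hσ : ∀ k, 0 < E.sigmaSq k)
    (μ₀ : EuclideanSpace ℝ (Fin K)) (t : ℕ) {f : History K t × ℝ → ℝ≥0∞} (hf : Measurable f) :
    ∫⁻ ω, f (s.history E ω t, E.postMean μ₀ (s.history E ω (t + 1)) 0) ∂(law E μ₀) =
      ∫⁻ ω, ∫⁻ x, f (s.history E ω t, x)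
        ∂(gaussianReal (E.postMean μ₀ (s.history E ω t) 0)
          (E.posteriorVar (s.history E ω t).counts - E.posteriorVar ((s.history E ω t).counts +
            s.acquire t (s.history E ω t))).toNNReal) ∂(law E μ₀) := by
  have hblock := s.lintegral_history_block hV hσ μ₀ t
    (f := fun h => f (h.init, E.postMean μ₀ h 0)) (by fun_prop)
  simp only [init_history_succ, History.init_extend] at hblock
  rw [hblock]
  exact lintegral_congr fun ω => InfoEnv.lintegral_postMean_extend_zero hV hσ _ _
    (f := fun x => f (s.history E ω t, x)) (by fun_prop)

@[fun_prop]
lemma measurable_lintegral_simStep {α : Type*} [MeasurableSpace α]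
    {f : History K (t + 1) × ℝ → ℝ≥0∞} (hf : Measurable f) {h : α → History K t} {x : α → ℝ}
    {c : α → Fin K → ℕ} (hh : Measurable h) (hx : Measurable x) (hc : Measurable c) :
    Measurable fun a => ∫⁻ w, f (s.simStep E μ₀ w (h a) (x a) (c a), x a) ∂E.tapeLaw :=
  Measurable.lintegral_prod_right' (f := fun p : α × Tape K =>
    f (s.simStep E μ₀ p.2 (h p.1) (x p.1) (c p.1), x p.1)) (by fun_prop)

lemma lintegral_simStep (hV : E.V₀.PosDef) (hσ : ∀ k, 0 < E.sigmaSq k) (h : History K t)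
    {c : Fin K → ℕ} (hc : E.posteriorVar c ≤ E.posteriorVar (h.counts + s.acquire t h))
    {f : History K (t + 1) × ℝ → ℝ≥0∞} (hf : Measurable f) :
    ∫⁻ x, ∫⁻ w, f (s.simStep E μ₀ w h x c, x) ∂E.tapeLaw
        ∂(gaussianReal (E.postMean μ₀ h 0) (E.posteriorVar h.counts - E.posteriorVar c).toNNReal) =
      ∫⁻ θ, ∫⁻ e, ∫⁻ x, f (h.extend (s.acquire t h) (E.observe θ e), x)
          ∂(gaussianReal (E.postMean μ₀ (h.extend (s.acquire t h) (E.observe θ e)) 0)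
            (E.posteriorVar (h.counts + s.acquire t h) - E.posteriorVar c).toNNReal)
        ∂(E.blockNoise (s.acquire t h)) ∂(E.posteriorLaw μ₀ h) := by
  set m := E.postMean μ₀ h
  set n := s.acquire t h
  have hF : Measurable fun p : Block n × ℝ => f (h.extend n (E.observe m p.1), m 0 + p.2) := by
    fun_prop
  have hsim := InfoEnv.lintegral_simulate hV hσ h.counts n hc hF
  have hR : Measurable fun p : EuclideanSpace ℝ (Fin K) × Block n =>
      ∫⁻ x, f (h.extend n (E.observe p.1 p.2), x)
        ∂(gaussianReal (E.postMean μ₀ (h.extend n (E.observe p.1 p.2)) 0)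
          (E.posteriorVar (h.counts + n) - E.posteriorVar c).toNNReal) :=
    measurable_lintegral_gaussianReal (f := fun q : (EuclideanSpace ℝ (Fin K) × Block n) × ℝ =>
      f (h.extend n (E.observe q.1.1 q.1.2), q.2)) (by fun_prop) measurable_const (by fun_prop)
  rw [lintegral_gaussianReal _ _ (by fun_prop),
    InfoEnv.lintegral_posteriorLaw h hR.lintegral_prod_right']
  refine Eq.trans (lintegral_congr fun a => ?_) (hsim.trans (lintegral_congr fun z =>
    lintegral_congr fun e => ?_))
  · rw [← (Tape.measurePreserving_block E n).lintegral_comp (by fun_prop)]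
    simp only [simStep, add_sub_cancel_left, m, n]
  · rw [InfoEnv.observe_add, InfoEnv.postMean_extend_observe, PiLp.add_apply,
      lintegral_gaussianReal _ _ (by fun_prop), lintegral_gaussianReal (m 0 + _) _ (by fun_prop)]
    simp only [add_assoc, m]

/-- The three sources of randomness of one simulated period: the actual posterior mean before the
period, its change in the period, and the random numbers of the period. -/
lemma lintegral_lintegral_simStep (hV : E.V₀.PosDef) (hσ : ∀ k, 0 < E.sigmaSq k)
    (hφ : φ.IsMoreInformative E) (h : History K t) {f : History K (t + 1) × ℝ → ℝ≥0∞}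
    (hf : Measurable f) :
    ∫⁻ m, ∫⁻ x, ∫⁻ w, f (s.simStep E μ₀ w h x (φ.nextPlan h (s.acquire t h)), x) ∂E.tapeLaw
        ∂(gaussianReal m (E.posteriorVar (φ.plan h) -
          E.posteriorVar (φ.nextPlan h (s.acquire t h))).toNNReal)
        ∂(gaussianReal (E.postMean μ₀ h 0)
          (E.posteriorVar h.counts - E.posteriorVar (φ.plan h)).toNNReal) =
      ∫⁻ θ, ∫⁻ e, ∫⁻ x, f (h.extend (s.acquire t h) (E.observe θ e), x)
          ∂(gaussianReal (E.postMean μ₀ (h.extend (s.acquire t h) (E.observe θ e)) 0)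
            (E.posteriorVar (h.extend (s.acquire t h) (E.observe θ e)).counts -
              E.posteriorVar (φ.plan (h.extend (s.acquire t h) (E.observe θ e)))).toNNReal)
        ∂(E.blockNoise (s.acquire t h)) ∂(E.posteriorLaw μ₀ h) := by
  have hnext : E.posteriorVar (φ.nextPlan h (s.acquire t h)) ≤ E.posteriorVar (φ.plan h) :=
    InfoEnv.posteriorVar_antitone hV le_self_add
  rw [lintegral_lintegral_gaussianReal _ _ _ (by fun_prop),
    toNNReal_sub_add_toNNReal_sub (hφ h) hnext,
    lintegral_simStep hV hσ _ (hφ.posteriorVar_nextPlan_le _ _) hf]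
  simp only [History.counts_extend, SamplingRule.plan_extend]

/-- The random numbers of the last period are independent of everything before. -/
lemma lintegral_simulatedHistory_succ (t : ℕ) {f : History K (t + 1) × ℝ → ℝ≥0∞}
    (hf : Measurable f) :
    ∫⁻ ξ, ∫⁻ ω, f (s.simulatedHistory E φ μ₀ ξ ω (t + 1), s.simMean E φ μ₀ ξ ω (t + 1))
        ∂(law E μ₀) ∂E.tapesLaw =
      ∫⁻ ξ, ∫⁻ ω, ∫⁻ w, f (s.simStep E μ₀ w (s.simulatedHistory E φ μ₀ ξ ω t)
          (s.simMean E φ μ₀ ξ ω (t + 1)) (φ.nextPlan (s.simulatedHistory E φ μ₀ ξ ω t)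
            (s.acquire t (s.simulatedHistory E φ μ₀ ξ ω t))), s.simMean E φ μ₀ ξ ω (t + 1))
        ∂E.tapeLaw ∂(law E μ₀) ∂E.tapesLaw := by
  have hm : Measurable fun p : (ℕ → Tape K) × Outcome K =>
      f (s.simulatedHistory E φ μ₀ p.1 p.2 (t + 1), s.simMean E φ μ₀ p.1 p.2 (t + 1)) := by
    fun_prop
  rw [lintegral_infinitePi_update _ t hm.lintegral_prod_right']
  refine lintegral_congr fun ξ => ?_
  have hne (w : Tape K) (i : ℕ) (hi : i < t) : Function.update ξ t w i = ξ i :=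
    Function.update_of_ne hi.ne w ξ
  have hmean (w : Tape K) (ω : Outcome K) :
      s.simMean E φ μ₀ (Function.update ξ t w) ω (t + 1) = s.simMean E φ μ₀ ξ ω (t + 1) :=
    simMean_congr (fun i hi => hne w i (Nat.lt_of_succ_lt_succ hi)) ω
  have hpast (w : Tape K) (ω : Outcome K) :
      s.simulatedHistory E φ μ₀ (Function.update ξ t w) ω t = s.simulatedHistory E φ μ₀ ξ ω t :=
    simulatedHistory_congr (hne w) ω
  simp only [simulatedHistory_succ, hmean, hpast, Function.update_self]
  exact lintegral_lintegral_swap (Measurable.aemeasurable (by fun_prop))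

lemma lintegral_simMean_succ (hV : E.V₀.PosDef) (hσ : ∀ k, 0 < E.sigmaSq k) (ξ : ℕ → Tape K)
    (t : ℕ) {f : History K t × ℝ → ℝ≥0∞} (hf : Measurable f) :
    ∫⁻ ω, f (s.simulatedHistory E φ μ₀ ξ ω t, s.simMean E φ μ₀ ξ ω (t + 1)) ∂(law E μ₀) =
      ∫⁻ ω, ∫⁻ x, f (s.simulatedHistory E φ μ₀ ξ ω t, x)
        ∂(gaussianReal (s.simMean E φ μ₀ ξ ω t)
          (E.posteriorVar (φ.plan (s.simulatedHistory E φ μ₀ ξ ω t)) -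
            E.posteriorVar (φ.nextPlan (s.simulatedHistory E φ μ₀ ξ ω t)
              (s.acquire t (s.simulatedHistory E φ μ₀ ξ ω t)))).toNNReal) ∂(law E μ₀) := by
  have h := (s.simulation E φ μ₀ ξ).lintegral_postMean_succ hV hσ μ₀ t
    (f := fun p => f (s.simHist E μ₀ ξ p.1, p.2)) (by fun_prop)
  simp only [acquire_history_simulation, counts_history_simulation] at h
  exact h

lemma lintegral_simulatedHistory (hV : E.V₀.PosDef) (hσ : ∀ k, 0 < E.sigmaSq k)
    (hφ : φ.IsMoreInformative E) (t : ℕ) {f : History K t × ℝ → ℝ≥0∞} (hf : Measurable f) :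
    ∫⁻ ξ, ∫⁻ ω, f (s.simulatedHistory E φ μ₀ ξ ω t, s.simMean E φ μ₀ ξ ω t)
        ∂(law E μ₀) ∂E.tapesLaw =
      ∫⁻ ω, ∫⁻ x, f (s.history E ω t, x)
        ∂(gaussianReal (E.postMean μ₀ (s.history E ω t) 0)
          (E.posteriorVar (s.history E ω t).counts -
            E.posteriorVar (φ.plan (s.history E ω t))).toNNReal) ∂(law E μ₀) := by
  induction t with
  | zero =>
    have hf₀ : Measurable fun x => f ((Fin.elim0 : History K 0), x) := by fun_prop
    simp only [Subsingleton.elim (simulatedHistory _ _ _ _ _ _ 0) (Fin.elim0 : History K 0),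
      Subsingleton.elim (history _ _ _ 0) (Fin.elim0 : History K 0), simMean,
      SamplingRule.plan, History.counts_zero, sub_self, Real.toNNReal_zero,
      gaussianReal_zero_var, lintegral_dirac' _ hf₀,
      lintegral_const, measure_univ, mul_one]
  | succ t ih =>
    set f₁ : History K t × ℝ → ℝ≥0∞ := fun p =>
      ∫⁻ w, f (s.simStep E μ₀ w p.1 p.2 (φ.nextPlan p.1 (s.acquire t p.1)), p.2) ∂E.tapeLaw
    have hf₁ : Measurable f₁ := by fun_prop
    have hstep := lintegral_congr (μ := E.tapesLaw) fun ξ =>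
      lintegral_simMean_succ (s := s) (φ := φ) (μ₀ := μ₀) hV hσ ξ t hf₁
    have hlast : Measurable fun h : History K (t + 1) => ∫⁻ x, f (h, x)
        ∂(gaussianReal (E.postMean μ₀ h 0)
          (E.posteriorVar h.counts - E.posteriorVar (φ.plan h)).toNNReal) :=
      measurable_lintegral_gaussianReal (by fun_prop) (by fun_prop) hf
    rw [lintegral_simulatedHistory_succ t hf, hstep, s.lintegral_history_block hV hσ μ₀ t hlast,
      ih (f := fun p => ∫⁻ x, f₁ (p.1, x) ∂(gaussianReal p.2 (E.posteriorVar (φ.plan p.1) -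
        E.posteriorVar (φ.nextPlan p.1 (s.acquire t p.1))).toNNReal))
        (measurable_lintegral_gaussianReal
          (f := fun p : (History K t × ℝ) × ℝ => f₁ (p.1.1, p.2))
          (by fun_prop) (by fun_prop) (by fun_prop))]
    exact lintegral_congr fun ω => lintegral_lintegral_simStep hV hσ hφ _ hf

lemma lintegral_simulatedHistory_state (hV : E.V₀.PosDef) (hσ : ∀ k, 0 < E.sigmaSq k)
    (hφ : φ.IsMoreInformative E) (t : ℕ) {f : History K t × ℝ → ℝ≥0∞} (hf : Measurable f) :
    ∫⁻ ξ, ∫⁻ ω, f (s.simulatedHistory E φ μ₀ ξ ω t, ω.1 0) ∂(law E μ₀) ∂E.tapesLaw =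
      ∫⁻ ω, f (s.history E ω t, ω.1 0) ∂(law E μ₀) := by
  have hsim (ξ : ℕ → Tape K) : ∫⁻ ω, f (s.simulatedHistory E φ μ₀ ξ ω t, ω.1 0) ∂(law E μ₀) =
      ∫⁻ ω, ∫⁻ x, f (s.simulatedHistory E φ μ₀ ξ ω t, x) ∂(gaussianReal (s.simMean E φ μ₀ ξ ω t)
        (E.posteriorVar (φ.plan (s.simulatedHistory E φ μ₀ ξ ω t))).toNNReal) ∂(law E μ₀) := by
    refine ((s.simulation E φ μ₀ ξ).lintegral_history hV hσ μ₀ t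
      (f := fun p => f (s.simHist E μ₀ ξ p.1, p.2 0)) (by fun_prop)).trans
      (lintegral_congr fun ω => ?_)
    refine (InfoEnv.lintegral_posteriorLaw_zero hV _
      (f := fun x => f (s.simulatedHistory E φ μ₀ ξ ω t, x)) (by fun_prop)).trans ?_
    rw [counts_history_simulation, simMean]
  simp_rw [hsim]
  rw [lintegral_simulatedHistory hV hσ hφ t (f := fun p => ∫⁻ x, f (p.1, x)
      ∂(gaussianReal p.2 (E.posteriorVar (φ.plan p.1)).toNNReal))
      (measurable_lintegral_gaussianReal (f := fun p : (History K t × ℝ) × ℝ => f (p.1.1, p.2))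
        (by fun_prop) (by fun_prop) (by fun_prop)),
    s.lintegral_history hV hσ μ₀ t (f := fun p => f (p.1, p.2 0)) (by fun_prop)]
  refine lintegral_congr fun ω => ?_
  dsimp only
  rw [lintegral_lintegral_gaussianReal _ _ _ (by fun_prop),
    ← Real.toNNReal_add (sub_nonneg.2 (hφ _)) (InfoEnv.posteriorVar_pos hV _).le, sub_add_cancel]
  exact (InfoEnv.lintegral_posteriorLaw_zero hV _
    (f := fun x => f (s.history E ω t, x)) (by fun_prop)).symm

end Strategy

end SignalAcquisition

namespace SignalAcquisition

section Paths

variable {K : ℕ}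

namespace History

/-- A sequence of histories, one for each number of periods, that extend one another. -/
def IsPath (H : (t : ℕ) → History K t) : Prop := ∀ t, (H (t + 1)).init = H t

lemma IsPath.apply_castLE {H : (t : ℕ) → History K t} (hH : IsPath H) {t T : ℕ} (h : t ≤ T)
    (i : Fin t) : H T (Fin.castLE h i) = H t i := by
  induction T, h using Nat.le_induction with
  | base => rfl
  | succ T h ih => rw [← ih, ← hH T]; rfl

/-- The initial segments, of the lengths in `I`, of a history that is long enough. Each of them is
paired with the second argument. -/
def segments (I : Finset ℕ) (p : History K (I.sup id) × ℝ) : (i : I) → History K i × ℝ :=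
  fun i => (fun j => p.1 (Fin.castLE (Finset.le_sup (f := id) i.2) j), p.2)

lemma measurable_segments (I : Finset ℕ) : Measurable (segments (K := K) I) := by
  unfold segments
  fun_prop

lemma IsPath.restrict_eq_segments {H : (t : ℕ) → History K t} (hH : IsPath H) (x : ℝ)
    (I : Finset ℕ) :
    I.restrict (fun t => (H t, x)) = segments I (H (I.sup id), x) :=
  funext fun _ => Prod.ext (funext fun j => (hH.apply_castLE _ j).symm) rfl

lemma map_path_eq {Ω₁ Ω₂ : Type*} [MeasurableSpace Ω₁] [MeasurableSpace Ω₂] {μ₁ : Measure Ω₁}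
    {μ₂ : Measure Ω₂} [IsFiniteMeasure μ₁] {H₁ : Ω₁ → (t : ℕ) → History K t}
    {H₂ : Ω₂ → (t : ℕ) → History K t} {x₁ : Ω₁ → ℝ} {x₂ : Ω₂ → ℝ}
    (hm₁ : ∀ t, Measurable fun ω => H₁ ω t) (hm₂ : ∀ t, Measurable fun ω => H₂ ω t)
    (hx₁ : Measurable x₁) (hx₂ : Measurable x₂) (hH₁ : ∀ ω, IsPath (H₁ ω))
    (hH₂ : ∀ ω, IsPath (H₂ ω))
    (hlaw : ∀ t, μ₁.map (fun ω => (H₁ ω t, x₁ ω)) = μ₂.map (fun ω => (H₂ ω t, x₂ ω))) :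
    μ₁.map (fun ω t => (H₁ ω t, x₁ ω)) = μ₂.map (fun ω t => (H₂ ω t, x₂ ω)) := by
  refine IsProjectiveLimit.unique
    (P := fun I : Finset ℕ => (μ₁.map fun ω t => (H₁ ω t, x₁ ω)).map I.restrict)
    (fun _ => rfl) fun I => ?_
  beta_reduce
  rw [Measure.map_map (Finset.measurable_restrict I) (by fun_prop),
    Measure.map_map (Finset.measurable_restrict I) (by fun_prop)]
  have h₁ : (I.restrict ∘ fun ω t => (H₁ ω t, x₁ ω)) =
      segments I ∘ fun ω => (H₁ ω (I.sup id), x₁ ω) :=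
    funext fun ω => (hH₁ ω).restrict_eq_segments (x₁ ω) I
  have h₂ : (I.restrict ∘ fun ω t => (H₂ ω t, x₂ ω)) =
      segments I ∘ fun ω => (H₂ ω (I.sup id), x₂ ω) :=
    funext fun ω => (hH₂ ω).restrict_eq_segments (x₂ ω) I
  rw [h₁, h₂, ← Measure.map_map (measurable_segments I) (by fun_prop),
    ← Measure.map_map (measurable_segments I) (by fun_prop), hlaw]

end History

end Paths

section Averaging

lemma coe_sub_coe_le_coe_sub_coe {a b c d : ℝ≥0∞} (hb : b ≠ ∞) (hc : c ≠ ∞)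
    (h : a + d ≤ c + b) : (a : EReal) - b ≤ (c : EReal) - d := by
  have had : a + d ≠ ∞ := ne_top_of_le_ne_top (ENNReal.add_ne_top.2 ⟨hc, hb⟩) h
  obtain ⟨ha, hd⟩ := ENNReal.add_ne_top.1 had
  lift a to ℝ≥0 using ha
  lift b to ℝ≥0 using hb
  lift c to ℝ≥0 using hc
  lift d to ℝ≥0 using hd
  have hreal : (a : ℝ) + d ≤ c + b := by exact_mod_cast h
  have hsub : (a : ℝ) - b ≤ c - d := by linarith
  simp only [EReal.coe_nnreal_eq_coe_real]
  exact_mod_cast hsub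

lemma coe_sub_coe_le_sub_add {g : ℝ} {a b c : ℝ≥0∞} (hc : c ≠ ∞) (h : a ≤ b + c) :
    (g : EReal) - b ≤ (g : EReal) - a + c := by
  obtain rfl | hb := eq_or_ne b ∞
  · rw [EReal.coe_ennreal_top, EReal.sub_top]
    exact bot_le
  have ha : a ≠ ∞ := ne_top_of_le_ne_top (ENNReal.add_ne_top.2 ⟨hb, hc⟩) h
  lift a to ℝ≥0 using ha
  lift b to ℝ≥0 using hb
  lift c to ℝ≥0 using hc
  have hreal : (a : ℝ) ≤ b + c := by exact_mod_cast h
  have hsub : g - b ≤ g - a + c := by linarith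
  simp only [EReal.coe_nnreal_eq_coe_real]
  exact_mod_cast hsub

variable {X : Type*} [MeasurableSpace X] {μ : Measure X} [IsProbabilityMeasure μ]
  {p n : X → ℝ≥0∞} {a b : ℝ≥0∞}

lemma exists_add_le_add (hp : Measurable p) (hn : Measurable n) (hb : b ≠ ∞)
    (hpi : ∫⁻ x, p x ∂μ ≠ ∞) (hap : a ≤ ∫⁻ x, p x ∂μ) (hnb : ∫⁻ x, n x ∂μ ≤ b) :
    ∃ x, p x < ∞ ∧ a + n x ≤ p x + b := by
  by_contra! hlt
  have hs := lintegral_strict_mono (IsProbabilityMeasure.ne_zero μ) (f := fun x => p x + b)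
    (g := fun x => a + n x) (hn.const_add a).aemeasurable
    (by simp [lintegral_add_right _ measurable_const, hpi, hb]) ((ae_lt_top hp hpi).mono hlt)
  rw [lintegral_add_right _ measurable_const, lintegral_add_left measurable_const] at hs
  simp only [lintegral_const, measure_univ, mul_one] at hs
  exact hs.not_ge (add_le_add hap hnb)

lemma exists_coe_sub_coe_le (hp : Measurable p) (hn : Measurable n)
    (hpi : ∫⁻ x, p x ∂μ ≠ ∞) (hap : a ≤ ∫⁻ x, p x ∂μ) (hnb : ∫⁻ x, n x ∂μ ≤ b) :
    ∃ x, p x < ∞ ∧ (a : EReal) - b ≤ (p x : EReal) - n x := by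
  obtain rfl | hb := eq_or_ne b ∞
  · obtain ⟨x, hx⟩ := (ae_lt_top hp hpi).exists
    refine ⟨x, hx, ?_⟩
    rw [EReal.coe_ennreal_top, EReal.sub_top]
    exact bot_le
  · obtain ⟨x, hx, hle⟩ := exists_add_le_add hp hn hb hpi hap hnb
    exact ⟨x, hx, coe_sub_coe_le_coe_sub_coe hb hx.ne hle⟩

end Averaging

section Costs

variable {κ : ℕ → ℝ≥0∞} {B D : ℕ} {M : ℝ≥0∞}

lemma cost_add_mul_min_le {d : ℝ≥0∞} (hd : d ≤ 1) {N l l' : ℕ}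
    (hl : l' + N = l + boost B D N l) (hM : 1 ≤ N → N < B → κ N ≤ M) :
    d * κ N + M * (min l D : ℕ) ≤ d * κ (boost B D N l) + M * (min l' D : ℕ) := by
  by_cases hN : 1 ≤ N ∧ N < B ∧ l < D
  · have hboost : boost B D N l = B := if_pos hN
    have hmin : 1 + min l D ≤ min l' D := by omega
    calc d * κ N + M * (min l D : ℕ)
        ≤ 1 * M + M * (min l D : ℕ) := by gcongr; exact hM hN.1 hN.2.1
      _ = M * (1 + min l D : ℕ) := by push_cast; ring
      _ ≤ M * (min l' D : ℕ) := by gcongr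
      _ ≤ d * κ (boost B D N l) + M * (min l' D : ℕ) := le_add_self
  · have hboost : boost B D N l = N := if_neg hN
    rw [hboost] at hl ⊢
    rw [Nat.add_right_cancel hl]

/-- Every period with a boosted intensity increases the lead, and there is no such period once the
lead is `D`. -/
lemma tsum_cost_le {d : ℝ≥0∞} (hd : d ≤ 1) {N lead : ℕ → ℕ}
    (hlead : ∀ t, lead (t + 1) + N t = lead t + boost B D (N t) (lead t))
    (hM : ∀ t, 1 ≤ N t → N t < B → κ (N t) ≤ M) :
    ∑' t, d ^ t * κ (N t) ≤ ∑' t, d ^ t * κ (boost B D (N t) (lead t)) + M * D := by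
  have hpart (T : ℕ) : ∑ t ∈ Finset.range T, d ^ t * κ (N t) ≤
      ∑ t ∈ Finset.range T, d ^ t * κ (boost B D (N t) (lead t)) + M * (min (lead T) D : ℕ) := by
    induction T with
    | zero => simp
    | succ T ih =>
      have hstep := cost_add_mul_min_le (pow_le_one' hd T) (hlead T) (hM T)
      rw [Finset.sum_range_succ, Finset.sum_range_succ, add_assoc]
      refine (add_le_add_left ih _).trans ?_
      rw [add_assoc, add_comm (M * _)]
      gcongr
  refine ENNReal.tsum_le_of_sum_range_le fun T => (hpart T).trans ?_
  gcongr
  · exact ENNReal.sum_le_tsum _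
  · exact min_le_right _ _

end Costs

end SignalAcquisition

namespace SignalAcquisition

variable {K : ℕ}

section MyopicRule

variable {B D t : ℕ}

/-- The number of signals by which a simulation that follows `φ` is ahead of the simulated history
`h`. The subtraction is truncated, but in an `IsSimulationInvariant` the simulation never falls
behind. -/
def SamplingRule.lead (φ : SamplingRule K) (h : History K t) : ℕ :=
  ∑ k, φ.plan h k - ∑ k, h.counts k

variable [NeZero K] {E : InfoEnv K} {R : (Fin K → ℕ) → (Fin K → ℕ) → Prop}

/-- The sampling rule of a simulation that chooses signals myopically, with boosted intensities. -/
noncomputable def InfoEnv.myopicRule (E : InfoEnv K) (B D : ℕ) : SamplingRule K := fun c q n =>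
  E.myopicBlock c (boost B D (∑ k, n k) (∑ k, c k - ∑ k, q k))

lemma InfoEnv.sum_myopicRule_plan (h : History K t) (n : Fin K → ℕ) :
    ∑ k, E.myopicRule B D ((E.myopicRule B D).plan h) h.counts n k =
      boost B D (∑ k, n k) ((E.myopicRule B D).lead h) :=
  InfoEnv.sum_myopicBlock _ _

namespace InfoEnv.IsSimulationInvariant

lemma plan_counts (hR : E.IsSimulationInvariant B D R) (h : History K t) :
    R ((E.myopicRule B D).plan h) h.counts := by
  induction t with
  | zero => rw [History.counts_zero]; exact hR.zero
  | succ t ih => rw [History.counts_succ]; exact hR.step _ _ _ (ih h.init)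

lemma isMoreInformative (hR : E.IsSimulationInvariant B D R) :
    (E.myopicRule B D).IsMoreInformative E :=
  fun h => hR.posteriorVar_le _ _ (hR.plan_counts h)

lemma lead_extend (hR : E.IsSimulationInvariant B D R) (h : History K t) (n : Fin K → ℕ)
    (y : Block n) :
    (E.myopicRule B D).lead (h.extend n y) + ∑ k, n k =
      (E.myopicRule B D).lead h + boost B D (∑ k, n k) ((E.myopicRule B D).lead h) := by
  have hsum := hR.sum_le _ _ (hR.plan_counts h)
  have hsum' := hR.sum_le _ _ (hR.plan_counts (h.extend n y))
  rw [← sum_myopicRule_plan h n, SamplingRule.lead, SamplingRule.lead]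
  rw [SamplingRule.plan_extend, SamplingRule.nextPlan, History.counts_extend] at hsum' ⊢
  simp only [Pi.add_apply, Finset.sum_add_distrib] at hsum' ⊢
  omega

end InfoEnv.IsSimulationInvariant

lemma Strategy.myopic_simulation {A : ℕ → Type u} [∀ t, MeasurableSpace (A t)]
    (s : Strategy K A) (E : InfoEnv K) (B D : ℕ) (μ₀ : EuclideanSpace ℝ (Fin K))
    (ξ : ℕ → Tape K) : (s.simulation E (E.myopicRule B D) μ₀ ξ).Myopic E := fun _ h _ hm =>
  InfoEnv.posteriorVar_add_myopicBlock_le h.counts (hm.trans (InfoEnv.sum_myopicBlock _ _))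

end MyopicRule

namespace DecisionProblem

variable {A : ℕ → Type u} [∀ t, MeasurableSpace (A t)]

section Costs

/-- The sum of the finite flow costs of the intensities below `B`, which bounds what is saved by
boosting an intensity of finite cost to `B`. -/
noncomputable def finiteCost (P : DecisionProblem K A) (B : ℕ) : ℝ≥0∞ :=
  ∑ n ∈ Finset.range B with P.κ n ≠ ∞, P.κ n

variable {P : DecisionProblem K A} {B : ℕ}

lemma finiteCost_ne_top : P.finiteCost B ≠ ∞ :=
  ENNReal.sum_ne_top.2 fun _ hn => (Finset.mem_filter.1 hn).2

lemma le_finiteCost {n : ℕ} (hn : n < B) (hfin : P.κ n ≠ ∞) : P.κ n ≤ P.finiteCost B :=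
  Finset.single_le_sum (f := P.κ) (fun _ _ => zero_le)
    (Finset.mem_filter.2 ⟨Finset.mem_range.2 hn, hfin⟩)

end Costs

section Payoffs

variable {α : Type*} [MeasurableSpace α]

/-- The payoff, as a function of the sequence of histories, each paired with the payoff-relevant
state. -/
noncomputable def pathPayoff (P : DecisionProblem K A) (s : Strategy K A)
    (Z : (t : ℕ) → History K t × ℝ) : EReal :=
  ((P.U (fun t => s.act t (Z (t + 1)).1) (Z 0).2 : ℝ) : EReal) -
    ((∑' t, ENNReal.ofReal P.δ ^ t * P.κ (∑ k, s.acquire t (Z t).1 k) : ℝ≥0∞) : EReal)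

lemma measurable_sub_cost (P : DecisionProblem K A) {a : α → (t : ℕ) → A t}
    (ha : ∀ t, Measurable fun ω => a ω t) {x : α → ℝ} (hx : Measurable x)
    {n : α → ℕ → Fin K → ℕ} (hn : ∀ t, Measurable fun ω => n ω t) :
    Measurable fun ω => ((P.U (a ω) (x ω) : ℝ) : EReal) -
      ((∑' t, ENNReal.ofReal P.δ ^ t * P.κ (∑ k, n ω t k) : ℝ≥0∞) : EReal) := by
  have : Measurable fun ω => P.U (a ω) (x ω) :=
    P.measurable_U.comp ((measurable_pi_lambda _ ha).prodMk hx)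
  have : Measurable fun ω => ∑' t, ENNReal.ofReal P.δ ^ t * P.κ (∑ k, n ω t k) :=
    Measurable.tsum fun t => ((Measurable.of_discrete (f := fun m : Fin K → ℕ =>
      P.κ (∑ k, m k))).comp (hn t)).const_mul _
  fun_prop

lemma measurable_pathPayoff (P : DecisionProblem K A) (s : Strategy K A) :
    Measurable (P.pathPayoff s) :=
  P.measurable_sub_cost (fun t => (s.measurable_act t).comp (by fun_prop)) (by fun_prop)
    fun t => by fun_prop

variable [NeZero K]

/-- The payoff that `s` would have had if the simulated history were the actual one. -/
noncomputable def simulatedPayoff (P : DecisionProblem K A) (E : InfoEnv K) (φ : SamplingRule K)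
    (s : Strategy K A) (ξ : ℕ → Tape K) (ω : Outcome K) : EReal :=
  P.pathPayoff s fun t => (s.simulatedHistory E φ P.μ₀ ξ ω t, ω.1 0)

variable {P : DecisionProblem K A} {s : Strategy K A} {E : InfoEnv K} {φ : SamplingRule K}

@[fun_prop]
lemma measurable_simulatedPayoff {ξ : α → ℕ → Tape K} {ω : α → Outcome K} (hξ : Measurable ξ)
    (hω : Measurable ω) : Measurable fun a => P.simulatedPayoff E φ s (ξ a) (ω a) :=
  (P.measurable_pathPayoff s).comp (by fun_prop)

@[fun_prop]
lemma measurable_payoff_simulation {ξ : α → ℕ → Tape K} {ω : α → Outcome K} (hξ : Measurable ξ)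
    (hω : Measurable ω) :
    Measurable fun a => P.payoff E (s.simulation E φ P.μ₀ (ξ a)) (ω a) :=
  P.measurable_sub_cost
    (fun t => (s.measurable_act t).comp (Strategy.measurable_simulatedHistory hξ hω))
    (by fun_prop) fun t => Strategy.measurable_simAcquire hξ (by fun_prop)

end Payoffs

variable [NeZero K] {P : DecisionProblem K A} {s : Strategy K A} {E : InfoEnv K}
  {φ : SamplingRule K} {B D : ℕ} {R : (Fin K → ℕ) → (Fin K → ℕ) → Prop}

lemma totalCost_simulation (ξ : ℕ → Tape K) (ω : Outcome K) :
    P.totalCost E (s.simulation E (E.myopicRule B D) P.μ₀ ξ) ω = ∑' t, ENNReal.ofReal P.δ ^ t *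
      P.κ (boost B D
        (∑ k, s.acquire t (s.simulatedHistory E (E.myopicRule B D) P.μ₀ ξ ω t) k)
        ((E.myopicRule B D).lead (s.simulatedHistory E (E.myopicRule B D) P.μ₀ ξ ω t))) := by
  refine tsum_congr fun t => ?_
  rw [Strategy.acquire_history_simulation, Strategy.counts_history_simulation,
    InfoEnv.sum_myopicRule_plan]

lemma simulatedPayoff_le (hκ : ∀ N, 1 ≤ N → N < B → P.κ B ≤ P.κ N) (ξ : ℕ → Tape K)
    (ω : Outcome K) :
    P.simulatedPayoff E (E.myopicRule B D) s ξ ω ≤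
      P.payoff E (s.simulation E (E.myopicRule B D) P.μ₀ ξ) ω := by
  refine EReal.sub_le_sub le_rfl (EReal.coe_ennreal_le_coe_ennreal_iff.2 ?_)
  rw [totalCost_simulation]
  gcongr with t
  unfold boost
  split_ifs with hN
  · exact hκ _ hN.1 hN.2.1
  · exact le_rfl

lemma payoff_simulation_le (hR : E.IsSimulationInvariant B D R) (ξ : ℕ → Tape K) (ω : Outcome K)
    (hfin : (∀ N, 1 ≤ N → N < B → P.κ N ≠ ∞) ∨
      P.simulatedPayoff E (E.myopicRule B D) s ξ ω ≠ ⊥) :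
    P.payoff E (s.simulation E (E.myopicRule B D) P.μ₀ ξ) ω ≤
      P.simulatedPayoff E (E.myopicRule B D) s ξ ω + ((P.finiteCost B * D : ℝ≥0∞) : EReal) := by
  refine coe_sub_coe_le_sub_add
    (ENNReal.mul_ne_top finiteCost_ne_top (ENNReal.natCast_ne_top D)) ?_
  rw [totalCost_simulation]
  refine tsum_cost_le (ENNReal.ofReal_le_one.2 P.δ_le_one) (fun t => ?_) fun t h₁ h₂ =>
    le_finiteCost h₂ ?_
  · rw [Strategy.simulatedHistory_succ]
    exact hR.lead_extend _ _ _
  obtain hfin | hfin := hfin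
  · exact hfin _ h₁ h₂
  · contrapose! hfin
    have hcost : ∑' t, ENNReal.ofReal P.δ ^ t * P.κ (∑ k, s.acquire t
        (s.simulatedHistory E (E.myopicRule B D) P.μ₀ ξ ω t) k) = ∞ := by
      refine ENNReal.tsum_eq_top_of_eq_top ⟨t, ?_⟩
      rw [hfin, ENNReal.mul_top (pow_ne_zero _ (ENNReal.ofReal_pos.2 P.δ_pos).ne')]
    rw [simulatedPayoff, pathPayoff]
    simp only [hcost, EReal.coe_ennreal_top, EReal.sub_top]

lemma lintegral_simulatedPayoff (hV : E.V₀.PosDef) (hσ : ∀ k, 0 < E.sigmaSq k)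
    (hφ : φ.IsMoreInformative E) {f : EReal → ℝ≥0∞} (hf : Measurable f) :
    ∫⁻ p, f (P.simulatedPayoff E φ s p.1 p.2) ∂(E.tapesLaw.prod (law E P.μ₀)) =
      ∫⁻ ω, f (P.payoff E s ω) ∂(law E P.μ₀) := by
  have hpath := History.map_path_eq (μ₁ := E.tapesLaw.prod (law E P.μ₀)) (μ₂ := law E P.μ₀)
    (H₁ := fun p => s.simulatedHistory E φ P.μ₀ p.1 p.2) (H₂ := fun ω => s.history E ω)
    (x₁ := fun p => p.2.1 0) (x₂ := fun ω => ω.1 0)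
    (fun t => by fun_prop) (fun t => by fun_prop) (by fun_prop) (by fun_prop)
    (fun p t => by rw [Strategy.simulatedHistory_succ]; exact History.init_extend _ _ _)
    (fun ω t => s.init_history_succ E ω t) fun t => Measure.ext_of_lintegral _ fun g hg => by
      rw [lintegral_map hg (by fun_prop), lintegral_map hg (by fun_prop),
        lintegral_prod _ (Measurable.aemeasurable (by fun_prop))]
      exact Strategy.lintegral_simulatedHistory_state hV hσ hφ t hg
  have hpay : Measurable fun Z => f (P.pathPayoff s Z) := hf.comp (P.measurable_pathPayoff s)
  calc ∫⁻ p, f (P.simulatedPayoff E φ s p.1 p.2) ∂(E.tapesLaw.prod (law E P.μ₀))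
      = ∫⁻ Z, f (P.pathPayoff s Z) ∂((E.tapesLaw.prod (law E P.μ₀)).map
          fun p t => (s.simulatedHistory E φ P.μ₀ p.1 p.2 t, p.2.1 0)) :=
        (lintegral_map hpay (by fun_prop)).symm
    _ = ∫⁻ Z, f (P.pathPayoff s Z) ∂((law E P.μ₀).map fun ω t => (s.history E ω t, ω.1 0)) := by
        rw [hpath]
    _ = ∫⁻ ω, f (P.payoff E s ω) ∂(law E P.μ₀) := lintegral_map hpay (by fun_prop)

lemma ae_toENNReal_payoff_simulation_le (hV : E.V₀.PosDef) (hσ : ∀ k, 0 < E.sigmaSq k)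
    (hR : E.IsSimulationInvariant B D R)
    (hfin : (∀ N, 1 ≤ N → N < B → P.κ N ≠ ∞) ∨
      ∫⁻ ω, (-P.payoff E s ω).toENNReal ∂(law E P.μ₀) ≠ ∞) :
    ∀ᵐ p ∂(E.tapesLaw.prod (law E P.μ₀)),
      (P.payoff E (s.simulation E (E.myopicRule B D) P.μ₀ p.1) p.2).toENNReal ≤
        (P.simulatedPayoff E (E.myopicRule B D) s p.1 p.2).toENNReal + P.finiteCost B * D := by
  have hae : ∀ᵐ p ∂(E.tapesLaw.prod (law E P.μ₀)), (∀ N, 1 ≤ N → N < B → P.κ N ≠ ∞) ∨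
      P.simulatedPayoff E (E.myopicRule B D) s p.1 p.2 ≠ ⊥ := by
    obtain hκ | hneg := hfin
    · exact .of_forall fun _ => .inl hκ
    · rw [← lintegral_simulatedPayoff hV hσ hR.isMoreInformative
        (f := fun x => (-x).toENNReal) (by fun_prop)] at hneg
      refine (ae_lt_top (by fun_prop) hneg).mono fun p hp => .inr fun hbot => ?_
      simp [hbot] at hp
  refine hae.mono fun p hp => ?_
  refine (EReal.toENNReal_le_toENNReal (payoff_simulation_le hR p.1 p.2 hp)).trans ?_
  exact EReal.toENNReal_add_le.trans_eq (by rw [EReal.toENNReal_coe])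

lemma lintegral_toENNReal_payoff_simulation_ne_top (hV : E.V₀.PosDef)
    (hσ : ∀ k, 0 < E.sigmaSq k) (hR : E.IsSimulationInvariant B D R) (hs : P.WellDefined E s)
    (hfin : (∀ N, 1 ≤ N → N < B → P.κ N ≠ ∞) ∨
      ∫⁻ ω, (-P.payoff E s ω).toENNReal ∂(law E P.μ₀) ≠ ∞) :
    ∫⁻ p, (P.payoff E (s.simulation E (E.myopicRule B D) P.μ₀ p.1) p.2).toENNReal
      ∂(E.tapesLaw.prod (law E P.μ₀)) ≠ ∞ := by
  refine ne_top_of_le_ne_top ?_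
    (lintegral_mono_ae (ae_toENNReal_payoff_simulation_le hV hσ hR hfin))
  rw [lintegral_add_right _ measurable_const,
    lintegral_simulatedPayoff hV hσ hR.isMoreInformative measurable_ereal_toENNReal]
  simp only [lintegral_const, measure_univ, mul_one]
  exact ENNReal.add_ne_top.2
    ⟨hs.ne, ENNReal.mul_ne_top finiteCost_ne_top (ENNReal.natCast_ne_top D)⟩

lemma exists_simulation_dominating (hV : E.V₀.PosDef) (hσ : ∀ k, 0 < E.sigmaSq k)
    (hR : E.IsSimulationInvariant B D R) (hκ : ∀ N, 1 ≤ N → N < B → P.κ B ≤ P.κ N)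
    (hs : P.WellDefined E s)
    (hfin : (∀ N, 1 ≤ N → N < B → P.κ N ≠ ∞) ∨
      ∫⁻ ω, (-P.payoff E s ω).toENNReal ∂(law E P.μ₀) ≠ ∞) :
    ∃ ξ, P.WellDefined E (s.simulation E (E.myopicRule B D) P.μ₀ ξ) ∧
      P.expectedPayoff E s ≤
        P.expectedPayoff E (s.simulation E (E.myopicRule B D) P.μ₀ ξ) := by
  have hpos : Measurable fun p : (ℕ → Tape K) × Outcome K =>
      (P.payoff E (s.simulation E (E.myopicRule B D) P.μ₀ p.1) p.2).toENNReal := by fun_prop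
  have hneg : Measurable fun p : (ℕ → Tape K) × Outcome K =>
      (-P.payoff E (s.simulation E (E.myopicRule B D) P.μ₀ p.1) p.2).toENNReal := by fun_prop
  refine exists_coe_sub_coe_le (μ := E.tapesLaw) hpos.lintegral_prod_right'
    hneg.lintegral_prod_right' ?_ ?_ ?_
  · rw [← lintegral_prod _ hpos.aemeasurable]
    exact lintegral_toENNReal_payoff_simulation_ne_top hV hσ hR hs hfin
  · rw [← lintegral_prod _ hpos.aemeasurable,
      ← lintegral_simulatedPayoff hV hσ hR.isMoreInformative measurable_ereal_toENNReal]
    exact lintegral_mono fun p => EReal.toENNReal_le_toENNReal (simulatedPayoff_le hκ p.1 p.2)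
  · rw [← lintegral_prod _ hneg.aemeasurable, ← lintegral_simulatedPayoff hV hσ
      hR.isMoreInformative (f := fun x => (-x).toENNReal) (by fun_prop)]
    exact lintegral_mono fun p => EReal.toENNReal_le_toENNReal
      (EReal.neg_le_neg_iff.2 (simulatedPayoff_le hκ p.1 p.2))

lemma exists_myopic_wellDefined (s : Strategy K A) (E : InfoEnv K) {N : ℕ} (hN : P.κ N = ∞) :
    ∃ s' : Strategy K A, s'.Myopic E ∧ P.WellDefined E s' := by
  -- Always acquiring `N` signals costs `∞`, so the positive part of the payoff vanishes.
  refine ⟨{ s with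
    acquire := fun _ h => E.myopicBlock h.counts N
    measurable_acquire := fun _ =>
      (Measurable.of_discrete (f := fun c => E.myopicBlock c N)).comp (by fun_prop) },
    fun t h m hm => ?_, ?_⟩
  · exact InfoEnv.posteriorVar_add_myopicBlock_le _ (hm.trans (InfoEnv.sum_myopicBlock _ _))
  · refine (lintegral_congr fun ω => ?_).trans_lt (lintegral_zero.trans_lt ENNReal.zero_lt_top)
    have hcost : ∑' t, ENNReal.ofReal P.δ ^ t * (∞ : ℝ≥0∞) = ∞ :=
      ENNReal.tsum_eq_top_of_eq_top ⟨0, by simp⟩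
    rw [EReal.toENNReal_eq_zero_iff, payoff, totalCost]
    simp only [InfoEnv.sum_myopicBlock, hN, hcost, EReal.coe_ennreal_top, EReal.sub_top, bot_le]

theorem exists_myopic_dominating (hV : E.V₀.PosDef) (hσ : ∀ k, 0 < E.sigmaSq k)
    (hR : E.IsSimulationInvariant B D R) (hκ : ∀ N, 1 ≤ N → N < B → P.κ B ≤ P.κ N)
    (hs : P.WellDefined E s) :
    ∃ s' : Strategy K A, s'.Myopic E ∧ P.WellDefined E s' ∧
      P.expectedPayoff E s ≤ P.expectedPayoff E s' := by
  by_cases hfin : (∀ N, 1 ≤ N → N < B → P.κ N ≠ ∞) ∨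
      ∫⁻ ω, (-P.payoff E s ω).toENNReal ∂(law E P.μ₀) ≠ ∞
  · obtain ⟨ξ, hξ⟩ := exists_simulation_dominating hV hσ hR hκ hs hfin
    exact ⟨_, s.myopic_simulation E B D P.μ₀ ξ, hξ⟩
  · push Not at hfin
    obtain ⟨⟨N, -, -, hN⟩, hneg⟩ := hfin
    obtain ⟨s', hmyopic, hdef⟩ := exists_myopic_wellDefined s E hN
    refine ⟨s', hmyopic, hdef, ?_⟩
    rw [expectedPayoff, hneg, EReal.coe_ennreal_top, EReal.sub_top]
    exact bot_le

theorem myopicOptimal (P : DecisionProblem K A) (hV : E.V₀.PosDef) (hσ : ∀ k, 0 < E.sigmaSq k)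
    (hR : E.IsSimulationInvariant B D R) (hκ : ∀ N, 1 ≤ N → N < B → P.κ B ≤ P.κ N) :
    P.MyopicOptimal E := by
  refine ⟨fun s hs => exists_myopic_dominating hV hσ hR hκ hs, ?_⟩
  rintro ⟨s, hs, hopt⟩
  obtain ⟨s', hmyopic, hdef, hle⟩ := exists_myopic_dominating hV hσ hR hκ hs
  exact ⟨s', ⟨hdef, fun r hr => (hopt r hr).trans hle⟩, hmyopic⟩

end DecisionProblem

end SignalAcquisition

theorem corollary2_general {K : ℕ} [NeZero K] (E : SignalAcquisition.InfoEnv K)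
    (hV : E.V₀.PosDef) (hσ : ∀ k, 0 < E.sigmaSq k) :
    (E.NonRedundant → ∃ B₀ : ℕ, ∀ B : ℕ, B₀ ≤ B →
      ∀ (A : ℕ → Type u) [∀ t, MeasurableSpace (A t)]
        (P : SignalAcquisition.DecisionProblem K A),
        (∀ N : ℕ, 1 ≤ N → N ≤ B → P.κ B ≤ P.κ N) → P.MyopicOptimal E) ∧
    (E.Separable →
      ∀ (A : ℕ → Type u) [∀ t, MeasurableSpace (A t)]
        (P : SignalAcquisition.DecisionProblem K A), P.MyopicOptimal E) := by
  refine ⟨fun hC => ?_, fun hsep A _ P => ?_⟩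
  · obtain ⟨D, hD⟩ := SignalAcquisition.InfoEnv.exists_simulationInvariant hV hσ hC
    refine ⟨D, fun B hB A _ P hκ => ?_⟩
    obtain ⟨R, hR⟩ := hD B hB
    exact P.myopicOptimal hV hσ hR fun N h₁ h₂ => hκ N h₁ h₂.le
  · have hR := SignalAcquisition.InfoEnv.Separable.isSimulationInvariant hV hσ hsep
    exact P.myopicOptimal hV hσ hR fun N _ hN => absurd hN N.not_lt_zero

theorem corollary2 {K : ℕ} [NeZero K] (E : SignalAcquisition.InfoEnv K)
    (hV : E.V₀.PosDef) (hσ : ∀ k, 0 < E.sigmaSq k) (hC : E.NonRedundant) :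
    (∃ B₀ : ℕ, ∀ B : ℕ, B₀ ≤ B →
      ∀ (A : ℕ → Type u) [∀ t, MeasurableSpace (A t)]
        (P : SignalAcquisition.DecisionProblem K A),
        (∀ N : ℕ, 1 ≤ N → N ≤ B → P.κ B ≤ P.κ N) → P.MyopicOptimal E) ∧
    (E.Separable →
      ∀ (A : ℕ → Type u) [∀ t, MeasurableSpace (A t)]
        (P : SignalAcquisition.DecisionProblem K A), P.MyopicOptimal E) :=
  ⟨(corollary2_general E hV hσ).1 hC, (corollary2_general E hV hσ).2⟩
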